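/- Let $V:\mathbb R\to[0,\infty)$ be a smooth even function with $0<\delta_-\le V''\le\delta_+<\infty$ and $\delta_- /\delta_+>(3/4)^{1/16}$, and let $\beta,\gamma>0$. On $\Omega=(\mathbb R^2)^{\mathbb Z}$, with configurations $\omega=(p_i,r_i)_{i\in\mathbb Z}$, let $\nu_\beta$ be the product probability measure with marginals proportional to $e^{-\beta(p^2/2+V(r))}\,dp\,dr$, and write $\langle f\rangle=\int f\,d\nu_\beta$, $\langle f,g\rangle=\langle fg\rangle$. Let $\tau_j$ be the shift ($\tau_jp_i=p_{i+j}$, $\tau_jr_i=r_{i+j}$) and put $$Y_{i,j}=p_i\partial_{r_j}-V'(r_j)\partial_{p_i},\qquad X_i=Y_{i,i},\qquad \mathcal E_i=\tfrac{p_i^2}{2}+V(r_i),$$ $$L=\sum_{i\in\mathbb Z}(X_i-Y_{i,i+1})+\frac{\gamma}{2}\sum_{i\in\mathbb Z}\bigl(X_i^2+Y_{i,i+1}^2\bigr).$$ Let $\mathcal C$ be the set of smooth local functions (smooth functions of finitely many coordinates $(p_i,r_i)$) that are compactly supported as functions of these coordinates and have zero $\nu_\beta$-average. Let $\tilde{\mathcal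 C}$ be the set of smooth local $f$ such that $f$, $X_if$, $Y_{i,i+1}f$ lie in $L^2(\nu_\beta)$ for all $i$, and let $\mathcal C_0$ be the linear space of finite sums $\sum_i\bigl(X_iF_i+Y_{i,i+1}G_i\bigr)$ with $F_i,G_i\in\tilde{\mathcal C}$. For $g\in\mathcal C$ let $\Gamma_g=\sum_{j}\tau_jg$ (a formal sum; $X_0\Gamma_g$ and $Y_{0,1}\Gamma_g$ are finite sums), and for $h\in\mathcal C_0$ let $$|\!|\!|h|\!|\!|_{-1}^2=\sup_{g\in\mathcal C,\,a\in\mathbb R}\Bigl\{2\sum_{i}\langle g,\tau_ih\rangle+2a\sum_i i\,\langle h,\mathcal E_i\rangle-\frac\gamma2\bigl\langle(a\,p_0V'(r_1)+Y_{0,1}\Gamma_g)^2\bigr\rangle-\frac\gamma2\bigl\langle(X_0\Gamma_g)^2\bigr\rangle\Bigr\}.$$ Then $Lg\in\mathcal C_0$ for every $g\in\mathcal C$, $p_1^2-p_0^2\in\mathcal C_0$, the supremum is finite for every $h\in\mathcal C_0$, and polarization, $\ll g,h\gg_{-1}=\frac14\bigl(|\!|\!|g+h|\!|\!|_{-1}^2-|\!|\!|g-h|\!|\!|_{-1}^2\bigr)$,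 defines a semi-inner product on $\mathcal C_0$ with semi-norm $|\!|\!|\cdot|\!|\!|_{-1}$. Let $\mathcal H_{-1}$ be the Hilbert space obtained by completing the quotient of $\mathcal C_0$ by the kernel of $|\!|\!|\cdot|\!|\!|_{-1}$, and let $\overline{L\mathcal C}$ be the closure in $\mathcal H_{-1}$ of (the image of) $\{Lg:\ g\in\mathcal C\}$. Then $\overline{L\mathcal C}$ is a linear subspace, $$\mathcal H_{-1}=\overline{L\mathcal C}\oplus\mathbb R\,(p_1^2-p_0^2),$$ and for every $g\in\mathcal C_0$ there is a unique $a\in\mathbb R$ such that $g+a(p_1^2-p_0^2)\in\overline{L\mathcal C}$ in $\mathcal H_{-1}$. -/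

import Mathlib

open MeasureTheory

noncomputable section

namespace EnergyChain

/-- Configurations `ω = (p_i, r_i)_{i ∈ ℤ}`: `(ω i).1 = p_i` and `(ω i).2 = r_i`. -/
abbrev Config : Type := ℤ → ℝ × ℝ

/-- The standing assumptions on the potential `V : ℝ → ℝ₊`. -/
structure IsAdmissible (V : ℝ → ℝ) (δm δp : ℝ) : Prop where
  nonneg : ∀ r, 0 ≤ V r
  smooth : ContDiff ℝ (⊤ : ℕ∞) V
  symm : ∀ r, V (-r) = V r
  pos : 0 < δm
  lower : ∀ r, δm ≤ deriv (deriv V) r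
  upper : ∀ r, deriv (deriv V) r ≤ δp
  ratio : (3 / 4 : ℝ) ^ (1 / 16 : ℝ) < δm / δp

/-! ### The grand canonical measure -/

/-- The partition function `Z_β = ∫ exp (-β V(r)) dr`. -/
def partitionZ (V : ℝ → ℝ) (β : ℝ) : ℝ := ∫ r : ℝ, Real.exp (-β * V r)

/-- The one-site Gibbs measure
`exp (-β (p²/2 + V(r))) / (√(2π/β) Z_β) dp dr` on `ℝ²`. -/
def siteMeasure (V : ℝ → ℝ) (β : ℝ) : Measure (ℝ × ℝ) :=
  (volume : Measure (ℝ × ℝ)).withDensity fun x =>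
    ENNReal.ofReal
      (Real.exp (-β * (x.1 ^ 2 / 2 + V x.2)) / (Real.sqrt (2 * Real.pi * β⁻¹) * partitionZ V β))

theorem IsAdmissible.quadratic_le {V : ℝ → ℝ} {δm δp : ℝ} (hV : IsAdmissible V δm δp) (r : ℝ) :
    δm / 2 * r ^ 2 ≤ V r := by
  have hd : Differentiable ℝ V := hV.smooth.differentiable (by simp)
  have hd2 : Differentiable ℝ (deriv V) := by
    have h1 : ContDiff ℝ (⊤ : ℕ∞) (deriv V) := hV.smooth.iterate_deriv 1
    exact h1.differentiable (by simp)
  have e1 : deriv (fun x => V x - δm / 2 * x ^ 2) = fun x => deriv V x - δm * x := by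
    funext x
    have := (hd x).hasDerivAt.sub (((hasDerivAt_id x).pow 2).const_mul (δm / 2))
    refine (this.congr_deriv ?_).deriv
    simp; ring
  have e2 : deriv (fun x => deriv V x - δm * x) = fun x => deriv (deriv V) x - δm := by
    funext x
    have := (hd2 x).hasDerivAt.sub ((hasDerivAt_id x).const_mul δm)
    refine (this.congr_deriv ?_).deriv
    simp
  have hc : ConvexOn ℝ Set.univ (fun x => V x - δm / 2 * x ^ 2) := by
    refine convexOn_univ_of_deriv2_nonneg (by fun_prop) ?_ ?_
    · rw [e1]; fun_prop
    · intro x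
      simp only [Function.iterate_succ, Function.iterate_zero, Function.comp, id]
      rw [e1, e2]; linarith [hV.lower x]
  have := hc.2 (Set.mem_univ r) (Set.mem_univ (-r)) (show (0 : ℝ) ≤ 1 / 2 by norm_num)
    (show (0 : ℝ) ≤ 1 / 2 by norm_num) (by norm_num)
  simp only [smul_eq_mul] at this
  have e : (1 / 2 : ℝ) * r + 1 / 2 * -r = 0 := by ring
  rw [e, hV.symm r] at this
  have h0 := hV.nonneg 0
  nlinarith

/-- The one-site Gibbs measure is a probability measure, so that `gibbs` is the product measure. -/
theorem isProbabilityMeasure_siteMeasure {V : ℝ → ℝ} {δm δp β : ℝ} (hV : IsAdmissible V δm δp)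
    (hβ : 0 < β) : IsProbabilityMeasure (siteMeasure V β) := by
  have hcont : Continuous V := hV.smooth.continuous
  have hp : 0 < β * (δm / 2) := by have := hV.pos; positivity
  have hiV : Integrable fun r : ℝ => Real.exp (-β * V r) := by
    refine (integrable_exp_neg_mul_sq hp).mono' (by fun_prop) (.of_forall fun r => ?_)
    rw [Real.norm_eq_abs, abs_of_pos (Real.exp_pos _)]
    refine Real.exp_le_exp.2 ?_
    have := mul_le_mul_of_nonneg_left (hV.quadratic_le r) hβ.le
    nlinarith
  have hZ : 0 < partitionZ V β := integral_exp_pos hiV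
  have hig : Integrable fun p : ℝ => Real.exp (-(β / 2) * p ^ 2) :=
    integrable_exp_neg_mul_sq (by positivity)
  have hs : Real.sqrt (2 * Real.pi * β⁻¹) = ∫ p : ℝ, Real.exp (-(β / 2) * p ^ 2) := by
    rw [integral_gaussian]; congr 1; field_simp
  have hs0 : 0 < Real.sqrt (2 * Real.pi * β⁻¹) := by have := Real.pi_pos; positivity
  have hsplit : (fun x : ℝ × ℝ => Real.exp (-β * (x.1 ^ 2 / 2 + V x.2)) /
      (Real.sqrt (2 * Real.pi * β⁻¹) * partitionZ V β)) = fun x : ℝ × ℝ =>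
      (Real.exp (-(β / 2) * x.1 ^ 2) * Real.exp (-β * V x.2)) /
      (Real.sqrt (2 * Real.pi * β⁻¹) * partitionZ V β) := by
    funext x; rw [← Real.exp_add]; congr 2; ring
  refine ⟨?_⟩
  rw [siteMeasure, withDensity_apply _ MeasurableSet.univ, Measure.restrict_univ,
    ← ofReal_integral_eq_lintegral_ofReal]
  · rw [hsplit, integral_div, Measure.volume_eq_prod,
      integral_prod_mul (fun p : ℝ => Real.exp (-(β / 2) * p ^ 2)) fun r => Real.exp (-β * V r),
      ← hs, partitionZ, div_self, ENNReal.ofReal_one]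
    exact (mul_pos hs0 hZ).ne'
  · rw [hsplit, Measure.volume_eq_prod]
    exact (hig.mul_prod hiV).div_const _
  · exact .of_forall fun x => by positivity

/-- The product measure `ν_β` on `(ℝ²)^ℤ`. -/
def gibbs (V : ℝ → ℝ) (β : ℝ) : Measure Config :=
  Measure.infinitePi fun _ : ℤ => siteMeasure V β

/-! ### Shifts, vector fields and generators -/

/-- `(τ_j f)(ω) = f(τ_j ω)` with `(τ_j ω)_i = ω_{i+j}`, so that `τ_j p_i = p_{i+j}`. -/
def shift (j : ℤ) (f : Config → ℝ) : Config → ℝ := fun ω => f fun i => ω (i + j)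

/-- `∂ f / ∂ p_i`. -/
def dp (i : ℤ) (f : Config → ℝ) : Config → ℝ := fun ω =>
  deriv (fun x : ℝ => f (Function.update ω i (x, (ω i).2))) (ω i).1

/-- `∂ f / ∂ r_i`. -/
def dr (i : ℤ) (f : Config → ℝ) : Config → ℝ := fun ω =>
  deriv (fun x : ℝ => f (Function.update ω i ((ω i).1, x))) (ω i).2

/-- `Y_{i,j} = p_i ∂_{r_j} - V'(r_j) ∂_{p_i}`. -/
def Y (V : ℝ → ℝ) (i j : ℤ) (f : Config → ℝ) : Config → ℝ := fun ω =>
  (ω i).1 * dr j f ω - deriv V (ω j).2 * dp i f ω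

/-- `X_i = Y_{i,i}`. -/
def X (V : ℝ → ℝ) (i : ℤ) (f : Config → ℝ) : Config → ℝ := Y V i i f

/-- `A = ∑_i (X_i - Y_{i,i+1})`; on local functions the sum is finite. -/
def opA (V : ℝ → ℝ) (f : Config → ℝ) : Config → ℝ := fun ω =>
  ∑ᶠ i : ℤ, (X V i f ω - Y V i (i + 1) f ω)

/-- `S^γ = (γ/2) ∑_i (X_i² + Y_{i,i+1}²)`; on local functions the sum is finite. -/
def opS (V : ℝ → ℝ) (γ : ℝ) (f : Config → ℝ) : Config → ℝ := fun ω =>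
  γ / 2 * ∑ᶠ i : ℤ, (X V i (X V i f) ω + Y V i (i + 1) (Y V i (i + 1) f) ω)

/-- The generator `L = L^γ = S^γ + A`. -/
def opL (V : ℝ → ℝ) (γ : ℝ) (f : Config → ℝ) : Config → ℝ := opS V γ f + opA V f

/-- The energy `ℰ_i = p_i²/2 + V(r_i)`. -/
def energy (V : ℝ → ℝ) (i : ℤ) : Config → ℝ := fun ω => (ω i).1 ^ 2 / 2 + V (ω i).2

/-! ### Spaces of local functions -/

/-- Smooth local functions: smooth functions of finitely many coordinates. -/
def IsSmoothLocal (f : Config → ℝ) : Prop :=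
  ∃ (Λ : Finset ℤ) (φ : (Λ → ℝ × ℝ) → ℝ), ContDiff ℝ (⊤ : ℕ∞) φ ∧ ∀ ω, f ω = φ fun i => ω i

/-- The set `𝒞` of smooth local functions with compact support (as functions of the finitely many
coordinates on which they depend) and zero average with respect to `ν_β`. -/
def spaceC (V : ℝ → ℝ) (β : ℝ) : Set (Config → ℝ) :=
  {f | (∃ (Λ : Finset ℤ) (φ : (Λ → ℝ × ℝ) → ℝ),
      ContDiff ℝ (⊤ : ℕ∞) φ ∧ HasCompactSupport φ ∧ ∀ ω, f ω = φ fun i => ω i) ∧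
    ∫ ω, f ω ∂(gibbs V β) = 0}

/-- The set `𝒞̃` of smooth local `f` with `f`, `X_i f`, `Y_{i,i+1} f` in `L²(ν_β)` for all `i`. -/
def spaceCTilde (V : ℝ → ℝ) (β : ℝ) : Set (Config → ℝ) :=
  {f | IsSmoothLocal f ∧ MemLp f 2 (gibbs V β) ∧
    ∀ i : ℤ, MemLp (X V i f) 2 (gibbs V β) ∧ MemLp (Y V i (i + 1) f) 2 (gibbs V β)}

/-- The space `𝒞₀` of finite sums `∑_{i ∈ Λ} (X_i F_i + Y_{i,i+1} G_i)` with `F_i`, `G_i` in `𝒞̃`.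
(As `𝒞̃` is a linear space on which the vector fields are linear, these sums are the linear span
of the `X_i F` and the `Y_{i,i+1} G`.) -/
def spaceC0 (V : ℝ → ℝ) (β : ℝ) : Submodule ℝ (Config → ℝ) :=
  Submodule.span ℝ
    {f | ∃ i : ℤ, ∃ F ∈ spaceCTilde V β, f = X V i F ∨ f = Y V i (i + 1) F}

/-- The function `p_1² - p_0²`. -/
def gradP : Config → ℝ := fun ω => (ω 1).1 ^ 2 - (ω 0).1 ^ 2

/-! ### The semi-norm and the Hilbert space `ℋ₋₁` -/

/-- `X_0 Γ_g` for the formal sum `Γ_g = ∑_j τ_j g`. -/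
def XGamma (V : ℝ → ℝ) (g : Config → ℝ) : Config → ℝ := fun ω =>
  ∑ᶠ j : ℤ, X V 0 (shift j g) ω

/-- `Y_{0,1} Γ_g` for the formal sum `Γ_g = ∑_j τ_j g`. -/
def YGamma (V : ℝ → ℝ) (g : Config → ℝ) : Config → ℝ := fun ω =>
  ∑ᶠ j : ℤ, Y V 0 1 (shift j g) ω

/-- `≪ g, h ≫_* = ∑_i ⟨g, τ_i h⟩`. -/
def pairStar (V : ℝ → ℝ) (β : ℝ) (g h : Config → ℝ) : ℝ :=
  ∑ᶠ i : ℤ, ∫ ω, g ω * shift i h ω ∂(gibbs V β)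

/-- `≪ h ≫_{**} = ∑_i i ⟨h, ℰ_i⟩`. -/
def pairStarStar (V : ℝ → ℝ) (β : ℝ) (h : Config → ℝ) : ℝ :=
  ∑ᶠ i : ℤ, (i : ℝ) * ∫ ω, h ω * energy V i ω ∂(gibbs V β)

/-- The set of values over which the supremum defining the squared semi-norm is taken. -/
def variationalSet (V : ℝ → ℝ) (β γ : ℝ) (h : Config → ℝ) : Set ℝ :=
  {x | ∃ g ∈ spaceC V β, ∃ a : ℝ,
    x = 2 * pairStar V β g h + 2 * a * pairStarStar V β h
      - γ / 2 * ∫ ω, (a * ((ω 0).1 * deriv V (ω 1).2) + YGamma V g ω) ^ 2 ∂(gibbs V β)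
      - γ / 2 * ∫ ω, (XGamma V g ω) ^ 2 ∂(gibbs V β)}

/-- The squared semi-norm `|||h|||₋₁²`. -/
def normSq (V : ℝ → ℝ) (β γ : ℝ) (h : Config → ℝ) : ℝ := sSup (variationalSet V β γ h)

/-- The form `≪ g, h ≫₋₁` on `𝒞₀` obtained from `||| · |||₋₁` by polarization. -/
def form (V : ℝ → ℝ) (β γ : ℝ) (g h : spaceC0 V β) : ℝ :=
  1 / 4 * (normSq V β γ ((g + h : spaceC0 V β) : Config → ℝ)
    - normSq V β γ ((g - h : spaceC0 V β) : Config → ℝ))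

/-- A real form is a semi-inner product: symmetric, bilinear and positive semi-definite. -/
structure IsSemiInner {E : Type*} [AddCommGroup E] [Module ℝ E] (B : E → E → ℝ) : Prop where
  symm : ∀ x y, B x y = B y x
  add_left : ∀ x y z, B (x + y) z = B x z + B y z
  smul_left : ∀ (a : ℝ) (x y : E), B (a • x) y = a * B x y
  nonneg : ∀ x, 0 ≤ B x x

/-- A copy of the vector space `E` that carries the semi-norm of the semi-inner product `B`
(and no other topology). -/
def PreHilbert {E : Type*} [AddCommGroup E] [Module ℝ E] {B : E → E → ℝ}
    (_hB : IsSemiInner B) : Type _ := E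

section Completion

variable {E : Type*} [AddCommGroup E] [Module ℝ E] {B : E → E → ℝ} (hB : IsSemiInner B)

instance : AddCommGroup (PreHilbert hB) := inferInstanceAs (AddCommGroup E)

instance : Module ℝ (PreHilbert hB) := inferInstanceAs (Module ℝ E)

/-- The semi-inner product `B` as Mathlib's bundled structure. -/
abbrev preCore : PreInnerProductSpace.Core ℝ (PreHilbert hB) where
  inner x y := B x y
  conj_inner_symm x y := hB.symm y x
  re_inner_nonneg x := hB.nonneg x
  add_left x y z := hB.add_left x y z
  smul_left x y a := hB.smul_left a x y

instance : SeminormedAddCommGroup (PreHilbert hB) :=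
  @InnerProductSpace.Core.toSeminormedAddCommGroup ℝ (PreHilbert hB) _ _ _ (preCore hB)

instance : InnerProductSpace ℝ (PreHilbert hB) := InnerProductSpace.ofCore (preCore hB)

/-- The Hilbert space completion of `E` modulo the kernel of the semi-norm of `B`. -/
abbrev HilbertCompletion : Type _ := UniformSpace.Completion (PreHilbert hB)

/-- The canonical linear map from `E` to the completion. -/
def toCompletion : E →ₗ[ℝ] HilbertCompletion hB :=
  (UniformSpace.Completion.toComplₗᵢ (𝕜 := ℝ) (E := PreHilbert hB)).toLinearMap

end Completion

/-- The Hilbert space `ℋ₋₁`: the completion of `𝒞₀` modulo the kernel of `||| · |||₋₁`. -/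
abbrev HMinusOne (V : ℝ → ℝ) (β γ : ℝ) (hB : IsSemiInner (form V β γ)) : Type :=
  HilbertCompletion hB

/-- The image of `L𝒞 = {L g ; g ∈ 𝒞}` in `ℋ₋₁`. -/
def imageLC (V : ℝ → ℝ) (β γ : ℝ) (hB : IsSemiInner (form V β γ)) :
    Set (HMinusOne V β γ hB) :=
  {x | ∃ g ∈ spaceC V β, ∃ h : spaceC0 V β,
    (h : Config → ℝ) = opL V γ g ∧ x = toCompletion hB h}

end EnergyChain

end

open MeasureTheory

noncomputable section

namespace EnergyChain

open Filter Topology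

/-! ### Elementary properties of the potential -/

namespace IsAdmissible

variable {V : ℝ → ℝ} {δm δp : ℝ}

/-! Integration by parts turns the variational formula into Hilbert space geometry. For `h = X_i F`
or `h = Y_{i,i+1} F`, the functional `(g, a) ↦ ≪g, h≫_* + a ≪h≫_**` is the inner product in `L² ⊕
L²` of the test vector `w(g, a) = (X_0 Γ_g, a p_0 V'(r_1) + Y_{0,1} Γ_g)` with a vector `K` built
from `-τ_{-i} F` (`Represents`, `represents_X`, `represents_Y`). Completing the square gives
`|||h|||² = (2/γ) ‖P K‖²`, where `P` projects onto the closed span of the test vectors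
(`isLUB_quadratic`, `normSq_eq`). So the supremum is finite, and polarization yields a multiple of
an inner product (`form_eq`).

In this picture the symmetric part `S g` of `L g` becomes `-(γ/2) w(g, 0)` (`riesz_symmPart`). The
vector of `p_1² - p_0²` is orthogonal to every `w(g, 0)`, because the pairing telescopes
(`pairStar_gradP`). It is not orthogonal to `w(0, 1)`, because there the pairing is the integral of
`p_0² V'(r_1) r_1`, which is positive (`pairStarStar_gradP_ne_zero`). The test space is the closed
span of the `w(g, 0)` and the single vector `w(0, 1)`, so the images of `S` and `p_1² - p_0²` span a
dense subspace (`topologicalClosure_symmPart_sup`).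

Passing from `S` to `L = S + A` is a Lax-Milgram argument (`isCompl_closure_range`). It needs that
`A` does not change the diagonal (`inner_wvec_opA_self`) and that `A` is bounded relative to `S`
(`abs_inner_wvec_opA_le`). The second fact is a sector condition. It reduces to the one-site
estimate `|∫ X f · g| ≤ C ‖X f‖ ‖X g‖`, proved by splitting into parts even and odd in the momentum.
`X` exchanges the two parities, and on odd functions the Poincaré inequality `δm ∫ u² ≤ ∫ (X u)²`
holds because `p` is a positive solution of `D² p = -V'' p` on `p > 0`, with `D` the Hamiltonian
derivative (`siteMeasure_poincare_odd`).

The set `𝒞` is not visibly linear: a sum of functions compactly supported in different coordinates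
need not be compactly supported in their union. The argument therefore runs on the linear space
`centred` of smooth local functions with moments of all orders, and `exists_approximation` brings it
back to `𝒞`. -/

theorem contDiff_deriv (hV : IsAdmissible V δm δp) : ContDiff ℝ (⊤ : ℕ∞) (deriv V) :=
  hV.smooth.iterate_deriv 1

theorem contDiff_deriv_two (hV : IsAdmissible V δm δp) :
    ContDiff ℝ (⊤ : ℕ∞) (deriv (deriv V)) :=
  hV.contDiff_deriv.iterate_deriv 1

theorem differentiable (hV : IsAdmissible V δm δp) : Differentiable ℝ V :=
  hV.smooth.differentiable (by simp)

theorem differentiable_deriv (hV : IsAdmissible V δm δp) : Differentiable ℝ (deriv V) :=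
  hV.contDiff_deriv.differentiable (by simp)

theorem upper_pos (hV : IsAdmissible V δm δp) : 0 < δp :=
  hV.pos.trans_le ((hV.lower 0).trans (hV.upper 0))

theorem deriv_zero (hV : IsAdmissible V δm δp) : deriv V 0 = 0 := by
  have h : (fun r => V (-r)) = V := funext hV.symm
  have h2 := deriv_comp_neg V 0
  rw [h, neg_zero] at h2
  linarith

theorem abs_deriv_le (hV : IsAdmissible V δm δp) (r : ℝ) : |deriv V r| ≤ δp * |r| := by
  have := convex_univ.norm_image_sub_le_of_norm_deriv_le (f := deriv V) (C := δp) (x := 0) (y := r)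
    (fun x _ => hV.differentiable_deriv x)
    (fun x _ => by
      rw [Real.norm_eq_abs, abs_of_nonneg (hV.pos.le.trans (hV.lower x))]
      exact hV.upper x) (Set.mem_univ _) (Set.mem_univ _)
  simpa [hV.deriv_zero] using this

theorem abs_le (hV : IsAdmissible V δm δp) (r : ℝ) : |V r| ≤ V 0 + δp * r ^ 2 := by
  have := (convex_Icc (-|r|) |r|).norm_image_sub_le_of_norm_deriv_le (f := V) (C := δp * |r|)
    (x := 0) (y := r) (fun x _ => hV.differentiable x)
    (fun x hx => (hV.abs_deriv_le x).trans
      (mul_le_mul_of_nonneg_left (_root_.abs_le.2 hx) hV.upper_pos.le))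
    ⟨by simp, by simp⟩ ⟨neg_abs_le r, le_abs_self r⟩
  rw [abs_of_nonneg (hV.nonneg r)]
  have h2 : V r - V 0 ≤ ‖V r - V 0‖ := le_abs_self _
  rw [sub_zero, Real.norm_eq_abs r, mul_assoc, abs_mul_abs_self] at this
  nlinarith

end IsAdmissible

/-! ### The Hamiltonian vector field of one site -/

/-- The derivative of `u` along the Hamiltonian vector field `p ∂_r - V'(r) ∂_p`. -/
def hamD (V : ℝ → ℝ) (u : ℝ × ℝ → ℝ) (x : ℝ × ℝ) : ℝ := fderiv ℝ u x (-deriv V x.2, x.1)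

/-- The density of the one-site Gibbs measure. -/
def siteDensity (V : ℝ → ℝ) (β : ℝ) (x : ℝ × ℝ) : ℝ :=
  Real.exp (-β * (x.1 ^ 2 / 2 + V x.2)) / (Real.sqrt (2 * Real.pi * β⁻¹) * partitionZ V β)

section OneSite

variable {V : ℝ → ℝ} {δm δp β : ℝ}

theorem hamD_mul {u v : ℝ × ℝ → ℝ} {x : ℝ × ℝ} (hu : DifferentiableAt ℝ u x)
    (hv : DifferentiableAt ℝ v x) :
    hamD V (fun y => u y * v y) x = hamD V u x * v x + u x * hamD V v x := by
  simp only [hamD]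
  rw [fderiv_fun_mul hu hv]
  simp
  ring

theorem hamD_comp {φ : ℝ → ℝ} {u : ℝ × ℝ → ℝ} {x : ℝ × ℝ} (hφ : DifferentiableAt ℝ φ (u x))
    (hu : DifferentiableAt ℝ u x) :
    hamD V (fun y => φ (u y)) x = deriv φ (u x) * hamD V u x := by
  simp only [hamD]
  rw [show (fun y => φ (u y)) = φ ∘ u from rfl,
    (hφ.hasDerivAt.comp_hasFDerivAt x hu.hasFDerivAt).fderiv]
  simp

theorem hamD_fst (x : ℝ × ℝ) : hamD V (fun y => y.1) x = -deriv V x.2 := by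
  simp [hamD, hasFDerivAt_fst.fderiv]

theorem hamD_snd (x : ℝ × ℝ) : hamD V (fun y => y.2) x = x.1 := by
  simp [hamD, hasFDerivAt_snd.fderiv]

theorem hamD_energy (hV : IsAdmissible V δm δp) (x : ℝ × ℝ) :
    hamD V (fun y => y.1 ^ 2 / 2 + V y.2) x = 0 := by
  have h1 : DifferentiableAt ℝ (fun y : ℝ × ℝ => y.1 ^ 2 / 2) x := by fun_prop
  have hVx := hV.differentiable x.2
  have h2 : DifferentiableAt ℝ (fun y : ℝ × ℝ => V y.2) x := hVx.comp x differentiableAt_snd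
  have e1 : hamD V (fun y => y.1 ^ 2 / 2) x = x.1 * -deriv V x.2 := by
    rw [hamD_comp (φ := fun t => t ^ 2 / 2) (by fun_prop) differentiableAt_fst, hamD_fst]
    simp
  have e2 : hamD V (fun y => V y.2) x = deriv V x.2 * x.1 := by
    rw [hamD_comp hVx differentiableAt_snd, hamD_snd]
  have : hamD V (fun y => y.1 ^ 2 / 2 + V y.2) x =
      hamD V (fun y => y.1 ^ 2 / 2) x + hamD V (fun y => V y.2) x := by
    simp only [hamD]
    rw [fderiv_fun_add h1 h2]; rfl
  rw [this, e1, e2]; ring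

theorem continuous_hamD (hV : IsAdmissible V δm δp) {u : ℝ × ℝ → ℝ}
    (hu : ContDiff ℝ (⊤ : ℕ∞) u) : Continuous (hamD V u) := by
  have h1 : Continuous (fderiv ℝ u) := hu.continuous_fderiv (by simp)
  have h2 := hV.contDiff_deriv.continuous
  unfold hamD
  fun_prop

theorem hamD_eq (u : ℝ × ℝ → ℝ) (x : ℝ × ℝ) :
    hamD V u x = x.1 * fderiv ℝ u x (0, 1) - deriv V x.2 * fderiv ℝ u x (1, 0) := by
  have : ((-deriv V x.2, x.1) : ℝ × ℝ) = (-deriv V x.2) • (1, 0) + x.1 • (0, 1) := by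
    ext <;> simp
  rw [hamD, this, map_add, map_smul, map_smul]
  simp only [smul_eq_mul]; ring

theorem hasCompactSupport_hamD {u : ℝ × ℝ → ℝ} (hu : HasCompactSupport u) :
    HasCompactSupport (hamD V u) := by
  refine (hu.fderiv (𝕜 := ℝ)).mono fun x hx => ?_
  contrapose! hx
  simp only [Function.mem_support, ne_eq, not_not] at hx ⊢
  simp [hamD, hx]

theorem continuous_siteDensity (hV : IsAdmissible V δm δp) : Continuous (siteDensity V β) := by
  have := hV.smooth.continuous
  unfold siteDensity
  fun_prop

theorem siteDensity_nonneg (x : ℝ × ℝ) : 0 ≤ siteDensity V β x := by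
  unfold siteDensity partitionZ
  have : 0 ≤ ∫ r : ℝ, Real.exp (-β * V r) := integral_nonneg fun r => (Real.exp_pos _).le
  positivity

theorem integral_siteMeasure (hV : IsAdmissible V δm δp) (f : ℝ × ℝ → ℝ) :
    ∫ x, f x ∂(siteMeasure V β) = ∫ x, f x * siteDensity V β x := by
  have hm : Measurable fun x => ENNReal.ofReal (siteDensity V β x) :=
    (continuous_siteDensity hV).measurable.ennreal_ofReal
  have := integral_withDensity_eq_integral_toReal_smul (μ := (volume : Measure (ℝ × ℝ))) hm
    (.of_forall fun x => ENNReal.ofReal_lt_top) f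
  refine this.trans (integral_congr_ae (.of_forall fun x => ?_))
  simp [ENNReal.toReal_ofReal (siteDensity_nonneg x), mul_comm]

/-- The Hamiltonian flow preserves both Lebesgue measure and the energy. Concretely, integrating the
`∂_r` and the `∂_p` terms by parts against the density produces the same integral, with opposite
signs. -/
theorem integral_hamD_of_hasCompactSupport (hV : IsAdmissible V δm δp) {u : ℝ × ℝ → ℝ}
    (hu : ContDiff ℝ (⊤ : ℕ∞) u) (hc : HasCompactSupport u) :
    ∫ x, hamD V u x ∂(siteMeasure V β) = 0 := by
  have hρ := continuous_siteDensity (β := β) hV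
  have hV' := hV.contDiff_deriv.continuous
  have hd : Differentiable ℝ u := hu.differentiable (by simp)
  have huc := hu.continuous
  have hfd (v : ℝ × ℝ) : Continuous fun x => fderiv ℝ u x v :=
    (hu.continuous_fderiv (by simp)).clm_apply continuous_const
  have hfc (v : ℝ × ℝ) : HasCompactSupport fun x => fderiv ℝ u x v := by
    refine (hc.fderiv (𝕜 := ℝ)).mono fun x hx => ?_
    contrapose! hx
    simp only [Function.mem_support, ne_eq, not_not] at hx ⊢
    simp [hx]
  have key (f f' : ℝ × ℝ → ℝ) (v : ℝ × ℝ) (hf : Continuous f) (hf' : Continuous f')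
      (h : ∀ x, HasLineDerivAt ℝ f (f' x) x v) :
      ∫ x, f x * fderiv ℝ u x v = -∫ x, f' x * u x :=
    integral_bilinear_hasLineDerivAt_right_eq_neg_left_of_integrable
      (B := ContinuousLinearMap.mul ℝ ℝ)
      ((hf'.mul huc).integrable_of_hasCompactSupport hc.mul_left)
      ((hf.mul (hfd v)).integrable_of_hasCompactSupport (hfc v).mul_left)
      ((hf.mul huc).integrable_of_hasCompactSupport hc.mul_left)
      (fun x _ => h x) fun x _ => (hd x).hasFDerivAt.hasLineDerivAt v
  set c := Real.sqrt (2 * Real.pi * β⁻¹) * partitionZ V β with hcdef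
  have hder (x v : ℝ × ℝ) : HasDerivAt (fun t : ℝ => siteDensity V β (x + t • v))
      (siteDensity V β x * (-β * (x.1 * v.1 + deriv V x.2 * v.2))) 0 := by
    have h1 : HasDerivAt (fun t : ℝ => x.1 + t * v.1) v.1 0 := by
      simpa using ((hasDerivAt_id (0 : ℝ)).mul_const v.1).const_add x.1
    have h2 : HasDerivAt (fun t : ℝ => x.2 + t * v.2) v.2 0 := by
      simpa using ((hasDerivAt_id (0 : ℝ)).mul_const v.2).const_add x.2
    have h3 : HasDerivAt V (deriv V x.2) (x.2 + 0 * v.2) := by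
      simpa using (hV.differentiable x.2).hasDerivAt
    have := ((((h1.pow 2).div_const 2).add (h3.comp 0 h2)).const_mul (-β)).exp.div_const c
    refine this.congr_deriv ?_
    simp only [siteDensity, ← hcdef, Pi.add_apply, Pi.pow_apply, Function.comp_apply, zero_mul, add_zero]
    push_cast
    ring
  have hp : ∫ x, (x.1 * siteDensity V β x) * fderiv ℝ u x (0, 1)
      = -∫ x, (-β * x.1 * deriv V x.2 * siteDensity V β x) * u x := by
    refine key _ _ _ (by fun_prop) (by fun_prop) fun x => ?_
    have h1 : HasDerivAt (fun t : ℝ => (x + t • ((0, 1) : ℝ × ℝ)).1) 0 0 := by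
      simpa using hasDerivAt_const (0 : ℝ) x.1
    have := h1.mul (hder x (0, 1))
    refine this.congr_deriv ?_
    simp; ring
  have hr : ∫ x, (deriv V x.2 * siteDensity V β x) * fderiv ℝ u x (1, 0)
      = -∫ x, (-β * x.1 * deriv V x.2 * siteDensity V β x) * u x := by
    refine key _ _ _ (by fun_prop) (by fun_prop) fun x => ?_
    have h1 : HasDerivAt (fun t : ℝ => deriv V (x + t • ((1, 0) : ℝ × ℝ)).2) 0 0 := by
      simpa using hasDerivAt_const (0 : ℝ) (deriv V x.2)
    have := h1.mul (hder x (1, 0))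
    refine this.congr_deriv ?_
    simp; ring
  rw [integral_siteMeasure hV]
  have : ∀ x, hamD V u x * siteDensity V β x = (x.1 * siteDensity V β x) * fderiv ℝ u x (0, 1)
      - (deriv V x.2 * siteDensity V β x) * fderiv ℝ u x (1, 0) := fun x => by
    rw [hamD_eq]; ring
  simp_rw [this]
  rw [integral_sub, hp, hr, sub_self]
  · exact (Continuous.mul (by fun_prop) (hfd _)).integrable_of_hasCompactSupport (hfc _).mul_left
  · exact (Continuous.mul (by fun_prop) (hfd _)).integrable_of_hasCompactSupport (hfc _).mul_left

/-- A smooth cutoff along the energy levels: it is constant along the Hamiltonian flow. -/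
theorem exists_energy_cutoff (hV : IsAdmissible V δm δp) :
    ∃ χ : ℕ → ℝ × ℝ → ℝ, (∀ n, ContDiff ℝ (⊤ : ℕ∞) (χ n)) ∧ (∀ n, HasCompactSupport (χ n)) ∧
      (∀ n x, hamD V (χ n) x = 0) ∧ (∀ n x, 0 ≤ χ n x) ∧ (∀ n x, χ n x ≤ 1) ∧
      (∀ n x, χ n (-x.1, x.2) = χ n x) ∧ ∀ x, ∀ᶠ n in atTop, χ n x = 1 := by
  let ψ : ContDiffBump (0 : ℝ) := ⟨1, 2, one_pos, one_lt_two⟩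
  have hE : ContDiff ℝ (⊤ : ℕ∞) fun x : ℝ × ℝ => x.1 ^ 2 / 2 + V x.2 :=
    ((contDiff_fst.pow 2).div_const 2).add (hV.smooth.comp contDiff_snd)
  have hψ (n : ℕ) : ContDiff ℝ (⊤ : ℕ∞) fun t : ℝ => ψ (t / (n + 1)) :=
    ψ.contDiff.comp (contDiff_id.div_const _)
  refine ⟨fun n x => ψ ((x.1 ^ 2 / 2 + V x.2) / (n + 1)), fun n => (hψ n).comp hE, fun n => ?_,
    fun n x => ?_, fun n x => ψ.nonneg, fun n x => ψ.le_one, fun n x => by simp, fun x => ?_⟩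
  · have hδ := hV.pos
    have hn : (0 : ℝ) < n + 1 := by positivity
    refine HasCompactSupport.intro (isCompact_closedBall (0 : ℝ × ℝ)
      (4 * (n + 1) + 4 * (n + 1) / δm + 1)) fun x hx => ?_
    by_contra h
    have hs : (x.1 ^ 2 / 2 + V x.2) / (n + 1) ∈ Metric.ball (0 : ℝ) 2 := by
      have := ψ.support_eq
      rw [← this]; exact h
    rw [Metric.mem_ball, dist_zero_right, Real.norm_eq_abs, abs_div, abs_of_pos hn,
      div_lt_iff₀ hn] at hs
    have hs := (le_abs_self _).trans_lt hs
    have hq := hV.quadratic_le x.2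
    have hV0 := hV.nonneg x.2
    have h1 : x.1 ^ 2 ≤ 4 * (n + 1) := by linarith
    have h2 : x.2 ^ 2 ≤ 4 * (n + 1) / δm := by
      rw [le_div_iff₀ hδ]; nlinarith [sq_nonneg x.1]
    have h3 : (0 : ℝ) ≤ 4 * (n + 1) / δm := by positivity
    refine hx ?_
    rw [mem_closedBall_zero_iff, Prod.norm_def, Real.norm_eq_abs, Real.norm_eq_abs]
    refine max_le ?_ ?_ <;> refine abs_le_of_sq_le_sq' ?_ (by positivity) |> _root_.abs_le.2
    · nlinarith
    · nlinarith
  · rw [hamD_comp (φ := fun t : ℝ => ψ (t / (n + 1))) (u := fun x => x.1 ^ 2 / 2 + V x.2)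
      ((hψ n).differentiable (by simp) _) (hE.differentiable (by simp) _), hamD_energy hV,
      mul_zero]
  · obtain ⟨N, hN⟩ := exists_nat_ge |x.1 ^ 2 / 2 + V x.2|
    filter_upwards [eventually_ge_atTop N] with n hn
    refine ψ.one_of_mem_closedBall ?_
    rw [mem_closedBall_zero_iff, Real.norm_eq_abs, abs_div, abs_of_pos (by positivity :
      (0 : ℝ) < n + 1), div_le_iff₀ (by positivity)]
    have : (N : ℝ) ≤ n := by exact_mod_cast hn
    show _ ≤ (1 : ℝ) * _
    linarith

/-- A cutoff that depends on the energy alone commutes with `hamD`, so truncation leaves no error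
term and only `hamD V u` has to be integrable, not `u` itself. -/
theorem integral_hamD_eq_zero (hV : IsAdmissible V δm δp) {u : ℝ × ℝ → ℝ}
    (hu : ContDiff ℝ (⊤ : ℕ∞) u) (hi : Integrable (hamD V u) (siteMeasure V β)) :
    ∫ x, hamD V u x ∂(siteMeasure V β) = 0 := by
  obtain ⟨χ, hs, hc, hD, h0, h1, -, hlim⟩ := exists_energy_cutoff hV
  have e (n : ℕ) : ∫ x, hamD V u x * χ n x ∂(siteMeasure V β) = 0 := by
    rw [← integral_hamD_of_hasCompactSupport (β := β) hV (hu.mul (hs n)) (hc n).mul_left]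
    congr 1 with x
    have := hamD_mul (V := V) (hu.differentiable (by simp) x) ((hs n).differentiable (by simp) x)
    rw [hD, mul_zero, add_zero] at this
    exact this.symm
  have ht : Tendsto (fun n => ∫ x, hamD V u x * χ n x ∂(siteMeasure V β)) atTop
      (𝓝 (∫ x, hamD V u x ∂(siteMeasure V β))) := by
    refine tendsto_integral_of_dominated_convergence (fun x => ‖hamD V u x‖) (fun n => ?_)
      hi.norm (fun n => .of_forall fun x => ?_) (.of_forall fun x => ?_)
    · exact ((continuous_hamD hV hu).mul (hs n).continuous).aestronglyMeasurable
    · rw [norm_mul, Real.norm_eq_abs (χ n x), abs_of_nonneg (h0 n x)]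
      exact mul_le_of_le_one_right (norm_nonneg _) (h1 n x)
    · refine tendsto_const_nhds.congr' ?_
      filter_upwards [hlim x] with n hn
      rw [hn, mul_one]
  simp_rw [e] at ht
  exact (tendsto_nhds_unique ht tendsto_const_nhds)

set_option maxHeartbeats 1000000 in
-- A ground state argument. Along the flow `D p = -V'(r)` and `D² p = -V''(r) p`, so `m = D p / p =
-- -V'(r) / p` solves the Riccati equation `D m + m² = -V''`. Integrating `(D u - m u)² ≥ 0`, with
-- `∫ D(m u²) = 0`, gives `∫ (D u)² ≥ ∫ V'' u²`. The pole of `m` at `p = 0` is harmless because odd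
-- `u` vanishes there; it is smoothed with a parameter `ε` that is sent to zero.
theorem siteMeasure_poincare_odd_of_hasCompactSupport (hV : IsAdmissible V δm δp) (hβ : 0 < β)
    {u : ℝ × ℝ → ℝ} (hu : ContDiff ℝ (⊤ : ℕ∞) u) (hc : HasCompactSupport u)
    (hodd : ∀ x, u (-x.1, x.2) = -u x) :
    δm * ∫ x, u x ^ 2 ∂(siteMeasure V β) ≤ ∫ x, hamD V u x ^ 2 ∂(siteMeasure V β) := by
  have := isProbabilityMeasure_siteMeasure hV hβ
  set μ := siteMeasure V β with hμ
  have huc := hu.continuous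
  have hud : Differentiable ℝ u := hu.differentiable (by simp)
  have hV' := hV.contDiff_deriv.continuous
  have hδ := hV.pos
  obtain ⟨C, hC⟩ := ContDiff.lipschitzWith_of_hasCompactSupport hc hu (by simp)
  -- Oddness makes `u` vanish on `p = 0`. The resulting linear bound keeps `u² / p²` bounded, which
  -- dominates the error of the regularization uniformly in `ε`.
  have hlip (x : ℝ × ℝ) : |u x| ≤ C * |x.1| := by
    have h0 : u (0, x.2) = 0 := by
      have := hodd (0, x.2)
      simp only [neg_zero] at this
      linarith
    have := hC.dist_le_mul x (0, x.2)
    rw [Real.dist_eq, h0, sub_zero, Prod.dist_eq, dist_self, Real.dist_eq, sub_zero,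
      max_eq_left (abs_nonneg _)] at this
    exact this
  -- The defect in the Riccati equation when `-1/p` is replaced by `-p/(p² + ε)`, multiplied by `u²`
  -- and with `V''` bounded below by `δm`.
  let err (ε : ℝ) (x : ℝ × ℝ) : ℝ :=
    deriv V x.2 ^ 2 * (ε * u x ^ 2 / (x.1 ^ 2 + ε) ^ 2) + δm * (ε / (x.1 ^ 2 + ε)) * u x ^ 2
  let bd : ℝ × ℝ → ℝ := fun x =>
    (tsupport u).indicator (fun x => deriv V x.2 ^ 2 * C ^ 2 + δm * u x ^ 2) x
  have hbd : Integrable bd μ := by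
    refine IntegrableOn.integrable_indicator ?_ (isClosed_tsupport u).measurableSet
    exact ContinuousOn.integrableOn_compact hc (by fun_prop)
  have herr_nonneg {ε : ℝ} (hε : 0 < ε) (x : ℝ × ℝ) : 0 ≤ err ε x := by
    simp only [err]; positivity
  have herr_le {ε : ℝ} (hε : 0 < ε) (x : ℝ × ℝ) : err ε x ≤ bd x := by
    by_cases hx : x ∈ tsupport u
    · simp only [bd, Set.indicator_of_mem hx, err]
      have h1 : ε * u x ^ 2 / (x.1 ^ 2 + ε) ^ 2 ≤ (C : ℝ) ^ 2 := by
        rw [div_le_iff₀ (by positivity)]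
        have : u x ^ 2 ≤ C ^ 2 * x.1 ^ 2 := by
          rw [← mul_pow, ← sq_abs, ← sq_abs ((C : ℝ) * x.1), abs_mul, abs_of_nonneg C.coe_nonneg]
          exact pow_le_pow_left₀ (abs_nonneg _) (hlip x) 2
        have h2 : ε * x.1 ^ 2 ≤ (x.1 ^ 2 + ε) ^ 2 := by nlinarith [sq_nonneg x.1, sq_nonneg ε]
        calc ε * u x ^ 2 ≤ ε * (C ^ 2 * x.1 ^ 2) := by gcongr
          _ = C ^ 2 * (ε * x.1 ^ 2) := by ring
          _ ≤ _ := by gcongr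
      have h2 : ε / (x.1 ^ 2 + ε) ≤ 1 := by
        rw [div_le_one (by positivity)]; nlinarith [sq_nonneg x.1]
      have h3 : δm * (ε / (x.1 ^ 2 + ε)) * u x ^ 2 ≤ δm * 1 * u x ^ 2 := by gcongr
      have h4 := mul_le_mul_of_nonneg_left h1 (sq_nonneg (deriv V x.2))
      linarith
    · simp [bd, err, Set.indicator_of_notMem hx, image_eq_zero_of_notMem_tsupport hx]
  have herr_cont {ε : ℝ} (hε : 0 < ε) : Continuous (err ε) := by
    have h1 (x : ℝ × ℝ) : x.1 ^ 2 + ε ≠ 0 := by positivity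
    have h2 (x : ℝ × ℝ) : (x.1 ^ 2 + ε) ^ 2 ≠ 0 := by positivity
    simp only [err]
    fun_prop (disch := assumption)
  have herr_int {ε : ℝ} (hε : 0 < ε) : Integrable (err ε) μ :=
    hbd.mono' (herr_cont hε).aestronglyMeasurable (.of_forall fun x => by
      rw [Real.norm_eq_abs, abs_of_nonneg (herr_nonneg hε x)]; exact herr_le hε x)
  have hDint : Integrable (fun x => hamD V u x ^ 2) μ := by
    have h1 : Continuous fun x => hamD V u x ^ 2 := (continuous_hamD hV hu).pow 2
    have h2 : HasCompactSupport fun x => hamD V u x ^ 2 :=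
      (hasCompactSupport_hamD (V := V) hc).comp_left (g := fun t : ℝ => t ^ 2)
        (zero_pow two_ne_zero)
    exact h1.integrable_of_hasCompactSupport h2
  have huint : Integrable (fun x => u x ^ 2) μ := by
    have h1 : Continuous fun x => u x ^ 2 := huc.pow 2
    have h2 : HasCompactSupport fun x => u x ^ 2 :=
      hc.comp_left (g := fun t : ℝ => t ^ 2) (zero_pow two_ne_zero)
    exact h1.integrable_of_hasCompactSupport h2
  have main {ε : ℝ} (hε : 0 < ε) :
      δm * ∫ x, u x ^ 2 ∂μ ≤ ∫ x, hamD V u x ^ 2 ∂μ + ∫ x, err ε x ∂μ := by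
    let q : ℝ → ℝ := fun p => -p / (p ^ 2 + ε)
    have hq0 (p : ℝ) : p ^ 2 + ε ≠ 0 := by positivity
    have hq : ContDiff ℝ (⊤ : ℕ∞) q :=
      contDiff_id.neg.div ((contDiff_id.pow 2).add contDiff_const) hq0
    have hqd (p : ℝ) : deriv q p = (p ^ 2 - ε) / (p ^ 2 + ε) ^ 2 := by
      have := ((hasDerivAt_id p).neg.div (((hasDerivAt_id p).pow 2).add_const ε) (hq0 p))
      refine HasDerivAt.deriv (this.congr_deriv ?_)
      simp; ring
    let m : ℝ × ℝ → ℝ := fun x => deriv V x.2 * q x.1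
    have hm1 : ContDiff ℝ (⊤ : ℕ∞) fun x : ℝ × ℝ => deriv V x.2 :=
      hV.contDiff_deriv.comp contDiff_snd
    have hm2 : ContDiff ℝ (⊤ : ℕ∞) fun x : ℝ × ℝ => q x.1 := hq.comp contDiff_fst
    have hm : ContDiff ℝ (⊤ : ℕ∞) m := hm1.mul hm2
    have hDm (x : ℝ × ℝ) : hamD V m x = deriv (deriv V) x.2 * x.1 * q x.1
        - deriv V x.2 ^ 2 * deriv q x.1 := by
      have h1 : hamD V m x = _ := hamD_mul (V := V)
        (hm1.differentiable (by simp) x) (hm2.differentiable (by simp) x)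
      rw [hamD_comp (φ := deriv V) (hV.differentiable_deriv _) differentiableAt_snd, hamD_snd,
        hamD_comp (hq.differentiable (by simp) _) differentiableAt_fst, hamD_fst] at h1
      rw [h1]; ring
    let w : ℝ × ℝ → ℝ := fun x => m x * (u x * u x)
    have hwc : HasCompactSupport w := hc.mul_left.mul_left
    have hw : ContDiff ℝ (⊤ : ℕ∞) w := hm.mul (hu.mul hu)
    have hDw (x : ℝ × ℝ) : hamD V w x = hamD V m x * u x ^ 2 + 2 * m x * u x * hamD V u x := by
      have h1 : hamD V w x = _ := hamD_mul (V := V) (hm.differentiable (by simp) x)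
        ((hud x).mul (hud x))
      rw [hamD_mul (hud x) (hud x)] at h1
      rw [h1]; ring
    have hpt (x : ℝ × ℝ) : δm * u x ^ 2 ≤ hamD V u x ^ 2 - hamD V w x + err ε x := by
      -- The regularized Riccati equation; at `ε = 0` the right side is `-V''`.
      have hr : hamD V m x + m x ^ 2
          = -deriv (deriv V) x.2 * (1 - ε / (x.1 ^ 2 + ε))
            + deriv V x.2 ^ 2 * (ε / (x.1 ^ 2 + ε) ^ 2) := by
        rw [hDm, hqd]
        simp only [m, q]
        have := hq0 x.1
        field_simp
        ring
      have h1 : 0 ≤ (hamD V u x - m x * u x) ^ 2 := sq_nonneg _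
      have h2 : (hamD V u x - m x * u x) ^ 2
          = hamD V u x ^ 2 - hamD V w x + (hamD V m x + m x ^ 2) * u x ^ 2 := by
        rw [hDw]; ring
      rw [h2, hr] at h1
      have h3 : 0 ≤ 1 - ε / (x.1 ^ 2 + ε) := by
        rw [sub_nonneg, div_le_one (by positivity)]; nlinarith [sq_nonneg x.1]
      have h4 := mul_nonneg (mul_nonneg (sub_nonneg.2 (hV.lower x.2)) h3) (sq_nonneg (u x))
      simp only [err]
      have h5 : deriv V x.2 ^ 2 * (ε * u x ^ 2 / (x.1 ^ 2 + ε) ^ 2)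
        = deriv V x.2 ^ 2 * (ε / (x.1 ^ 2 + ε) ^ 2) * u x ^ 2 := by ring
      rw [h5]
      nlinarith
    have hwi : Integrable (hamD V w) μ :=
      (continuous_hamD hV hw).integrable_of_hasCompactSupport (hasCompactSupport_hamD hwc)
    have h0 : ∫ x, hamD V w x ∂μ = 0 := integral_hamD_of_hasCompactSupport hV hw hwc
    have hint1 : Integrable (fun x => hamD V u x ^ 2 - hamD V w x) μ := hDint.sub hwi
    have hint : Integrable (fun x => hamD V u x ^ 2 - hamD V w x + err ε x) μ :=
      hint1.add (herr_int hε)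
    calc δm * ∫ x, u x ^ 2 ∂μ = ∫ x, δm * u x ^ 2 ∂μ := (integral_const_mul _ _).symm
      _ ≤ ∫ x, (hamD V u x ^ 2 - hamD V w x + err ε x) ∂μ :=
        integral_mono (huint.const_mul _) hint hpt
      _ = _ := by
        rw [integral_add hint1 (herr_int hε), integral_sub hDint hwi, h0, sub_zero]
  have hlim : Tendsto (fun n : ℕ => ∫ x, err (1 / ((n : ℝ) + 1)) x ∂μ) atTop (𝓝 0) := by
    have := tendsto_integral_of_dominated_convergence (μ := μ)
      (F := fun (n : ℕ) x => err (1 / ((n : ℝ) + 1)) x) (f := fun _ => (0 : ℝ)) bd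
      (fun n => (herr_cont Nat.one_div_pos_of_nat).aestronglyMeasurable) hbd
      (fun n => .of_forall fun x => by
        rw [Real.norm_eq_abs, abs_of_nonneg (herr_nonneg Nat.one_div_pos_of_nat x)]
        exact herr_le Nat.one_div_pos_of_nat x)
      (.of_forall fun x => ?_)
    · simpa using this
    -- On `p = 0` the factor `1/(p² + ε)` blows up as `ε → 0`, but there `u` vanishes exactly.
    · by_cases hx : x.1 = 0
      · have : u x = 0 := by
          have := hlip x
          rw [hx, abs_zero, mul_zero] at this
          exact abs_eq_zero.1 (le_antisymm this (abs_nonneg _))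
        simp [err, this]
      · have h1 : ContinuousAt (fun ε => err ε x) 0 := by
          have h2 : x.1 ^ 2 + 0 ≠ 0 := by positivity
          have h3 : (x.1 ^ 2 + 0) ^ 2 ≠ 0 := by positivity
          simp only [err]
          fun_prop (disch := assumption)
        have h4 := h1.tendsto.comp (tendsto_one_div_add_atTop_nhds_zero_nat (𝕜 := ℝ))
        have h5 : err 0 x = 0 := by simp [err]
        rw [h5] at h4
        exact h4
  have := ge_of_tendsto' (hlim.const_add (∫ x, hamD V u x ^ 2 ∂μ)) fun n =>
    main (ε := 1 / ((n : ℝ) + 1)) Nat.one_div_pos_of_nat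
  simpa using this

/-- A Poincaré inequality along the Hamiltonian flow, for functions odd in the momentum. -/
theorem siteMeasure_poincare_odd (hV : IsAdmissible V δm δp) (hβ : 0 < β)
    {u : ℝ × ℝ → ℝ} (hu : ContDiff ℝ (⊤ : ℕ∞) u) (hodd : ∀ x, u (-x.1, x.2) = -u x)
    (hi : Integrable (fun x => u x ^ 2) (siteMeasure V β))
    (hDi : Integrable (fun x => hamD V u x ^ 2) (siteMeasure V β)) :
    δm * ∫ x, u x ^ 2 ∂(siteMeasure V β) ≤ ∫ x, hamD V u x ^ 2 ∂(siteMeasure V β) := by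
  obtain ⟨χ, hs, hc, hD, h0, h1, hsymm, hlim⟩ := exists_energy_cutoff hV
  have hsq (n : ℕ) (x : ℝ × ℝ) : χ n x ^ 2 ≤ 1 := pow_le_one₀ (h0 n x) (h1 n x)
  have hle (n : ℕ) : δm * ∫ x, u x ^ 2 * χ n x ^ 2 ∂(siteMeasure V β)
      ≤ ∫ x, hamD V u x ^ 2 ∂(siteMeasure V β) := by
    -- The energy is even in `p`, so multiplication by the cutoff preserves oddness.
    have h := siteMeasure_poincare_odd_of_hasCompactSupport hV hβ (hu.mul (hs n))
      (hc n).mul_left fun x => by rw [hodd, hsymm]; ring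
    simp_rw [mul_pow] at h
    refine h.trans (integral_mono_of_nonneg (.of_forall fun x => sq_nonneg _) hDi
      (.of_forall fun x => ?_))
    have := hamD_mul (V := V) (hu.differentiable (by simp) x) ((hs n).differentiable (by simp) x)
    rw [hD, mul_zero, add_zero] at this
    show hamD V (fun y => u y * χ n y) x ^ 2 ≤ _
    rw [this, mul_pow]
    exact mul_le_of_le_one_right (sq_nonneg _) (hsq n x)
  have ht : Tendsto (fun n => ∫ x, u x ^ 2 * χ n x ^ 2 ∂(siteMeasure V β)) atTop
      (𝓝 (∫ x, u x ^ 2 ∂(siteMeasure V β))) := by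
    refine tendsto_integral_of_dominated_convergence (fun x => u x ^ 2) (fun n => ?_)
      hi (fun n => .of_forall fun x => ?_) (.of_forall fun x => ?_)
    · exact ((hu.continuous.pow 2).mul ((hs n).continuous.pow 2)).aestronglyMeasurable
    · rw [Real.norm_eq_abs, abs_of_nonneg (by positivity)]
      exact mul_le_of_le_one_right (sq_nonneg _) (hsq n x)
    · refine tendsto_const_nhds.congr' ?_
      filter_upwards [hlim x] with n hn
      rw [hn, one_pow, mul_one]
  exact le_of_tendsto' (ht.const_mul δm) hle

end OneSite

/-! ### The one-site measure as a product -/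

/-- The probability measure on `ℝ` with density proportional to `exp (-W)`. -/
def boltzmann (W : ℝ → ℝ) : Measure ℝ :=
  volume.withDensity fun x => ENNReal.ofReal (Real.exp (-W x) / ∫ y, Real.exp (-W y))

section Boltzmann

variable {W : ℝ → ℝ} {c : ℝ}

theorem integrable_exp_neg_of_quadratic_le (hW : Continuous W) (hc : 0 < c)
    (h : ∀ x, c * x ^ 2 ≤ W x) : Integrable fun x => Real.exp (-W x) := by
  refine (integrable_exp_neg_mul_sq hc).mono' (by fun_prop) (.of_forall fun x => ?_)
  rw [Real.norm_eq_abs, abs_of_pos (Real.exp_pos _)]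
  exact Real.exp_le_exp.2 (by linarith [h x])

theorem isProbabilityMeasure_boltzmann (hW : Continuous W) (hc : 0 < c)
    (h : ∀ x, c * x ^ 2 ≤ W x) : IsProbabilityMeasure (boltzmann W) := by
  have hi := integrable_exp_neg_of_quadratic_le hW hc h
  have hZ : 0 < ∫ y, Real.exp (-W y) := integral_exp_pos hi
  refine ⟨?_⟩
  rw [boltzmann, withDensity_apply _ MeasurableSet.univ, Measure.restrict_univ,
    ← ofReal_integral_eq_lintegral_ofReal (hi.div_const _) (.of_forall fun x => by positivity),
    integral_div, div_self hZ.ne', ENNReal.ofReal_one]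

theorem memLp_id_boltzmann (hW : Continuous W) (hc : 0 < c)
    (h : ∀ x, c * x ^ 2 ≤ W x) {q : ENNReal} (hq : q ≠ ⊤) : MemLp (fun x => x) q (boltzmann W) := by
  have := isProbabilityMeasure_boltzmann hW hc h
  obtain ⟨k, hk⟩ := ENNReal.exists_nat_gt hq
  refine MemLp.mono_exponent (q := (k : ENNReal)) ?_ hk.le
  have hk0 : (k : ENNReal) ≠ 0 := (bot_le.trans_lt hk).ne'
  rw [← integrable_norm_rpow_iff (by fun_prop) hk0 (ENNReal.natCast_ne_top k), boltzmann,
    integrable_withDensity_iff (by fun_prop) (.of_forall fun x => ENNReal.ofReal_lt_top)]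
  have hg := (integrable_rpow_mul_exp_neg_mul_sq hc (s := (k : ℝ))
    (by linarith [(Nat.cast_nonneg k : (0 : ℝ) ≤ k)])).norm.div_const (∫ y, Real.exp (-W y))
  have hZ : 0 ≤ ∫ y, Real.exp (-W y) := integral_nonneg fun x => (Real.exp_pos _).le
  refine hg.mono' (Measurable.aestronglyMeasurable (by fun_prop)) (.of_forall fun x => ?_)
  rw [ENNReal.toReal_ofReal (by positivity), ENNReal.toReal_natCast, Real.rpow_natCast,
    Real.rpow_natCast, norm_mul, norm_mul, norm_pow, norm_pow, norm_norm, norm_div,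
    Real.norm_of_nonneg hZ, mul_div_assoc, Real.norm_of_nonneg (Real.exp_pos _).le,
    Real.norm_of_nonneg (Real.exp_pos _).le]
  gcongr
  linarith [h x]

end Boltzmann

section OneSite

variable {V : ℝ → ℝ} {δm δp β : ℝ}

/-- Independence of `p` and `r` at one site, which later allows positions to be translated relative
to momenta. -/
theorem siteMeasure_eq_prod (hV : IsAdmissible V δm δp) (hβ : 0 < β) :
    siteMeasure V β = (boltzmann fun p => β * (p ^ 2 / 2)).prod (boltzmann fun r => β * V r) := by
  have hcont : Continuous V := hV.smooth.continuous
  rw [boltzmann, boltzmann, prod_withDensity (by fun_prop) (by fun_prop), siteMeasure,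
    Measure.volume_eq_prod]
  congr 1 with x
  have hs : Real.sqrt (2 * Real.pi * β⁻¹) = ∫ p : ℝ, Real.exp (-(β * (p ^ 2 / 2))) := by
    have e (p : ℝ) : -(β * (p ^ 2 / 2)) = -(β / 2) * p ^ 2 := by ring
    simp_rw [e]
    rw [integral_gaussian]; congr 1; field_simp
  have hZ : partitionZ V β = ∫ r : ℝ, Real.exp (-(β * V r)) := by
    simp_rw [partitionZ, neg_mul]
  have h0 : 0 ≤ ∫ p : ℝ, Real.exp (-(β * (p ^ 2 / 2))) :=
    integral_nonneg fun x => (Real.exp_pos _).le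
  rw [← ENNReal.ofReal_mul (by positivity), hs, hZ, div_mul_div_comm, ← Real.exp_add]
  congr 4; ring

theorem momentum_quadratic_le (β : ℝ) (p : ℝ) : β / 2 * p ^ 2 ≤ β * (p ^ 2 / 2) := by
  linarith

theorem position_quadratic_le (hV : IsAdmissible V δm δp) (hβ : 0 < β) (r : ℝ) :
    β * (δm / 2) * r ^ 2 ≤ β * V r := by
  rw [mul_assoc]
  exact mul_le_mul_of_nonneg_left (hV.quadratic_le r) hβ.le

theorem isProbabilityMeasure_momentum (hβ : 0 < β) :
    IsProbabilityMeasure (boltzmann fun p => β * (p ^ 2 / 2)) :=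
  isProbabilityMeasure_boltzmann (by fun_prop) (half_pos hβ) (momentum_quadratic_le β)

theorem isProbabilityMeasure_position (hV : IsAdmissible V δm δp) (hβ : 0 < β) :
    IsProbabilityMeasure (boltzmann fun r => β * V r) :=
  isProbabilityMeasure_boltzmann (by have := hV.smooth.continuous; fun_prop)
    (mul_pos hβ (half_pos hV.pos)) (position_quadratic_le hV hβ)

theorem memLp_fst_siteMeasure (hV : IsAdmissible V δm δp) (hβ : 0 < β) {q : ENNReal}
    (hq : q ≠ ⊤) : MemLp (fun x : ℝ × ℝ => x.1) q (siteMeasure V β) := by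
  have := isProbabilityMeasure_momentum hβ
  have := isProbabilityMeasure_position hV hβ
  rw [siteMeasure_eq_prod hV hβ]
  exact (memLp_id_boltzmann (by fun_prop) (half_pos hβ) (momentum_quadratic_le β)
    hq).comp_measurePreserving measurePreserving_fst

theorem memLp_snd_siteMeasure (hV : IsAdmissible V δm δp) (hβ : 0 < β) {q : ENNReal}
    (hq : q ≠ ⊤) : MemLp (fun x : ℝ × ℝ => x.2) q (siteMeasure V β) := by
  have := isProbabilityMeasure_momentum hβ
  have := isProbabilityMeasure_position hV hβ
  rw [siteMeasure_eq_prod hV hβ]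
  exact (memLp_id_boltzmann (by have := hV.smooth.continuous; fun_prop)
    (mul_pos hβ (half_pos hV.pos)) (position_quadratic_le hV hβ)
    hq).comp_measurePreserving measurePreserving_snd

/-- Reversal of the momentum. -/
def flip (x : ℝ × ℝ) : ℝ × ℝ := (-x.1, x.2)

theorem measurePreserving_flip (hV : IsAdmissible V δm δp) :
    MeasurePreserving flip (siteMeasure V β) (siteMeasure V β) := by
  have hm : Measurable flip := by unfold flip; fun_prop
  have hvol : MeasurePreserving flip (volume : Measure (ℝ × ℝ)) volume :=
    (Measure.measurePreserving_neg (volume : Measure ℝ)).prod (MeasurePreserving.id volume)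
  refine ⟨hm, Measure.ext fun s hs => ?_⟩
  rw [Measure.map_apply hm hs, siteMeasure, withDensity_apply _ (hm hs), withDensity_apply _ hs,
    ← hvol.setLIntegral_comp_preimage hs]
  · simp [flip]
  · exact (continuous_siteDensity hV).measurable.ennreal_ofReal

end OneSite

/-! ### Invariance properties of infinite product measures -/

section InfiniteProduct

variable {α : Type*} [MeasurableSpace α] (μ : Measure α) [IsProbabilityMeasure μ]

theorem measurePreserving_infinitePi_shift (j : ℤ) :
    MeasurePreserving (fun (ω : ℤ → α) i => ω (i + j)) (Measure.infinitePi fun _ => μ)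
      (Measure.infinitePi fun _ => μ) := by
  have hm : Measurable fun (ω : ℤ → α) i => ω (i + j) := by fun_prop
  refine ⟨hm, Measure.eq_infinitePi _ fun s t ht => ?_⟩
  rw [Measure.map_apply hm (.pi s.countable_toSet fun i _ => ht i)]
  have : (fun (ω : ℤ → α) i => ω (i + j)) ⁻¹' (s : Set ℤ).pi t =
      (s.map (addRightEmbedding j) : Set ℤ).pi fun i => t (i - j) := by
    ext ω
    simp only [Set.mem_preimage, Set.mem_pi, Finset.mem_coe, Finset.mem_map,
      addRightEmbedding_apply]
    constructor
    · rintro h _ ⟨i, hi, rfl⟩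
      simpa using h i hi
    · intro h i hi
      simpa using h (i + j) ⟨i, hi, rfl⟩
  rw [this, Measure.infinitePi_pi _ fun i _ => ht _, Finset.prod_map]
  simp

/-- Resampling one coordinate independently does not change the law. With Fubini this lifts one-site
statements to the infinite product. -/
theorem measurePreserving_infinitePi_update (i : ℤ) :
    MeasurePreserving (fun z : (ℤ → α) × α => Function.update z.1 i z.2)
      ((Measure.infinitePi fun _ => μ).prod μ) (Measure.infinitePi fun _ => μ) := by
  have hm : Measurable fun z : (ℤ → α) × α => Function.update z.1 i z.2 := by
    refine measurable_pi_iff.2 fun k => ?_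
    rcases eq_or_ne k i with rfl | h
    · simpa using measurable_snd
    · simp only [Function.update_of_ne h]
      fun_prop
  refine ⟨hm, Measure.eq_infinitePi _ fun s t ht => ?_⟩
  rw [Measure.map_apply hm (.pi s.countable_toSet fun i _ => ht i)]
  by_cases hi : i ∈ s
  · have : (fun z : (ℤ → α) × α => Function.update z.1 i z.2) ⁻¹' (s : Set ℤ).pi t =
        ((s.erase i : Finset ℤ) : Set ℤ).pi t ×ˢ t i := by
      ext z
      simp only [Set.mem_preimage, Set.mem_pi, Finset.mem_coe, Set.mem_prod, Finset.mem_erase]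
      constructor
      · intro h
        refine ⟨fun k hk => by simpa [hk.1] using h k hk.2, by simpa using h i hi⟩
      · rintro ⟨h1, h2⟩ k hk
        rcases eq_or_ne k i with rfl | hki
        · simpa using h2
        · simpa [hki] using h1 k ⟨hki, hk⟩
    rw [this, Measure.prod_prod, Measure.infinitePi_pi _ fun i _ => ht _,
      Finset.prod_erase_mul _ _ hi]
  · have : (fun z : (ℤ → α) × α => Function.update z.1 i z.2) ⁻¹' (s : Set ℤ).pi t =
        (s : Set ℤ).pi t ×ˢ Set.univ := by
      ext z
      simp only [Set.mem_preimage, Set.mem_pi, Finset.mem_coe, Set.mem_prod, Set.mem_univ,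
        and_true]
      refine forall₂_congr fun k hk => ?_
      rw [Function.update_of_ne (ne_of_mem_of_not_mem hk hi)]
    rw [this, Measure.prod_prod, Measure.infinitePi_pi _ fun i _ => ht _, measure_univ, mul_one]

theorem measurePreserving_infinitePi_map {f : α → α} (hf : MeasurePreserving f μ μ) (i : ℤ) :
    MeasurePreserving (fun (ω : ℤ → α) => Function.update ω i (f (ω i)))
      (Measure.infinitePi fun _ => μ) (Measure.infinitePi fun _ => μ) := by
  have e : (fun (ω : ℤ → α) => Function.update ω i (f (ω i))) =
      fun ω k => (if k = i then f else id) (ω k) := by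
    ext ω k
    rcases eq_or_ne k i with rfl | h <;> simp [*]
  have hm (k : ℤ) : Measurable (if k = i then f else id) := by
    split_ifs; exacts [hf.measurable, measurable_id]
  rw [e]
  refine ⟨measurable_pi_iff.2 fun k => (hm k).comp (measurable_pi_apply k), ?_⟩
  rw [Measure.infinitePi_map_pi _ hm]
  congr 1 with k : 1
  split_ifs
  · exact hf.map_eq
  · exact Measure.map_id

/-- An i.i.d. sequence of independent pairs is a pair of independent i.i.d. sequences. Both measures
are determined by their finite marginals, where this is a finite rearrangement. -/
theorem measurePreserving_infinitePi_pair {γ : Type*} [MeasurableSpace γ] (ν : Measure γ)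
    [IsProbabilityMeasure ν] :
    MeasurePreserving (fun (z : (ℤ → α) × (ℤ → γ)) i => (z.1 i, z.2 i))
      ((Measure.infinitePi fun _ => μ).prod (Measure.infinitePi fun _ => ν))
      (Measure.infinitePi fun _ => μ.prod ν) := by
  have hm : Measurable fun (z : (ℤ → α) × (ℤ → γ)) i => (z.1 i, z.2 i) := by fun_prop
  refine ⟨hm, IsProjectiveLimit.unique (P := fun I : Finset ℤ => Measure.pi fun _ : I => μ.prod ν)
    (fun I => ?_) (Measure.isProjectiveLimit_infinitePi _)⟩
  rw [Measure.map_map (by fun_prop) hm]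
  have e : I.restrict ∘ (fun (z : (ℤ → α) × (ℤ → γ)) i => (z.1 i, z.2 i)) =
      (MeasurableEquiv.arrowProdEquivProdArrow α γ I).symm ∘ Prod.map I.restrict I.restrict := rfl
  rw [e, ← Measure.map_map (MeasurableEquiv.measurable _) (by fun_prop),
    ← Measure.map_prod_map _ _ (by fun_prop) (by fun_prop), Measure.infinitePi_map_restrict,
    Measure.infinitePi_map_restrict]
  exact ((measurePreserving_arrowProdEquivProdArrow α γ I (fun _ => μ) fun _ => ν).symm).map_eq

end InfiniteProduct

/-! ### Symmetries of the Gibbs measure -/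

section Gibbs

variable {V : ℝ → ℝ} {δm δp β : ℝ}

/-- Translation of the positions relative to the momenta. -/
def slide (s : ℤ) (ω : Config) : Config := fun k => ((ω k).1, (ω (k - s)).2)

/-- Reversal of the momentum at the site `i`. -/
def flipAt (i : ℤ) (ω : Config) : Config := Function.update ω i (flip (ω i))

theorem isProbabilityMeasure_gibbs (hV : IsAdmissible V δm δp) (hβ : 0 < β) :
    IsProbabilityMeasure (gibbs V β) := by
  have := isProbabilityMeasure_siteMeasure hV hβ
  unfold gibbs; infer_instance

theorem measurePreserving_shift (hV : IsAdmissible V δm δp) (hβ : 0 < β) (j : ℤ) :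
    MeasurePreserving (fun (ω : Config) i => ω (i + j)) (gibbs V β) (gibbs V β) := by
  have := isProbabilityMeasure_siteMeasure hV hβ
  exact measurePreserving_infinitePi_shift _ j

theorem measurePreserving_update (hV : IsAdmissible V δm δp) (hβ : 0 < β) (i : ℤ) :
    MeasurePreserving (fun z : Config × (ℝ × ℝ) => Function.update z.1 i z.2)
      ((gibbs V β).prod (siteMeasure V β)) (gibbs V β) := by
  have := isProbabilityMeasure_siteMeasure hV hβ
  exact measurePreserving_infinitePi_update _ i

theorem measurePreserving_eval (hV : IsAdmissible V δm δp) (hβ : 0 < β) (i : ℤ) :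
    MeasurePreserving (fun ω : Config => ω i) (gibbs V β) (siteMeasure V β) := by
  have := isProbabilityMeasure_siteMeasure hV hβ
  exact measurePreserving_eval_infinitePi _ i

theorem measurePreserving_flipAt (hV : IsAdmissible V δm δp) (hβ : 0 < β) (i : ℤ) :
    MeasurePreserving (flipAt i) (gibbs V β) (gibbs V β) := by
  have := isProbabilityMeasure_siteMeasure hV hβ
  exact measurePreserving_infinitePi_map _ (measurePreserving_flip hV) i

/-- Momenta and positions form independent i.i.d. families, so one may be shifted against the other.
This symmetry conjugates `X_i` to `Y_{i,i+s}`. -/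
theorem measurePreserving_slide (hV : IsAdmissible V δm δp) (hβ : 0 < β) (s : ℤ) :
    MeasurePreserving (slide s) (gibbs V β) (gibbs V β) := by
  have := isProbabilityMeasure_momentum hβ
  have := isProbabilityMeasure_position hV hβ
  have hp := measurePreserving_infinitePi_pair (boltzmann fun p => β * (p ^ 2 / 2))
    (boltzmann fun r => β * V r)
  have hs := (MeasurePreserving.id (Measure.infinitePi fun _ : ℤ =>
    boltzmann fun p => β * (p ^ 2 / 2))).prod
    (measurePreserving_infinitePi_shift (boltzmann fun r => β * V r) (-s))
  have h : gibbs V β = Measure.infinitePi fun _ : ℤ =>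
      (boltzmann fun p => β * (p ^ 2 / 2)).prod (boltzmann fun r => β * V r) := by
    unfold gibbs
    congr 1 with i : 1
    exact siteMeasure_eq_prod hV hβ
  have hm : Measurable (slide s) := by unfold slide; fun_prop
  refine ⟨hm, ?_⟩
  rw [h]
  conv_lhs => rw [← hp.map_eq]
  rw [Measure.map_map hm hp.measurable, ← (hp.comp hs).map_eq]
  rfl

end Gibbs

/-! ### Smooth local functions -/

/-- Smooth functions of finitely many coordinates, with values in a normed space. -/
def SmoothLocal {E : Type*} [NormedAddCommGroup E] [NormedSpace ℝ E] (f : Config → E) : Prop :=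
  ∃ (Λ : Finset ℤ) (φ : (Λ → ℝ × ℝ) → E), ContDiff ℝ (⊤ : ℕ∞) φ ∧ ∀ ω, f ω = φ fun i => ω i

/-- The function `f` does not depend on the coordinates outside `Λ`. -/
def DependsOnlyOn (Λ : Finset ℤ) (f : Config → ℝ) : Prop :=
  ∀ ω ω' : Config, (∀ i ∈ Λ, ω i = ω' i) → f ω = f ω'

namespace SmoothLocal

variable {E F : Type*} [NormedAddCommGroup E] [NormedSpace ℝ E] [NormedAddCommGroup F]
  [NormedSpace ℝ F]

theorem exists_superset {f : Config → E} (hf : SmoothLocal f) (M : Finset ℤ) :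
    ∃ (Λ : Finset ℤ) (φ : (Λ → ℝ × ℝ) → E), M ⊆ Λ ∧ ContDiff ℝ (⊤ : ℕ∞) φ ∧
      ∀ ω, f ω = φ fun i => ω i := by
  obtain ⟨Λ, φ, hφ, h⟩ := hf
  refine ⟨Λ ∪ M, fun y => φ fun i => y ⟨i, Finset.mem_union_left _ i.2⟩,
    Finset.subset_union_right, hφ.comp ?_, h⟩
  exact contDiff_pi.2 fun i => contDiff_apply _ _ _

theorem comp {f : Config → E} (hf : SmoothLocal f) {ψ : E → F} (hψ : ContDiff ℝ (⊤ : ℕ∞) ψ) :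
    SmoothLocal fun ω => ψ (f ω) := by
  obtain ⟨Λ, φ, hφ, h⟩ := hf
  exact ⟨Λ, fun y => ψ (φ y), hψ.comp hφ, fun ω => congrArg ψ (h ω)⟩

theorem const (c : E) : SmoothLocal fun _ => c := ⟨∅, fun _ => c, contDiff_const, fun _ => rfl⟩

theorem coord (k : ℤ) : SmoothLocal fun ω => ω k :=
  ⟨{k}, fun y => y ⟨k, Finset.mem_singleton_self k⟩, contDiff_apply _ _ _, fun _ => rfl⟩

theorem prodMk {f : Config → E} {g : Config → F} (hf : SmoothLocal f) (hg : SmoothLocal g) :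
    SmoothLocal fun ω => (f ω, g ω) := by
  obtain ⟨M, ψ, hψ, h'⟩ := hg
  obtain ⟨Λ, φ, hM, hφ, h⟩ := hf.exists_superset M
  refine ⟨Λ, fun y => (φ y, ψ fun i => y ⟨i, hM i.2⟩), hφ.prodMk (hψ.comp ?_), fun ω =>
    Prod.ext (h ω) (h' ω)⟩
  exact contDiff_pi.2 fun i => contDiff_apply _ _ _

theorem pi {ι : Type*} [Fintype ι] {f : ι → Config → E} (hf : ∀ k, SmoothLocal (f k)) :
    SmoothLocal fun ω k => f k ω := by
  choose Λ φ hφ h using hf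
  refine ⟨Finset.univ.biUnion Λ, fun y k => φ k fun i =>
    y ⟨i, Finset.mem_biUnion.2 ⟨k, Finset.mem_univ k, i.2⟩⟩,
    contDiff_pi.2 fun k => (hφ k).comp ?_, fun ω => ?_⟩
  · exact contDiff_pi.2 fun i => contDiff_apply _ _ _
  · ext k; exact h k ω

/-- Substitution in a smooth local function. -/
theorem subst {f : Config → E} (hf : SmoothLocal f) {T : Config → Config}
    (hT : ∀ k, SmoothLocal fun ω => T ω k) : SmoothLocal fun ω => f (T ω) := by
  obtain ⟨Λ, φ, hφ, h⟩ := hf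
  have := (pi fun k : Λ => hT k).comp hφ
  simpa only [h] using this

theorem add {f g : Config → E} (hf : SmoothLocal f) (hg : SmoothLocal g) :
    SmoothLocal (f + g) := (hf.prodMk hg).comp (ψ := fun z => z.1 + z.2) (by fun_prop)

theorem sub {f g : Config → E} (hf : SmoothLocal f) (hg : SmoothLocal g) :
    SmoothLocal (f - g) := (hf.prodMk hg).comp (ψ := fun z => z.1 - z.2) (by fun_prop)

theorem smul {f : Config → E} (hf : SmoothLocal f) (c : ℝ) : SmoothLocal (c • f) :=
  hf.comp (ψ := fun z => c • z) (by fun_prop)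

theorem mul {f g : Config → ℝ} (hf : SmoothLocal f) (hg : SmoothLocal g) :
    SmoothLocal (f * g) := (hf.prodMk hg).comp (ψ := fun z => z.1 * z.2) (by fun_prop)

theorem sum {ι : Type*} (s : Finset ι) {f : ι → Config → E} (hf : ∀ k ∈ s, SmoothLocal (f k)) :
    SmoothLocal (∑ k ∈ s, f k) :=
  Finset.sum_induction f SmoothLocal (fun _ _ => add) (const 0) hf

theorem shift {f : Config → ℝ} (hf : SmoothLocal f) (j : ℤ) : SmoothLocal (shift j f) :=
  hf.subst fun k => coord (k + j)

theorem slide {f : Config → E} (hf : SmoothLocal f) (s : ℤ) :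
    SmoothLocal fun ω => f (slide s ω) :=
  hf.subst fun k => ((coord k).comp contDiff_fst).prodMk ((coord (k - s)).comp contDiff_snd)

theorem flipAt {f : Config → E} (hf : SmoothLocal f) (i : ℤ) :
    SmoothLocal fun ω => f (flipAt i ω) := by
  refine hf.subst fun k => ?_
  have h : ContDiff ℝ (⊤ : ℕ∞) flip := contDiff_fst.neg.prodMk contDiff_snd
  rcases eq_or_ne k i with rfl | hk
  · simpa [EnergyChain.flipAt] using (coord k).comp h
  · simpa [EnergyChain.flipAt, hk] using coord k

theorem continuous {f : Config → E} (hf : SmoothLocal f) : Continuous f := by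
  obtain ⟨Λ, φ, hφ, h⟩ := hf
  rw [show f = fun ω => φ fun i => ω i from funext h]
  exact hφ.continuous.comp (by fun_prop)

theorem contDiff_slice {f : Config → E} (hf : SmoothLocal f) (ω : Config) (i : ℤ) :
    ContDiff ℝ (⊤ : ℕ∞) fun x => f (Function.update ω i x) := by
  obtain ⟨Λ, φ, hφ, h⟩ := hf
  simp only [h]
  refine hφ.comp (contDiff_pi.2 fun k => ?_)
  rcases eq_or_ne (k : ℤ) i with hk | hk
  · simpa [hk] using contDiff_fun_id
  · simpa [hk] using contDiff_const

theorem hasFDerivAt_slice {f : Config → E} (hf : SmoothLocal f) (ω : Config) (i : ℤ)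
    (x : ℝ × ℝ) : HasFDerivAt (fun x => f (Function.update ω i x))
      (fderiv ℝ (fun x => f (Function.update ω i x)) x) x :=
  ((hf.contDiff_slice ω i).differentiable (by simp) x).hasFDerivAt

end SmoothLocal

theorem dp_eq_fderiv {f : Config → ℝ} (hf : SmoothLocal f) (i : ℤ) (ω : Config) :
    dp i f ω = fderiv ℝ (fun x => f (Function.update ω i x)) (ω i) (1, 0) := by
  have h1 : HasDerivAt (fun x : ℝ => (x, (ω i).2)) (1, 0) (ω i).1 :=
    (hasDerivAt_id _).prodMk (hasDerivAt_const _ _)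
  exact ((hf.hasFDerivAt_slice ω i (ω i)).comp_hasDerivAt _ h1).deriv

theorem dr_eq_fderiv {f : Config → ℝ} (hf : SmoothLocal f) (i : ℤ) (ω : Config) :
    dr i f ω = fderiv ℝ (fun x => f (Function.update ω i x)) (ω i) (0, 1) := by
  have h1 : HasDerivAt (fun x : ℝ => ((ω i).1, x)) (0, 1) (ω i).2 :=
    (hasDerivAt_const _ _).prodMk (hasDerivAt_id _)
  exact ((hf.hasFDerivAt_slice ω i (ω i)).comp_hasDerivAt _ h1).deriv

/-- Differentiating in one coordinate of the configuration is differentiating the finite-dimensional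
`φ` in a coordinate direction; hence partial derivatives stay smooth, local and, where applicable,
compactly supported. -/
theorem fderiv_slice_apply {f : Config → ℝ} {Λ : Finset ℤ} {φ : (Λ → ℝ × ℝ) → ℝ}
    (hφ : ContDiff ℝ (⊤ : ℕ∞) φ) (h : ∀ ω, f ω = φ fun i => ω i) {i : ℤ} (hi : i ∈ Λ)
    (ω : Config) (v : ℝ × ℝ) :
    fderiv ℝ (fun x => f (Function.update ω i x)) (ω i) v =
      fderiv ℝ φ (fun k => ω k) (Pi.single ⟨i, hi⟩ v) := by
  have h1 : HasFDerivAt (fun x (k : Λ) => Function.update ω i x k)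
      (ContinuousLinearMap.single ℝ (fun _ : Λ => ℝ × ℝ) ⟨i, hi⟩) (ω i) := by
    refine hasFDerivAt_pi'.2 fun k => ?_
    rcases eq_or_ne k ⟨i, hi⟩ with rfl | hk
    · simp only [Function.update_self]
      exact (hasFDerivAt_id (𝕜 := ℝ) (ω i)).congr_fderiv
        (ContinuousLinearMap.ext fun w => by simp)
    · have hk' : (k : ℤ) ≠ i := fun h => hk (Subtype.ext h)
      simp only [Function.update_of_ne hk']
      exact (hasFDerivAt_const (𝕜 := ℝ) (ω k) (ω i)).congr_fderiv
        (ContinuousLinearMap.ext fun w => by simp [hk])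
  have h2 := hφ.differentiable (by simp) fun k : Λ => Function.update ω i (ω i) k
  have h3 := h2.hasFDerivAt.comp (ω i) h1
  have e : (fun x => f (Function.update ω i x)) = φ ∘ fun x (k : Λ) => Function.update ω i x k := by
    ext x; exact h _
  simp only [e, h3.fderiv, Function.update_eq_self]
  rfl

theorem smoothLocal_fderiv {f : Config → ℝ} (hf : SmoothLocal f) (i : ℤ) (v : ℝ × ℝ) :
    SmoothLocal fun ω => fderiv ℝ (fun x => f (Function.update ω i x)) (ω i) v := by
  obtain ⟨Λ, φ, hi, hφ, h⟩ := hf.exists_superset {i}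
  exact ⟨Λ, fun y => fderiv ℝ φ y (Pi.single ⟨i, Finset.singleton_subset_iff.1 hi⟩ v),
    (hφ.fderiv_right (m := (⊤ : ℕ∞)) (by simp)).clm_apply contDiff_const,
    fun ω => fderiv_slice_apply hφ h _ ω v⟩

/-! ### Calculus of the vector fields on smooth local functions -/

section Calculus

variable {V : ℝ → ℝ} {δm δp β : ℝ} {f g : Config → ℝ}

theorem SmoothLocal.dp (hf : SmoothLocal f) (i : ℤ) : SmoothLocal (dp i f) := by
  rw [show EnergyChain.dp i f = _ from funext fun ω => dp_eq_fderiv hf i ω]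
  exact smoothLocal_fderiv hf i _

theorem SmoothLocal.dr (hf : SmoothLocal f) (i : ℤ) : SmoothLocal (dr i f) := by
  rw [show EnergyChain.dr i f = _ from funext fun ω => dr_eq_fderiv hf i ω]
  exact smoothLocal_fderiv hf i _

theorem smoothLocal_momentum (i : ℤ) : SmoothLocal fun ω => (ω i).1 :=
  (SmoothLocal.coord i).comp contDiff_fst

theorem smoothLocal_position (i : ℤ) : SmoothLocal fun ω => (ω i).2 :=
  (SmoothLocal.coord i).comp contDiff_snd

theorem smoothLocal_force (hV : IsAdmissible V δm δp) (i : ℤ) :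
    SmoothLocal fun ω => deriv V (ω i).2 :=
  (smoothLocal_position i).comp hV.contDiff_deriv

theorem SmoothLocal.Y (hV : IsAdmissible V δm δp) (hf : SmoothLocal f) (i j : ℤ) :
    SmoothLocal (Y V i j f) :=
  ((smoothLocal_momentum i).mul (hf.dr j)).sub ((smoothLocal_force hV j).mul (hf.dp i))

theorem SmoothLocal.differentiableAt_dp (hf : SmoothLocal f) (i : ℤ) (ω : Config) (x : ℝ) :
    DifferentiableAt ℝ (fun x : ℝ => f (Function.update ω i (x, (ω i).2))) x :=
  ((hf.contDiff_slice ω i).differentiable (by simp) (x, (ω i).2)).comp x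
    (f := fun x : ℝ => (x, (ω i).2)) (by fun_prop)

theorem SmoothLocal.differentiableAt_dr (hf : SmoothLocal f) (i : ℤ) (ω : Config) (x : ℝ) :
    DifferentiableAt ℝ (fun x : ℝ => f (Function.update ω i ((ω i).1, x))) x :=
  ((hf.contDiff_slice ω i).differentiable (by simp) ((ω i).1, x)).comp x
    (f := fun x : ℝ => ((ω i).1, x)) (by fun_prop)

theorem dp_add (hf : SmoothLocal f) (hg : SmoothLocal g) (i : ℤ) :
    dp i (f + g) = dp i f + dp i g := by
  ext ω
  exact deriv_fun_add (hf.differentiableAt_dp i ω _) (hg.differentiableAt_dp i ω _)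

theorem dr_add (hf : SmoothLocal f) (hg : SmoothLocal g) (i : ℤ) :
    dr i (f + g) = dr i f + dr i g := by
  ext ω
  exact deriv_fun_add (hf.differentiableAt_dr i ω _) (hg.differentiableAt_dr i ω _)

theorem dp_smul (hf : SmoothLocal f) (c : ℝ) (i : ℤ) : dp i (c • f) = c • dp i f := by
  ext ω
  exact deriv_const_mul c (hf.differentiableAt_dp i ω _)

theorem dr_smul (hf : SmoothLocal f) (c : ℝ) (i : ℤ) : dr i (c • f) = c • dr i f := by
  ext ω
  exact deriv_const_mul c (hf.differentiableAt_dr i ω _)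

theorem dp_mul (hf : SmoothLocal f) (hg : SmoothLocal g) (i : ℤ) :
    dp i (f * g) = dp i f * g + f * dp i g := by
  ext ω
  have h := deriv_fun_mul (hf.differentiableAt_dp i ω (ω i).1)
    (hg.differentiableAt_dp i ω (ω i).1)
  have e : Function.update ω i ((ω i).1, (ω i).2) = ω := Function.update_eq_self i ω
  rw [e] at h
  exact h

theorem dr_mul (hf : SmoothLocal f) (hg : SmoothLocal g) (i : ℤ) :
    dr i (f * g) = dr i f * g + f * dr i g := by
  ext ω
  have h := deriv_fun_mul (hf.differentiableAt_dr i ω (ω i).2)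
    (hg.differentiableAt_dr i ω (ω i).2)
  have e : Function.update ω i ((ω i).1, (ω i).2) = ω := Function.update_eq_self i ω
  rw [e] at h
  exact h

theorem Y_add (hf : SmoothLocal f) (hg : SmoothLocal g) (i j : ℤ) :
    Y V i j (f + g) = Y V i j f + Y V i j g := by
  ext ω
  simp only [Y, dp_add hf hg, dr_add hf hg, Pi.add_apply]; ring

theorem Y_smul (hf : SmoothLocal f) (c : ℝ) (i j : ℤ) : Y V i j (c • f) = c • Y V i j f := by
  ext ω
  simp only [Y, dp_smul hf, dr_smul hf, Pi.smul_apply, smul_eq_mul]; ring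

theorem Y_sub (hf : SmoothLocal f) (hg : SmoothLocal g) (i j : ℤ) :
    Y V i j (f - g) = Y V i j f - Y V i j g := by
  have h := Y_add (V := V) hf (hg.smul (-1)) i j
  rw [Y_smul hg] at h
  simpa [sub_eq_add_neg] using h

theorem Y_mul (hf : SmoothLocal f) (hg : SmoothLocal g) (i j : ℤ) :
    Y V i j (f * g) = Y V i j f * g + f * Y V i j g := by
  ext ω
  simp only [Y, dp_mul hf hg, dr_mul hf hg, Pi.add_apply, Pi.mul_apply]; ring

theorem Y_zero (i j : ℤ) : Y V i j 0 = 0 := by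
  ext ω; simp [Y, dp, dr]

theorem Y_sum {ι : Type*} (s : Finset ι) {f : ι → Config → ℝ} (hf : ∀ k, SmoothLocal (f k))
    (i j : ℤ) : Y V i j (∑ k ∈ s, f k) = ∑ k ∈ s, Y V i j (f k) := by
  classical
  induction s using Finset.induction_on with
  | empty => simp [Y_zero]
  | insert a s ha ih =>
    rw [Finset.sum_insert ha, Finset.sum_insert ha,
      Y_add (hf a) (SmoothLocal.sum s fun k _ => hf k), ih]

theorem X_eq_hamD (hf : SmoothLocal f) (i : ℤ) (ω : Config) :
    X V i f ω = hamD V (fun x => f (Function.update ω i x)) (ω i) := by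
  rw [hamD_eq, X, Y, dp_eq_fderiv hf, dr_eq_fderiv hf]

theorem Y_shift (i j k : ℤ) (f : Config → ℝ) :
    Y V (i + k) (j + k) (shift k f) = shift k (Y V i j f) := by
  have h (ω : Config) (i : ℤ) (x : ℝ × ℝ) : (fun m => Function.update ω (i + k) x (m + k)) =
      Function.update (fun m => ω (m + k)) i x := by
    ext m : 1
    rcases eq_or_ne m i with rfl | hm
    · simp
    · simp [hm]
  ext ω
  simp only [Y, shift, dp, dr, h]

theorem shift_shift (j k : ℤ) (f : Config → ℝ) : shift j (shift k f) = shift (j + k) f := by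
  ext ω
  simp only [shift]
  congr 1 with i : 1
  rw [add_assoc, add_comm k]

/-- `slide s` moves `r_i` to the site `i + s` and leaves `p_i` in place, so the pair `(p_i, r_i)`
becomes the pair `(p_i, r_{i+s})` on which `Y_{i,i+s}` acts. -/
theorem X_slide (i s : ℤ) (f : Config → ℝ) (ω : Config) :
    X V i (fun ω => f (slide s ω)) ω = Y V i (i + s) f (slide s ω) := by
  have hp (x : ℝ) : slide s (Function.update ω i (x, (ω i).2)) =
      Function.update (slide s ω) i (x, (slide s ω i).2) := by
    ext k : 1
    simp only [slide, Function.update_apply]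
    split_ifs <;> simp_all
  have hr (x : ℝ) : slide s (Function.update ω i ((ω i).1, x)) =
      Function.update (slide s ω) (i + s) ((slide s ω (i + s)).1, x) := by
    ext k : 1
    simp only [slide, Function.update_apply, sub_eq_iff_eq_add]
    split_ifs <;> simp_all
  simp only [X, Y, dp, dr, hp, hr]
  simp [slide]

/-- Time reversal: both terms of `p ∂_r - V'(r) ∂_p` change sign with `p`. -/
theorem X_flipAt (i : ℤ) (f : Config → ℝ) (ω : Config) :
    X V i (fun ω => f (flipAt i ω)) ω = -X V i f (flipAt i ω) := by
  have h1 (x : ℝ × ℝ) : flipAt i (Function.update ω i x) = Function.update ω i (flip x) := by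
    simp [flipAt]
  have h2 (x : ℝ × ℝ) : Function.update (flipAt i ω) i x = Function.update ω i x := by
    simp [flipAt]
  simp only [X, Y, dp, dr, h1, h2, flip]
  have h3 := deriv_comp_neg (fun x : ℝ => f (Function.update ω i (x, (ω i).2))) (ω i).1
  rw [h3]
  simp [flipAt, flip]
  ring

theorem flipAt_flipAt (i : ℤ) (ω : Config) : flipAt i (flipAt i ω) = ω := by
  simp [flipAt, flip]

theorem Y_eq_zero_of_dependsOnlyOn {Λ : Finset ℤ} (hf : DependsOnlyOn Λ f) {i j : ℤ}
    (hi : i ∉ Λ) (hj : j ∉ Λ) : Y V i j f = 0 := by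
  have h (ω : Config) {k : ℤ} (hk : k ∉ Λ) (x : ℝ × ℝ) : f (Function.update ω k x) = f ω :=
    hf _ _ fun m hm => Function.update_of_ne (ne_of_mem_of_not_mem hm hk) _ _
  ext ω
  simp [Y, dp, dr, h ω hi, h ω hj]

theorem SmoothLocal.exists_dependsOnlyOn (hf : SmoothLocal f) : ∃ Λ, DependsOnlyOn Λ f := by
  obtain ⟨Λ, φ, -, h⟩ := hf
  refine ⟨Λ, fun ω ω' hω => ?_⟩
  rw [h, h]
  congr 1 with i : 1
  exact hω i i.2

end Calculus

/-! ### Integration by parts and the sector estimate -/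

theorem integral_comp_of_measurePreserving {α γ : Type*} [MeasurableSpace α] [MeasurableSpace γ]
    {μ : Measure α} {ν : Measure γ} {T : α → γ} (hT : MeasurePreserving T μ ν) {f : γ → ℝ}
    (hf : AEStronglyMeasurable f ν) : ∫ x, f (T x) ∂μ = ∫ y, f y ∂ν := by
  rw [← hT.map_eq, integral_map hT.measurable.aemeasurable (by rwa [hT.map_eq])]

theorem integrable_mul_of_memLp_two {α : Type*} [MeasurableSpace α] {μ : Measure α} {a b : α → ℝ}
    (ha : MemLp a 2 μ) (hb : MemLp b 2 μ) : Integrable (fun x => a x * b x) μ :=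
  ha.integrable_mul hb

theorem abs_integral_mul_le {α : Type*} [MeasurableSpace α] {μ : Measure α} {a b : α → ℝ}
    (ha : MemLp a 2 μ) (hb : MemLp b 2 μ) :
    |∫ x, a x * b x ∂μ| ≤ √(∫ x, a x ^ 2 ∂μ) * √(∫ x, b x ^ 2 ∂μ) := by
  have hi {f g : α → ℝ} (hf : MemLp f 2 μ) (hg : MemLp g 2 μ) :
      inner ℝ (hf.toLp f) (hg.toLp g) = ∫ x, f x * g x ∂μ := by
    rw [L2.inner_def]
    refine integral_congr_ae ?_
    filter_upwards [hf.coeFn_toLp, hg.coeFn_toLp] with x h1 h2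
    rw [h1, h2]; simp [mul_comm]
  have hn {f : α → ℝ} (hf : MemLp f 2 μ) : ‖hf.toLp f‖ = √(∫ x, f x ^ 2 ∂μ) := by
    rw [norm_eq_sqrt_real_inner, hi hf hf]; simp_rw [sq]
  rw [← hi ha hb, ← hn ha, ← hn hb]
  exact abs_real_inner_le_norm _ _

theorem SmoothLocal.aestronglyMeasurable {f : Config → ℝ} (hf : SmoothLocal f)
    (μ : Measure Config) : AEStronglyMeasurable f μ :=
  hf.continuous.aestronglyMeasurable

section Gibbs

variable {V : ℝ → ℝ} {δm δp β : ℝ} {f g : Config → ℝ}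

theorem X_update (hf : SmoothLocal f) (i : ℤ) (ω : Config) (x : ℝ × ℝ) :
    X V i f (Function.update ω i x) = hamD V (fun y => f (Function.update ω i y)) x := by
  rw [X_eq_hamD hf]
  simp

theorem integral_X_eq_zero (hV : IsAdmissible V δm δp) (hβ : 0 < β) (hf : SmoothLocal f) (i : ℤ)
    (hi : Integrable (X V i f) (gibbs V β)) : ∫ ω, X V i f ω ∂(gibbs V β) = 0 := by
  have := isProbabilityMeasure_siteMeasure hV hβ
  have := isProbabilityMeasure_gibbs hV hβ
  have hT := measurePreserving_update hV hβ i
  have hiT : Integrable (fun z : Config × (ℝ × ℝ) => X V i f (Function.update z.1 i z.2))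
      ((gibbs V β).prod (siteMeasure V β)) := hT.integrable_comp_of_integrable hi
  -- With the site `i` resampled, Fubini integrates that site first, with the others frozen.
  rw [← integral_comp_of_measurePreserving hT hi.aestronglyMeasurable, integral_prod _ hiT]
  refine integral_eq_zero_of_ae ?_
  filter_upwards [hiT.prod_right_ae] with ω hω
  simp only [X_update hf] at hω ⊢
  exact integral_hamD_eq_zero hV (hf.contDiff_slice ω i) hω

theorem integral_sq_le_of_odd (hV : IsAdmissible V δm δp) (hβ : 0 < β) (hf : SmoothLocal f)
    (i : ℤ) (hodd : ∀ ω, f (flipAt i ω) = -f ω) (h2 : MemLp f 2 (gibbs V β))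
    (hX : MemLp (X V i f) 2 (gibbs V β)) :
    δm * ∫ ω, f ω ^ 2 ∂(gibbs V β) ≤ ∫ ω, X V i f ω ^ 2 ∂(gibbs V β) := by
  have := isProbabilityMeasure_siteMeasure hV hβ
  have := isProbabilityMeasure_gibbs hV hβ
  have hT := measurePreserving_update hV hβ i
  have h2' := h2.integrable_sq
  have hX' := hX.integrable_sq
  have hi1 : Integrable (fun z : Config × (ℝ × ℝ) => f (Function.update z.1 i z.2) ^ 2)
      ((gibbs V β).prod (siteMeasure V β)) := hT.integrable_comp_of_integrable h2'
  have hi2 : Integrable (fun z : Config × (ℝ × ℝ) => X V i f (Function.update z.1 i z.2) ^ 2)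
      ((gibbs V β).prod (siteMeasure V β)) := hT.integrable_comp_of_integrable hX'
  rw [← integral_comp_of_measurePreserving hT h2'.aestronglyMeasurable,
    ← integral_comp_of_measurePreserving hT hX'.aestronglyMeasurable, integral_prod _ hi1,
    integral_prod _ hi2, ← integral_const_mul]
  refine integral_mono_ae (hi1.integral_prod_left.const_mul _) hi2.integral_prod_left ?_
  filter_upwards [hi1.prod_right_ae, hi2.prod_right_ae] with ω h1 h2
  simp only [X_update hf] at h2 ⊢
  refine siteMeasure_poincare_odd hV hβ (hf.contDiff_slice ω i) (fun x => ?_) h1 h2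
  rw [← hodd]
  simp [flipAt, flip]

theorem integral_X_mul (hV : IsAdmissible V δm δp) (hβ : 0 < β) (hf : SmoothLocal f)
    (hg : SmoothLocal g) (i : ℤ) (hf2 : MemLp f 2 (gibbs V β))
    (hXf : MemLp (X V i f) 2 (gibbs V β)) (hg2 : MemLp g 2 (gibbs V β))
    (hXg : MemLp (X V i g) 2 (gibbs V β)) :
    ∫ ω, X V i f ω * g ω ∂(gibbs V β) = -∫ ω, f ω * X V i g ω ∂(gibbs V β) := by
  have h1 : Integrable (fun ω => X V i f ω * g ω) (gibbs V β) := hXf.integrable_mul hg2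
  have h2 : Integrable (fun ω => f ω * X V i g ω) (gibbs V β) := hf2.integrable_mul hXg
  have e : X V i (f * g) = fun ω => X V i f ω * g ω + f ω * X V i g ω := Y_mul hf hg i i
  have h := integral_X_eq_zero hV hβ (hf.mul hg) i (by rw [e]; exact h1.add h2)
  rw [e, integral_add h1 h2] at h
  linarith

/-- The values `c = -1` and `c = 1` select the odd and the even part in `p_i`; the change of sign of
`c` says that `X_i` exchanges the two. -/
theorem X_oddPart (hf : SmoothLocal f) (i : ℤ) (c : ℝ) :
    X V i (fun ω => (1 / 2) * (f ω + c * f (flipAt i ω))) =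
      fun ω => (1 / 2) * (X V i f ω - c * X V i f (flipAt i ω)) := by
  have h := Y_smul (V := V) (hf.add ((hf.flipAt i).smul c)) (1 / 2) i i
  rw [Y_add hf ((hf.flipAt i).smul c), Y_smul (hf.flipAt i)] at h
  refine h.trans ?_
  ext ω
  have h2 := X_flipAt (V := V) i f ω
  simp only [X] at h2 ⊢
  simp only [Pi.smul_apply, Pi.add_apply, smul_eq_mul, h2]
  ring

theorem integral_sq_half_le {T : Config → Config} {μ : Measure Config}
    (hT : MeasurePreserving T μ μ) (h2 : MemLp f 2 μ) {c : ℝ} (hc : c ^ 2 = 1) :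
    MemLp (fun ω => (1 / 2) * (f ω + c * f (T ω))) 2 μ ∧
      ∫ ω, ((1 / 2) * (f ω + c * f (T ω))) ^ 2 ∂μ ≤ ∫ ω, f ω ^ 2 ∂μ := by
  have hT2 : MemLp (fun ω => f (T ω)) 2 μ := h2.comp_measurePreserving hT
  have hm : MemLp (fun ω => (1 / 2) * (f ω + c * f (T ω))) 2 μ :=
    (h2.add (hT2.const_mul c)).const_mul (1 / 2)
  refine ⟨hm, ?_⟩
  have h1 := h2.integrable_sq
  have h3 := hT2.integrable_sq
  calc ∫ ω, ((1 / 2) * (f ω + c * f (T ω))) ^ 2 ∂μ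
      ≤ ∫ ω, ((1 / 2) * f ω ^ 2 + (1 / 2) * f (T ω) ^ 2) ∂μ := by
        refine integral_mono hm.integrable_sq ((h1.const_mul _).add (h3.const_mul _)) fun ω => ?_
        have h4 : 0 ≤ (f ω - c * f (T ω)) ^ 2 := sq_nonneg _
        have h5 : (c * f (T ω)) ^ 2 = f (T ω) ^ 2 := by rw [mul_pow, hc, one_mul]
        dsimp only
        nlinarith
    _ = ∫ ω, f ω ^ 2 ∂μ := by
        rw [integral_add (h1.const_mul _) (h3.const_mul _), integral_const_mul,
          integral_const_mul, integral_comp_of_measurePreserving (f := fun ω => f ω ^ 2) hT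
          h1.aestronglyMeasurable]
        ring

/-- The one-site form of the sector condition. The odd part of `g` is controlled by the Poincaré
inequality directly. For the even part, `X` is first moved onto `g`; the result is odd, so only the
odd part of `f` contributes and the Poincaré inequality applies to that. Each of the two
contributions costs `1 / √δm`. -/
theorem abs_integral_X_mul_le (hV : IsAdmissible V δm δp) (hβ : 0 < β) (hf : SmoothLocal f)
    (hg : SmoothLocal g) (i : ℤ) (hf2 : MemLp f 2 (gibbs V β))
    (hXf : MemLp (X V i f) 2 (gibbs V β)) (hg2 : MemLp g 2 (gibbs V β))
    (hXg : MemLp (X V i g) 2 (gibbs V β)) :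
    |∫ ω, X V i f ω * g ω ∂(gibbs V β)| ≤ 2 / √δm *
      (√(∫ ω, X V i f ω ^ 2 ∂(gibbs V β)) * √(∫ ω, X V i g ω ^ 2 ∂(gibbs V β))) := by
  set ν := gibbs V β with hν
  have hδ := hV.pos
  have hT : MeasurePreserving (flipAt i) ν ν := measurePreserving_flipAt hV hβ i
  have hneg : (-1 : ℝ) ^ 2 = 1 := by norm_num
  have hodd {f : Config → ℝ} (hf : SmoothLocal f) (hf2 : MemLp f 2 ν)
      (hXf : MemLp (X V i f) 2 ν) :
      √(∫ ω, ((1 / 2) * (f ω + -1 * f (flipAt i ω))) ^ 2 ∂ν) ≤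
        1 / √δm * √(∫ ω, X V i f ω ^ 2 ∂ν) := by
    have hs : SmoothLocal fun ω => (1 / 2) * (f ω + -1 * f (flipAt i ω)) :=
      (hf.add ((hf.flipAt i).smul (-1))).smul (1 / 2)
    have e := X_oddPart (V := V) hf i (-1)
    have hX := integral_sq_half_le hT hXf (c := 1) (by norm_num)
    have e' : X V i (fun ω => (1 / 2) * (f ω + -1 * f (flipAt i ω))) =
        fun ω => (1 / 2) * (X V i f ω + 1 * X V i f (flipAt i ω)) := by
      rw [e]; ext ω; ring
    have h := integral_sq_le_of_odd hV hβ hs i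
      (fun ω => by rw [flipAt_flipAt]; ring) (integral_sq_half_le hT hf2 hneg).1
      (by rw [e']; exact hX.1)
    rw [e'] at h
    have h' := h.trans hX.2
    rw [one_div_mul_eq_div, ← Real.sqrt_div' _ hδ.le]
    refine Real.sqrt_le_sqrt ?_
    rw [le_div_iff₀ hδ, mul_comm]
    exact h'
  have hsE : SmoothLocal fun ω => (1 / 2) * (g ω + 1 * g (flipAt i ω)) :=
    (hg.add ((hg.flipAt i).smul 1)).smul (1 / 2)
  have hE2 := (integral_sq_half_le hT hg2 (c := 1) (by norm_num)).1
  have hO2 := (integral_sq_half_le hT hg2 hneg).1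
  have hfO2 := (integral_sq_half_le hT hf2 hneg).1
  have hXE := integral_sq_half_le hT hXg hneg
  have eE : X V i (fun ω => (1 / 2) * (g ω + 1 * g (flipAt i ω))) =
      fun ω => (1 / 2) * (X V i g ω + -1 * X V i g (flipAt i ω)) := by
    rw [X_oddPart hg i 1]; ext ω; ring
  have hsplit : ∫ ω, X V i f ω * g ω ∂ν =
      ∫ ω, X V i f ω * ((1 / 2) * (g ω + -1 * g (flipAt i ω))) ∂ν +
      ∫ ω, X V i f ω * ((1 / 2) * (g ω + 1 * g (flipAt i ω))) ∂ν := by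
    rw [← integral_add (integrable_mul_of_memLp_two hXf hO2)
      (integrable_mul_of_memLp_two hXf hE2)]
    congr 1 with ω
    ring
  have hibp := integral_X_mul hV hβ hf hsE i hf2 hXf hE2 (by rw [eE]; exact hXE.1)
  rw [eE] at hibp
  set b : Config → ℝ := fun ω => (1 / 2) * (X V i g ω + -1 * X V i g (flipAt i ω)) with hb
  have hbodd (ω : Config) : b (flipAt i ω) = -b ω := by
    simp only [hb, flipAt_flipAt]; ring
  have hbm : AEStronglyMeasurable b ν := hXE.1.aestronglyMeasurable
  have hfT2 : MemLp (fun ω => f (flipAt i ω)) 2 ν := hf2.comp_measurePreserving hT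
  -- `b`, as the image under `X` of an even function, is odd, hence orthogonal to the even part of
  -- `f`.
  have hpar : ∫ ω, f ω * b ω ∂ν =
      ∫ ω, ((1 / 2) * (f ω + -1 * f (flipAt i ω))) * b ω ∂ν := by
    have h1 : ∫ ω, f (flipAt i ω) * b ω ∂ν = -∫ ω, f ω * b ω ∂ν := by
      rw [← integral_comp_of_measurePreserving (f := fun ω => f ω * b ω) hT
        (hf2.aestronglyMeasurable.mul hbm), ← integral_neg]
      congr 1 with ω
      rw [hbodd]; ring
    have h2 : ∫ ω, ((1 / 2) * (f ω + -1 * f (flipAt i ω))) * b ω ∂ν =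
        (1 / 2) * (∫ ω, f ω * b ω ∂ν - ∫ ω, f (flipAt i ω) * b ω ∂ν) := by
      rw [← integral_sub (integrable_mul_of_memLp_two hf2 hXE.1)
        (integrable_mul_of_memLp_two hfT2 hXE.1),
        ← integral_const_mul]
      congr 1 with ω
      ring
    rw [h2, h1]; ring
  have hbnd : √(∫ ω, b ω ^ 2 ∂ν) ≤ √(∫ ω, X V i g ω ^ 2 ∂ν) := Real.sqrt_le_sqrt hXE.2
  have hA := abs_integral_mul_le hXf hO2
  have hB := abs_integral_mul_le hfO2 hXE.1
  have hA' := hA.trans (mul_le_mul_of_nonneg_left (hodd hg hg2 hXg) (Real.sqrt_nonneg _))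
  have hB' := hB.trans (mul_le_mul (hodd hf hf2 hXf) hbnd (Real.sqrt_nonneg _)
    (by positivity))
  rw [hsplit, hibp, hpar]
  refine (abs_add_le _ _).trans ?_
  rw [abs_neg]
  refine (add_le_add hA' hB').trans (le_of_eq ?_)
  ring

/-! The same statements for the vector fields `Y_{i,i+s}`, by conjugation with `slide s`. -/

theorem Y_eq_X_slide (i s : ℤ) (f : Config → ℝ) :
    X V i (fun ω => f (slide s ω)) = fun ω => Y V i (i + s) f (slide s ω) :=
  funext fun ω => X_slide i s f ω

theorem integral_Y_mul (hV : IsAdmissible V δm δp) (hβ : 0 < β) (hf : SmoothLocal f)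
    (hg : SmoothLocal g) (i s : ℤ) (hf2 : MemLp f 2 (gibbs V β))
    (hYf : MemLp (Y V i (i + s) f) 2 (gibbs V β)) (hg2 : MemLp g 2 (gibbs V β))
    (hYg : MemLp (Y V i (i + s) g) 2 (gibbs V β)) :
    ∫ ω, Y V i (i + s) f ω * g ω ∂(gibbs V β) =
      -∫ ω, f ω * Y V i (i + s) g ω ∂(gibbs V β) := by
  have hT := measurePreserving_slide hV hβ s
  have h := integral_X_mul hV hβ (hf.slide s) (hg.slide s) i (hf2.comp_measurePreserving hT)
    (by rw [Y_eq_X_slide]; exact hYf.comp_measurePreserving hT) (hg2.comp_measurePreserving hT)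
    (by rw [Y_eq_X_slide]; exact hYg.comp_measurePreserving hT)
  rw [Y_eq_X_slide, Y_eq_X_slide] at h
  rwa [integral_comp_of_measurePreserving (f := fun ω => Y V i (i + s) f ω * g ω) hT
    (hYf.aestronglyMeasurable.mul hg2.aestronglyMeasurable),
    integral_comp_of_measurePreserving (f := fun ω => f ω * Y V i (i + s) g ω) hT
    (hf2.aestronglyMeasurable.mul hYg.aestronglyMeasurable)] at h

theorem abs_integral_Y_mul_le (hV : IsAdmissible V δm δp) (hβ : 0 < β) (hf : SmoothLocal f)
    (hg : SmoothLocal g) (i s : ℤ) (hf2 : MemLp f 2 (gibbs V β))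
    (hYf : MemLp (Y V i (i + s) f) 2 (gibbs V β)) (hg2 : MemLp g 2 (gibbs V β))
    (hYg : MemLp (Y V i (i + s) g) 2 (gibbs V β)) :
    |∫ ω, Y V i (i + s) f ω * g ω ∂(gibbs V β)| ≤ 2 / √δm *
      (√(∫ ω, Y V i (i + s) f ω ^ 2 ∂(gibbs V β)) *
        √(∫ ω, Y V i (i + s) g ω ^ 2 ∂(gibbs V β))) := by
  have hT := measurePreserving_slide hV hβ s
  have h := abs_integral_X_mul_le hV hβ (hf.slide s) (hg.slide s) i
    (hf2.comp_measurePreserving hT)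
    (by rw [Y_eq_X_slide]; exact hYf.comp_measurePreserving hT) (hg2.comp_measurePreserving hT)
    (by rw [Y_eq_X_slide]; exact hYg.comp_measurePreserving hT)
  rw [Y_eq_X_slide, Y_eq_X_slide] at h
  rwa [integral_comp_of_measurePreserving (f := fun ω => Y V i (i + s) f ω * g ω) hT
    (hYf.aestronglyMeasurable.mul hg2.aestronglyMeasurable),
    integral_comp_of_measurePreserving (f := fun ω => Y V i (i + s) f ω ^ 2) hT
    hYf.integrable_sq.aestronglyMeasurable,
    integral_comp_of_measurePreserving (f := fun ω => Y V i (i + s) g ω ^ 2) hT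
    hYg.integrable_sq.aestronglyMeasurable] at h

end Gibbs

/-! ### Tame functions -/

/-- Smooth local functions that belong to all `L^q(ν_β)`, `q < ∞`, with their first `n`
derivatives. -/
def Tame (V : ℝ → ℝ) (β : ℝ) : ℕ → Set (Config → ℝ)
  | 0 => {f | SmoothLocal f ∧ ∀ q : ENNReal, q ≠ ⊤ → MemLp f q (gibbs V β)}
  | n + 1 => {f | (SmoothLocal f ∧ ∀ q : ENNReal, q ≠ ⊤ → MemLp f q (gibbs V β)) ∧
      ∀ i, dp i f ∈ Tame V β n ∧ dr i f ∈ Tame V β n}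

/-- Smooth local functions with compact support in the coordinates on which they depend. -/
def CompactLocal (f : Config → ℝ) : Prop :=
  ∃ (Λ : Finset ℤ) (φ : (Λ → ℝ × ℝ) → ℝ),
    ContDiff ℝ (⊤ : ℕ∞) φ ∧ HasCompactSupport φ ∧ ∀ ω, f ω = φ fun i => ω i

namespace Tame

variable {V : ℝ → ℝ} {δm δp β : ℝ} {f g : Config → ℝ} {n : ℕ}

theorem zero (hf : f ∈ Tame V β n) : f ∈ Tame V β 0 := by
  cases n with
  | zero => exact hf
  | succ n => exact hf.1

theorem smoothLocal (hf : f ∈ Tame V β n) : SmoothLocal f := (zero hf).1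

theorem memLp (hf : f ∈ Tame V β n) {q : ENNReal} (hq : q ≠ ⊤) : MemLp f q (gibbs V β) :=
  (zero hf).2 q hq

theorem memLp_two (hf : f ∈ Tame V β n) : MemLp f 2 (gibbs V β) := memLp hf (by simp)

theorem of_succ (hf : f ∈ Tame V β (n + 1)) : f ∈ Tame V β n := by
  induction n generalizing f with
  | zero => exact hf.1
  | succ n ih => exact ⟨hf.1, fun i => ⟨ih (hf.2 i).1, ih (hf.2 i).2⟩⟩

theorem add (hf : f ∈ Tame V β n) (hg : g ∈ Tame V β n) : f + g ∈ Tame V β n := by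
  have h0 (f g : Config → ℝ) (hf : f ∈ Tame V β 0) (hg : g ∈ Tame V β 0) : f + g ∈ Tame V β 0 :=
    ⟨hf.1.add hg.1, fun q hq => (hf.2 q hq).add (hg.2 q hq)⟩
  induction n generalizing f g with
  | zero => exact h0 f g hf hg
  | succ n ih =>
    refine ⟨h0 f g hf.1 hg.1, fun i => ?_⟩
    rw [dp_add hf.1.1 hg.1.1, dr_add hf.1.1 hg.1.1]
    exact ⟨ih (hf.2 i).1 (hg.2 i).1, ih (hf.2 i).2 (hg.2 i).2⟩

theorem smul (hf : f ∈ Tame V β n) (c : ℝ) : c • f ∈ Tame V β n := by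
  have h0 (f : Config → ℝ) (hf : f ∈ Tame V β 0) : c • f ∈ Tame V β 0 :=
    ⟨hf.1.smul c, fun q hq => (hf.2 q hq).const_smul c⟩
  induction n generalizing f with
  | zero => exact h0 f hf
  | succ n ih =>
    refine ⟨h0 f hf.1, fun i => ?_⟩
    rw [dp_smul hf.1.1, dr_smul hf.1.1]
    exact ⟨ih (hf.2 i).1, ih (hf.2 i).2⟩

theorem sub (hf : f ∈ Tame V β n) (hg : g ∈ Tame V β n) : f - g ∈ Tame V β n := by
  have := add hf (smul hg (-1))
  rwa [neg_one_smul, ← sub_eq_add_neg] at this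

/-- Closure under products is the reason for asking for every finite `q`: Hölder with exponents `2q,
2q` stays inside the class, while `L²` alone would not. -/
theorem mul (hf : f ∈ Tame V β n) (hg : g ∈ Tame V β n) : f * g ∈ Tame V β n := by
  have h0 (f g : Config → ℝ) (hf : f ∈ Tame V β 0) (hg : g ∈ Tame V β 0) :
      f * g ∈ Tame V β 0 := by
    refine ⟨hf.1.mul hg.1, fun q hq => ?_⟩
    have h2 : 2 * q ≠ ⊤ := ENNReal.mul_ne_top (by simp) hq
    have : ENNReal.HolderTriple (2 * q) (2 * q) q := ⟨by
      rw [ENNReal.mul_inv (.inl two_ne_zero) (.inl (by simp)), ← two_mul, ← mul_assoc,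
        ENNReal.mul_inv_cancel two_ne_zero (by simp), one_mul]⟩
    exact (hg.2 _ h2).mul (hf.2 _ h2)
  induction n generalizing f g with
  | zero => exact h0 f g hf hg
  | succ n ih =>
    refine ⟨h0 f g hf.1 hg.1, fun i => ?_⟩
    rw [dp_mul hf.1.1 hg.1.1, dr_mul hf.1.1 hg.1.1]
    exact ⟨add (ih (hf.2 i).1 (of_succ hg)) (ih (of_succ hf) (hg.2 i).1),
      add (ih (hf.2 i).2 (of_succ hg)) (ih (of_succ hf) (hg.2 i).2)⟩

theorem const (hV : IsAdmissible V δm δp) (hβ : 0 < β) (c : ℝ) :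
    (fun _ => c : Config → ℝ) ∈ Tame V β n := by
  have := isProbabilityMeasure_gibbs hV hβ
  have h0 (c : ℝ) : (fun _ => c : Config → ℝ) ∈ Tame V β 0 :=
    ⟨SmoothLocal.const c, fun q _ => memLp_const c⟩
  induction n generalizing c with
  | zero => exact h0 c
  | succ n ih =>
    refine ⟨h0 c, fun i => ?_⟩
    have e1 : dp i (fun _ => c : Config → ℝ) = fun _ => 0 := by ext ω; simp [dp]
    have e2 : dr i (fun _ => c : Config → ℝ) = fun _ => 0 := by ext ω; simp [dr]
    rw [e1, e2]
    exact ⟨ih 0, ih 0⟩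

theorem momentum (hV : IsAdmissible V δm δp) (hβ : 0 < β) (k : ℤ) :
    (fun ω => (ω k).1 : Config → ℝ) ∈ Tame V β n := by
  have h0 : (fun ω => (ω k).1 : Config → ℝ) ∈ Tame V β 0 :=
    ⟨smoothLocal_momentum k, fun q hq =>
      (memLp_fst_siteMeasure hV hβ hq).comp_measurePreserving (measurePreserving_eval hV hβ k)⟩
  cases n with
  | zero => exact h0
  | succ n =>
    refine ⟨h0, fun i => ?_⟩
    have e1 : dp i (fun ω => (ω k).1) = fun _ => if k = i then 1 else 0 := by
      ext ω
      rcases eq_or_ne k i with rfl | h <;> simp [dp, *]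
    have e2 : dr i (fun ω => (ω k).1) = fun _ => 0 := by
      ext ω
      rcases eq_or_ne k i with rfl | h <;> simp [dr, *]
    rw [e1, e2]
    exact ⟨const hV hβ _, const hV hβ _⟩

theorem zero_comp_position (hV : IsAdmissible V δm δp) (hβ : 0 < β) (k : ℤ) {u : ℝ → ℝ}
    (hu : ContDiff ℝ (⊤ : ℕ∞) u) {a b : ℝ} (hb : ∀ r, |u r| ≤ a + b * r ^ 2) :
    (fun ω => u (ω k).2 : Config → ℝ) ∈ Tame V β 0 := by
  have hr : (fun ω => (ω k).2 : Config → ℝ) ∈ Tame V β 0 :=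
    ⟨smoothLocal_position k, fun q hq =>
      (memLp_snd_siteMeasure hV hβ hq).comp_measurePreserving (measurePreserving_eval hV hβ k)⟩
  have h := add (const hV hβ a) (smul (mul hr hr) b)
  have hs := (smoothLocal_position k).comp hu
  refine ⟨hs, fun q hq => (h.2 q hq).mono (hs.aestronglyMeasurable _) (.of_forall fun ω => ?_)⟩
  refine (hb _).trans ((le_abs_self _).trans (le_of_eq ?_))
  simp [sq]

theorem comp_position (hV : IsAdmissible V δm δp) (hβ : 0 < β) (k : ℤ) {u : ℝ → ℝ}
    (hu : ContDiff ℝ (⊤ : ℕ∞) u) {a b : ℝ} (hb : ∀ r, |u r| ≤ a + b * r ^ 2)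
    (hd : (fun ω => deriv u (ω k).2 : Config → ℝ) ∈ Tame V β n) :
    (fun ω => u (ω k).2 : Config → ℝ) ∈ Tame V β (n + 1) := by
  refine ⟨zero_comp_position hV hβ k hu hb, fun i => ?_⟩
  have e1 : dp i (fun ω => u (ω k).2) = fun _ => 0 := by
    ext ω
    rcases eq_or_ne k i with rfl | h <;> simp [dp, *]
  rw [e1]
  refine ⟨const hV hβ 0, ?_⟩
  rcases eq_or_ne k i with rfl | h
  · have e2 : dr k (fun ω => u (ω k).2) = fun ω => deriv u (ω k).2 := by
      ext ω; simp [dr]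
    rw [e2]; exact hd
  · have e2 : dr i (fun ω => u (ω k).2) = fun _ => 0 := by
      ext ω; simp [dr, h]
    rw [e2]; exact const hV hβ 0

theorem position (hV : IsAdmissible V δm δp) (hβ : 0 < β) (k : ℤ) :
    (fun ω => (ω k).2 : Config → ℝ) ∈ Tame V β 1 := by
  refine comp_position hV hβ k (u := fun r => r) (a := 1) (b := 1) contDiff_id (fun r => ?_) ?_
  · rw [abs_le]; constructor <;> nlinarith
  · simp only [deriv_id'']
    exact const hV hβ 1

/-- Order one is all that is claimed: `V''` is bounded, but no bound on `V'''` is available. This is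
the origin of the restriction `n ≤ 1` in `Tame.Y`. -/
theorem force (hV : IsAdmissible V δm δp) (hβ : 0 < β) (k : ℤ) :
    (fun ω => deriv V (ω k).2 : Config → ℝ) ∈ Tame V β 1 := by
  refine comp_position hV hβ k hV.contDiff_deriv (a := δp) (b := δp) (fun r => ?_)
    (zero_comp_position hV hβ k hV.contDiff_deriv_two (a := δp) (b := 0) fun r => ?_)
  · have h1 := hV.abs_deriv_le r
    have h2 : |r| ≤ 1 + r ^ 2 := by rw [abs_le]; constructor <;> nlinarith
    nlinarith [hV.upper_pos]
  · rw [abs_of_nonneg (hV.pos.le.trans (hV.lower r))]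
    linarith [hV.upper r]

theorem energy (hV : IsAdmissible V δm δp) (hβ : 0 < β) (k : ℤ) :
    energy V k ∈ Tame V β 1 := by
  have h1 := smul (mul (momentum hV hβ k) (momentum hV hβ k)) (1 / 2) (n := 1)
  have h2 := comp_position hV hβ k hV.smooth hV.abs_le (of_succ (force hV hβ k))
  convert add h1 h2 using 1
  ext ω
  simp [EnergyChain.energy]; ring

theorem Y (hV : IsAdmissible V δm δp) (hβ : 0 < β) (hf : f ∈ Tame V β (n + 1)) (hn : n ≤ 1)
    (i j : ℤ) : Y V i j f ∈ Tame V β n := by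
  have hF : (fun ω => deriv V (ω j).2 : Config → ℝ) ∈ Tame V β n := by
    interval_cases n
    · exact of_succ (force hV hβ j)
    · exact force hV hβ j
  exact sub (mul (momentum hV hβ i) (hf.2 j).2) (mul hF (hf.2 i).1)

theorem mem_spaceCTilde (hV : IsAdmissible V δm δp) (hβ : 0 < β) (hf : f ∈ Tame V β 1) :
    f ∈ spaceCTilde V β :=
  ⟨smoothLocal hf, memLp_two hf, fun i =>
    ⟨memLp_two (Y hV hβ hf (Nat.zero_le 1) i i), memLp_two (Y hV hβ hf (Nat.zero_le 1) i (i + 1))⟩⟩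

end Tame

/-! ### Compactly supported local functions are tame to every order -/

namespace CompactLocal

variable {V : ℝ → ℝ} {δm δp β : ℝ} {f : Config → ℝ}

theorem zero : CompactLocal 0 := ⟨∅, 0, contDiff_const, .zero, fun _ => rfl⟩

theorem smoothLocal (hf : CompactLocal f) : SmoothLocal f := by
  obtain ⟨Λ, φ, hφ, -, h⟩ := hf
  exact ⟨Λ, φ, hφ, h⟩

theorem exists_bound (hf : CompactLocal f) : ∃ C, ∀ ω, |f ω| ≤ C := by
  obtain ⟨Λ, φ, hφ, hc, h⟩ := hf
  obtain ⟨C, hC⟩ := hφ.continuous.bounded_above_of_compact_support hc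
  exact ⟨C, fun ω => by rw [h]; exact hC _⟩

theorem fderiv_slice (hf : CompactLocal f) (i : ℤ) (v : ℝ × ℝ) :
    CompactLocal fun ω => fderiv ℝ (fun x => f (Function.update ω i x)) (ω i) v := by
  obtain ⟨Λ, φ, hφ, hc, h⟩ := hf
  by_cases hi : i ∈ Λ
  · refine ⟨Λ, fun y => fderiv ℝ φ y (Pi.single ⟨i, hi⟩ v),
      (hφ.fderiv_right (m := (⊤ : ℕ∞)) (by simp)).clm_apply contDiff_const, ?_,
      fun ω => fderiv_slice_apply hφ h hi ω v⟩
    refine (hc.fderiv (𝕜 := ℝ)).mono fun x hx => ?_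
    contrapose! hx
    simp only [Function.mem_support, ne_eq, not_not] at hx ⊢
    simp [hx]
  · have e (ω : Config) : (fun x => f (Function.update ω i x)) = fun _ => f ω := by
      ext x
      rw [h, h]
      congr 1 with k : 1
      exact Function.update_of_ne (ne_of_mem_of_not_mem k.2 hi) _ _
    simp only [e, fderiv_fun_const]
    exact zero

theorem dp (hf : CompactLocal f) (i : ℤ) : CompactLocal (dp i f) := by
  rw [show EnergyChain.dp i f = _ from funext fun ω => dp_eq_fderiv hf.smoothLocal i ω]
  exact hf.fderiv_slice i _

theorem dr (hf : CompactLocal f) (i : ℤ) : CompactLocal (dr i f) := by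
  rw [show EnergyChain.dr i f = _ from funext fun ω => dr_eq_fderiv hf.smoothLocal i ω]
  exact hf.fderiv_slice i _

theorem tame (hV : IsAdmissible V δm δp) (hβ : 0 < β) (hf : CompactLocal f) (n : ℕ) :
    f ∈ Tame V β n := by
  have := isProbabilityMeasure_gibbs hV hβ
  have h0 (f : Config → ℝ) (hf : CompactLocal f) : f ∈ Tame V β 0 := by
    obtain ⟨C, hC⟩ := hf.exists_bound
    exact ⟨hf.smoothLocal, fun q _ =>
      .of_bound (hf.smoothLocal.aestronglyMeasurable _) C (.of_forall hC)⟩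
  induction n generalizing f with
  | zero => exact h0 f hf
  | succ n ih => exact ⟨h0 f hf, fun i => ⟨ih (hf.dp i), ih (hf.dr i)⟩⟩

end CompactLocal

/-! ### Formal sums over translates and their pairings -/

/-- `Z_s Γ_g` with `Z_s = Y_{0,s}` for the formal sum `Γ_g = ∑_j τ_j g`. -/
def ZGamma (V : ℝ → ℝ) (s : ℤ) (g : Config → ℝ) : Config → ℝ := fun ω =>
  ∑ᶠ j : ℤ, Y V 0 s (shift j g) ω

theorem XGamma_eq (V : ℝ → ℝ) (g : Config → ℝ) : XGamma V g = ZGamma V 0 g := rfl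

theorem YGamma_eq (V : ℝ → ℝ) (g : Config → ℝ) : YGamma V g = ZGamma V 1 g := rfl

/-- Outside the window `M` the vector fields `X_k` and `Y_{k,k+1}` annihilate `g`. -/
def Window (V : ℝ → ℝ) (g : Config → ℝ) (M : Finset ℤ) : Prop :=
  ∀ k ∉ M, Y V k (k + 0) g = 0 ∧ Y V k (k + 1) g = 0

/-- The sum of the translates `τ_{-k} g` for `k` in the window `M`. -/
def truncGamma (M : Finset ℤ) (g : Config → ℝ) : Config → ℝ := ∑ k ∈ M, shift (-k) g

section Gamma

variable {V : ℝ → ℝ} {δm δp β : ℝ} {f g F : Config → ℝ} {M : Finset ℤ} {s : ℤ}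

/-- `Y_{k,k+1}` touches `p_k` and `r_{k+1}`, so both `k` and `k + 1` have to avoid `Λ`; hence the
extra copy of `Λ` translated by `-1`. -/
theorem DependsOnlyOn.window {Λ : Finset ℤ} (hg : DependsOnlyOn Λ g) :
    Window V g (Λ ∪ Λ.map (addRightEmbedding (-1))) := by
  intro k hk
  rw [Finset.mem_union, not_or] at hk
  have h2 : k + 1 ∉ Λ := fun h => hk.2 (Finset.mem_map.2 ⟨k + 1, h, by simp⟩)
  exact ⟨Y_eq_zero_of_dependsOnlyOn hg hk.1 (by simpa using hk.1),
    Y_eq_zero_of_dependsOnlyOn hg hk.1 h2⟩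

theorem SmoothLocal.exists_window (hg : SmoothLocal g) : ∃ M, Window V g M := by
  obtain ⟨Λ, h⟩ := hg.exists_dependsOnlyOn
  exact ⟨_, h.window⟩

theorem Window.mono {M' : Finset ℤ} (h : Window V g M) (hM : M ⊆ M') : Window V g M' :=
  fun k hk => h k fun hk' => hk (hM hk')

theorem Window.eq_zero (h : Window V g M) (hs : s = 0 ∨ s = 1) {k : ℤ} (hk : k ∉ M) :
    Y V k (k + s) g = 0 := by
  rcases hs with rfl | rfl
  exacts [(h k hk).1, (h k hk).2]

theorem Y_zero_shift_neg (k s : ℤ) (g : Config → ℝ) :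
    Y V 0 s (shift (-k) g) = shift (-k) (Y V k (k + s) g) := by
  rw [← Y_shift]
  simp

theorem ZGamma_eq_sum (h : Window V g M) (hs : s = 0 ∨ s = 1) :
    ZGamma V s g = ∑ k ∈ M, shift (-k) (Y V k (k + s) g) := by
  ext ω
  rw [ZGamma, ← finsum_comp_equiv (Equiv.neg ℤ), Finset.sum_apply]
  simp only [Equiv.neg_apply, Y_zero_shift_neg]
  refine finsum_eq_sum_of_support_subset _ fun k hk => ?_
  by_contra hkM
  exact hk (by simp only [h.eq_zero hs hkM]; rfl)

/-- The formal sum is not a function, but `Y_{0,0}` and `Y_{0,1}` annihilate all but finitely many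
translates. The truncation is thus a genuine local function with the same derivatives, to which the
sector estimate can be applied. -/
theorem Y_truncGamma (hg : SmoothLocal g) (h : Window V g M) (hs : s = 0 ∨ s = 1) :
    Y V 0 s (truncGamma M g) = ZGamma V s g := by
  rw [ZGamma_eq_sum h hs, truncGamma, Y_sum _ fun k => hg.shift _]
  simp only [Y_zero_shift_neg]

theorem integral_shift (hV : IsAdmissible V δm δp) (hβ : 0 < β) (k : ℤ)
    (hf : AEStronglyMeasurable f (gibbs V β)) :
    ∫ ω, shift k f ω ∂(gibbs V β) = ∫ ω, f ω ∂(gibbs V β) :=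
  integral_comp_of_measurePreserving (measurePreserving_shift hV hβ k) hf

theorem memLp_shift (hV : IsAdmissible V δm δp) (hβ : 0 < β) (k : ℤ) {q : ENNReal}
    (hf : MemLp f q (gibbs V β)) : MemLp (shift k f) q (gibbs V β) :=
  hf.comp_measurePreserving (measurePreserving_shift hV hβ k)

theorem memLp_truncGamma (hV : IsAdmissible V δm δp) (hβ : 0 < β) (hg : MemLp g 2 (gibbs V β)) :
    MemLp (truncGamma M g) 2 (gibbs V β) :=
  memLp_finsetSum' M fun k _ => memLp_shift hV hβ (-k) hg

theorem smoothLocal_truncGamma (hg : SmoothLocal g) : SmoothLocal (truncGamma M g) :=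
  SmoothLocal.sum M fun k _ => hg.shift (-k)

theorem memLp_ZGamma (hV : IsAdmissible V δm δp) (hβ : 0 < β) (hg : g ∈ Tame V β 1)
    (hs : s = 0 ∨ s = 1) : MemLp (ZGamma V s g) 2 (gibbs V β) := by
  obtain ⟨M, h⟩ := (Tame.smoothLocal hg).exists_window (V := V)
  rw [ZGamma_eq_sum h hs]
  exact memLp_finsetSum' M fun k _ =>
    memLp_shift hV hβ (-k) (Tame.memLp_two (Tame.Y hV hβ hg (Nat.zero_le 1) _ _))

/-- The vector field is moved from `τ_k F` onto `g`, then everything is translated by `-(i + k)`.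
Now `F` occurs as `τ_{-i} F` whatever `k` is, so that the sum over `k` assembles the translates of
`g` into `Γ_g`. -/
theorem integral_mul_shift_Y (hV : IsAdmissible V δm δp) (hβ : 0 < β) (hg : g ∈ Tame V β 1)
    (hF : SmoothLocal F) (hF2 : MemLp F 2 (gibbs V β)) (i s : ℤ)
    (hYF : MemLp (Y V i (i + s) F) 2 (gibbs V β)) (k : ℤ) :
    ∫ ω, g ω * shift k (Y V i (i + s) F) ω ∂(gibbs V β) =
      -∫ ω, shift (-(i + k)) (Y V (i + k) (i + k + s) g) ω * shift (-i) F ω ∂(gibbs V β) := by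
  have hYg := Tame.memLp_two (Tame.Y hV hβ hg (Nat.zero_le 1) (i + k) (i + k + s))
  have e : Y V (i + k) (i + k + s) (shift k F) = shift k (Y V i (i + s) F) := by
    rw [← Y_shift]; congr 1; ring
  have h := integral_Y_mul hV hβ (Tame.smoothLocal hg) (hF.shift k) (i + k) s
    (Tame.memLp_two hg) hYg (memLp_shift hV hβ k hF2)
    (by rw [e]; exact memLp_shift hV hβ k hYF)
  rw [e] at h
  have h2 := integral_shift hV hβ (-(i + k))
    (hYg.aestronglyMeasurable.mul (memLp_shift hV hβ k hF2).aestronglyMeasurable)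
  have h3 : shift (-(i + k)) (shift k F) = shift (-i) F := by
    rw [shift_shift]; congr 1; ring
  have h4 : shift (-(i + k)) (Y V (i + k) (i + k + s) g * shift k F) =
      fun ω => shift (-(i + k)) (Y V (i + k) (i + k + s) g) ω * shift (-i) F ω := by
    rw [← h3]; rfl
  rw [h4] at h2
  rw [h2]
  simp only [Pi.mul_apply]
  rw [h, neg_neg]

theorem support_pairStar_finite (hV : IsAdmissible V δm δp) (hβ : 0 < β) (hg : g ∈ Tame V β 1)
    (hF : SmoothLocal F) (hF2 : MemLp F 2 (gibbs V β)) (i : ℤ) (hs : s = 0 ∨ s = 1)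
    (hYF : MemLp (Y V i (i + s) F) 2 (gibbs V β)) :
    (Function.support fun k : ℤ =>
      ∫ ω, g ω * shift k (Y V i (i + s) F) ω ∂(gibbs V β)).Finite := by
  obtain ⟨M, h⟩ := (Tame.smoothLocal hg).exists_window (V := V)
  refine (M.map (addLeftEmbedding (-i))).finite_toSet.subset fun k hk => ?_
  by_contra hkM
  have hkM' : i + k ∉ M := fun h' => hkM (by
    simp only [Finset.coe_map, addLeftEmbedding_apply, Set.mem_image, Finset.mem_coe]
    exact ⟨i + k, h', by ring⟩)
  refine hk ?_
  simp only [integral_mul_shift_Y hV hβ hg hF hF2 i s hYF, h.eq_zero hs hkM']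
  simp [shift]

theorem pairStar_Y (hV : IsAdmissible V δm δp) (hβ : 0 < β) (hg : g ∈ Tame V β 1)
    (hF : SmoothLocal F) (hF2 : MemLp F 2 (gibbs V β)) (i : ℤ) (hs : s = 0 ∨ s = 1)
    (hYF : MemLp (Y V i (i + s) F) 2 (gibbs V β)) :
    pairStar V β g (Y V i (i + s) F) =
      -∫ ω, ZGamma V s g ω * shift (-i) F ω ∂(gibbs V β) := by
  obtain ⟨M, h⟩ := (Tame.smoothLocal hg).exists_window (V := V)
  have hYg (k : ℤ) := Tame.memLp_two (Tame.Y hV hβ hg (Nat.zero_le 1) k (k + s))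
  rw [pairStar, ← finsum_comp_equiv (Equiv.addLeft (-i))]
  simp only [Equiv.coe_addLeft, integral_mul_shift_Y hV hβ hg hF hF2 i s hYF, add_neg_cancel_left]
  rw [finsum_eq_sum_of_support_subset (s := M), Finset.sum_neg_distrib, ZGamma_eq_sum h hs,
    ← integral_finsetSum]
  · simp [Finset.sum_mul]
  · exact fun k _ => integrable_mul_of_memLp_two (memLp_shift hV hβ _ (hYg k))
      (memLp_shift hV hβ _ hF2)
  · intro k hk
    by_contra hkM
    refine hk ?_
    simp only [h.eq_zero hs hkM]
    simp [shift]

/-- The energy current `p_0 V'(r_1)`, up to the sign. -/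
def current (V : ℝ → ℝ) : Config → ℝ := fun ω => (ω 0).1 * deriv V (ω 1).2

/-- `Y_{i,j}` transports energy from site `i` to site `j` and conserves the total; for `i = j` the
two indicators cancel. -/
theorem Y_energy (hV : IsAdmissible V δm δp) (i j k : ℤ) (ω : Config) :
    Y V i j (energy V k) ω =
      ((if k = j then 1 else 0) - (if k = i then 1 else 0)) * ((ω i).1 * deriv V (ω j).2) := by
  have h1 : dp i (energy V k) ω = if k = i then (ω i).1 else 0 := by
    rcases eq_or_ne k i with rfl | h
    · simp only [dp, energy, Function.update_self, if_true]
      have := ((hasDerivAt_id (ω k).1).pow 2).div_const 2 |>.add_const (V (ω k).2)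
      refine this.deriv.trans ?_
      simp
    · simp [dp, energy, h]
  have h2 : dr j (energy V k) ω = if k = j then deriv V (ω j).2 else 0 := by
    rcases eq_or_ne k j with rfl | h
    · simp only [dr, energy, Function.update_self, if_true]
      exact ((hV.differentiable (ω k).2).hasDerivAt.const_add _).deriv
    · simp [dr, energy, h]
  rw [Y, h1, h2]
  split_ifs <;> ring

theorem memLp_current (hV : IsAdmissible V δm δp) (hβ : 0 < β) :
    MemLp (current V) 2 (gibbs V β) :=
  Tame.memLp_two (Tame.mul (Tame.momentum hV hβ 0) (Tame.of_succ (Tame.force hV hβ 1)))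

theorem pairStarStar_term (hV : IsAdmissible V δm δp) (hβ : 0 < β)
    (hF : SmoothLocal F) (hF2 : MemLp F 2 (gibbs V β)) (i s : ℤ)
    (hYF : MemLp (Y V i (i + s) F) 2 (gibbs V β)) (k : ℤ) :
    (k : ℝ) * ∫ ω, Y V i (i + s) F ω * energy V k ω ∂(gibbs V β) =
      -k * ((if k = i + s then 1 else 0) - (if k = i then 1 else 0)) *
        ∫ ω, F ω * ((ω i).1 * deriv V (ω (i + s)).2) ∂(gibbs V β) := by
  have hE := Tame.energy hV hβ k
  rw [integral_Y_mul hV hβ hF (Tame.smoothLocal hE) i s hF2 hYF (Tame.memLp_two hE)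
    (Tame.memLp_two (Tame.Y hV hβ hE (Nat.zero_le 1) _ _)), mul_neg, mul_assoc, neg_mul]
  refine congrArg (fun x => -((k : ℝ) * x)) ?_
  rw [← integral_const_mul]
  refine integral_congr_ae (.of_forall fun ω => ?_)
  simp only [Y_energy hV]
  ring

theorem support_pairStarStar_finite (hV : IsAdmissible V δm δp) (hβ : 0 < β)
    (hF : SmoothLocal F) (hF2 : MemLp F 2 (gibbs V β)) (i s : ℤ)
    (hYF : MemLp (Y V i (i + s) F) 2 (gibbs V β)) :
    (Function.support fun k : ℤ =>
      (k : ℝ) * ∫ ω, Y V i (i + s) F ω * energy V k ω ∂(gibbs V β)).Finite := by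
  refine ({i, i + s} : Finset ℤ).finite_toSet.subset fun k hk => ?_
  by_contra h
  simp only [Finset.coe_insert, Finset.coe_singleton, Set.mem_insert_iff,
    Set.mem_singleton_iff, not_or] at h
  exact hk (by simp [pairStarStar_term hV hβ hF hF2 i s hYF, h.1, h.2])

theorem pairStarStar_X (hV : IsAdmissible V δm δp) (hβ : 0 < β)
    (hF : SmoothLocal F) (hF2 : MemLp F 2 (gibbs V β)) (i : ℤ)
    (hYF : MemLp (Y V i (i + 0) F) 2 (gibbs V β)) :
    pairStarStar V β (Y V i (i + 0) F) = 0 := by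
  simp only [pairStarStar, pairStarStar_term hV hβ hF hF2 i 0 hYF]
  simp

/-- Only `ℰ_i` and `ℰ_{i+1}` contribute, with opposite signs. Their weights `i` and `i + 1` differ
by one, which leaves a single copy of the current. -/
theorem pairStarStar_Y (hV : IsAdmissible V δm δp) (hβ : 0 < β)
    (hF : SmoothLocal F) (hF2 : MemLp F 2 (gibbs V β)) (i : ℤ)
    (hYF : MemLp (Y V i (i + 1) F) 2 (gibbs V β)) :
    pairStarStar V β (Y V i (i + 1) F) =
      -∫ ω, current V ω * shift (-i) F ω ∂(gibbs V β) := by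
  have e : ∫ ω, current V ω * shift (-i) F ω ∂(gibbs V β) =
      ∫ ω, F ω * ((ω i).1 * deriv V (ω (i + 1)).2) ∂(gibbs V β) := by
    refine (integral_shift hV hβ i ((memLp_current hV hβ).aestronglyMeasurable.mul
      (memLp_shift hV hβ (-i) hF2).aestronglyMeasurable)).symm.trans ?_
    refine integral_congr_ae (.of_forall fun ω => ?_)
    simp [shift, current, add_comm]
    ring
  simp only [pairStarStar, pairStarStar_term hV hβ hF hF2 i 1 hYF]
  rw [finsum_eq_sum_of_support_subset (s := {i, i + 1}), Finset.sum_pair (by simp), e]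
  · simp; ring
  · intro k hk
    by_contra h
    simp only [Finset.coe_insert, Finset.coe_singleton, Set.mem_insert_iff,
      Set.mem_singleton_iff, not_or] at h
    exact hk (by simp [h.1, h.2])

end Gamma

/-! ### Hilbert space lemmas -/

section Hilbert

variable {H : Type*} [NormedAddCommGroup H] [InnerProductSpace ℝ H]

/-- Completing the square, the maximizer is `(2/γ) κ`. By continuity it only has to lie in the
closure of `S`, and `S` need not be a subspace. -/
theorem isLUB_quadratic {γ : ℝ} (hγ : 0 < γ) {S : Set H} {κ : H}
    (hκ : (2 / γ) • κ ∈ closure S) :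
    IsLUB {x : ℝ | ∃ w ∈ S, x = 2 * inner ℝ w κ - γ / 2 * ‖w‖ ^ 2} (2 / γ * ‖κ‖ ^ 2) := by
  constructor
  · rintro _ ⟨w, -, rfl⟩
    have h := norm_sub_sq_real w ((2 / γ) • κ)
    rw [inner_smul_right, norm_smul, mul_pow, Real.norm_of_nonneg (by positivity)] at h
    have h2 : 0 ≤ γ / 2 * ‖w - (2 / γ) • κ‖ ^ 2 := by positivity
    rw [h] at h2
    have h3 : γ / 2 * (‖w‖ ^ 2 - 2 * (2 / γ * inner ℝ w κ) + (2 / γ) ^ 2 * ‖κ‖ ^ 2) =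
        γ / 2 * ‖w‖ ^ 2 - 2 * inner ℝ w κ + 2 / γ * ‖κ‖ ^ 2 := by field_simp
    linarith
  · intro b hb
    have hcl : IsClosed {w : H | 2 * inner ℝ w κ - γ / 2 * ‖w‖ ^ 2 ≤ b} :=
      isClosed_le (by fun_prop) continuous_const
    have h : 2 * inner ℝ ((2 / γ) • κ) κ - γ / 2 * ‖(2 / γ) • κ‖ ^ 2 ≤ b :=
      closure_minimal (fun w hw => hb ⟨w, hw, rfl⟩) hcl hκ
    rw [real_inner_smul_left, norm_smul, mul_pow,
      Real.norm_of_nonneg (show 0 ≤ 2 / γ by positivity), real_inner_self_eq_norm_sq] at h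
    refine le_trans (le_of_eq ?_) h
    field_simp
    ring

variable {G : Type*} [AddCommGroup G] [Module ℝ G] {s l : G →ₗ[ℝ] H} {ξ : H} {C : ℝ}

/-- If `l` is a relatively bounded perturbation of `s` with the same diagonal, then the closure of
the range of `l` is a complement of the orthogonal complement of the range of `s`. -/
theorem isCompl_closure_range [CompleteSpace H] (hξ : ξ ≠ 0) (horth : ∀ g, inner ℝ (s g) ξ = 0)
    (hdense : (LinearMap.range s ⊔ Submodule.span ℝ {ξ}).topologicalClosure = ⊤)
    (hdiag : ∀ g, inner ℝ (s g) (l g) = ‖s g‖ ^ 2) (hC : 0 ≤ C) (hbound : ∀ g, ‖l g‖ ≤ C * ‖s g‖) :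
    IsCompl (LinearMap.range l).topologicalClosure (Submodule.span ℝ {ξ}) := by
  -- A vector in the closure of the range of `m` vanishes if its norm is bounded by a multiple of
  -- its distance to every `m g`. Both halves of the proof end in this way.
  have key {η : H} {A : ℝ} (hA : 0 ≤ A) {m : G →ₗ[ℝ] H}
      (hη : η ∈ (LinearMap.range m).topologicalClosure)
      (h : ∀ g, ‖η‖ ≤ A * ‖m g - η‖) : η = 0 := by
    by_contra h0
    have hpos : 0 < ‖η‖ := norm_pos_iff.2 h0
    obtain ⟨_, ⟨g, rfl⟩, hg⟩ := Metric.mem_closure_iff.1 hη (‖η‖ / (A + 1)) (by positivity)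
    rw [dist_comm, dist_eq_norm, lt_div_iff₀ (by positivity)] at hg
    nlinarith [h g, norm_nonneg (m g - η)]
  refine ⟨(Submodule.disjoint_span_singleton' hξ).2 fun hmem => hξ ?_, codisjoint_iff.2 ?_⟩
  · refine key (A := 1 + C) (by positivity) hmem fun g => ?_
    -- If `l g` is near `ξ`, then `‖s g‖² = ⟨s g, l g⟩ = ⟨s g, l g - ξ⟩` makes `s g` small, hence
    -- also `l g`, and so `ξ`.
    have h1 : ‖s g‖ ^ 2 ≤ ‖s g‖ * ‖l g - ξ‖ := by
      rw [← hdiag g]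
      have : inner ℝ (s g) (l g) = inner ℝ (s g) (l g - ξ) := by
        rw [inner_sub_right, horth, sub_zero]
      rw [this]
      exact real_inner_le_norm _ _
    have h2 : ‖s g‖ ≤ ‖l g - ξ‖ := by
      rcases (norm_nonneg (s g)).eq_or_lt with h | h
      · rw [← h]; exact norm_nonneg _
      · rw [sq] at h1; exact le_of_mul_le_mul_left h1 h
    calc ‖ξ‖ = ‖l g - (l g - ξ)‖ := by rw [sub_sub_cancel]
      _ ≤ ‖l g‖ + ‖l g - ξ‖ := norm_sub_le _ _
      _ ≤ C * ‖l g - ξ‖ + ‖l g - ξ‖ := by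
        have := (hbound g).trans (mul_le_mul_of_nonneg_left h2 hC); linarith
      _ = (1 + C) * ‖l g - ξ‖ := by ring
  · have hclosed {m : G →ₗ[ℝ] H} :
        IsClosed ((((LinearMap.range m).topologicalClosure ⊔ Submodule.span ℝ {ξ} :
          Submodule ℝ H)) : Set H) :=
      Submodule.isClosed_sup_finiteDimensional _ _ (Submodule.isClosed_topologicalClosure _)
    have htop : (LinearMap.range s).topologicalClosure ⊔ Submodule.span ℝ {ξ} = ⊤ := by
      rw [eq_top_iff, ← hdense]
      exact Submodule.topologicalClosure_minimal _
        (sup_le_sup_right (Submodule.le_topologicalClosure _) _) hclosed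
    have hcomplete := (hclosed (m := l)).completeSpace_coe
    -- The sum is closed, so it suffices to show that a vector `η` orthogonal to it vanishes. Such
    -- an `η` lies in the closure of the range of `s`, since it has no component along `ξ`.
    rw [← Submodule.orthogonal_eq_bot_iff, eq_bot_iff]
    intro η hη
    rw [Submodule.mem_bot]
    have hηl (g : G) : inner ℝ (l g) η = 0 :=
      (Submodule.mem_orthogonal _ _).1 hη _ (Submodule.mem_sup_left
        (Submodule.le_topologicalClosure _ (LinearMap.mem_range_self l g)))
    have hηξ : inner ℝ ξ η = 0 :=
      (Submodule.mem_orthogonal _ _).1 hη _ (Submodule.mem_sup_right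
        (Submodule.mem_span_singleton_self ξ))
    obtain ⟨σ, hσ, _, hz, hsum⟩ := Submodule.mem_sup.1 (htop ▸ Submodule.mem_top (x := η))
    obtain ⟨t, rfl⟩ := Submodule.mem_span_singleton.1 hz
    have hσξ : inner ℝ ξ σ = 0 := by
      have hcl : IsClosed {x : H | inner ℝ ξ x = 0} := isClosed_eq (by fun_prop) continuous_const
      refine closure_minimal ?_ hcl hσ
      rintro _ ⟨g, rfl⟩
      exact (real_inner_comm _ _).trans (horth g)
    have ht : t = 0 := by
      rw [← hsum, inner_add_right, hσξ, inner_smul_right, zero_add,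
        real_inner_self_eq_norm_sq] at hηξ
      exact (mul_eq_zero.1 hηξ).resolve_right (pow_ne_zero 2 (norm_ne_zero_iff.2 hξ))
    rw [ht, zero_smul, add_zero] at hsum
    subst hsum
    refine key (A := 1 + C) (by positivity) hσ fun g => ?_
    -- The dual argument: `σ` is orthogonal to the range of `l`, so `‖s g‖² = ⟨s g - σ, l g⟩`, and
    -- `s g` near `σ` forces `s g` to be small.
    have h1 : ‖s g‖ ^ 2 ≤ ‖s g - σ‖ * (C * ‖s g‖) := by
      rw [← hdiag g]
      have : inner ℝ (s g) (l g) = inner ℝ (s g - σ) (l g) := by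
        rw [inner_sub_left, real_inner_comm (l g) σ, hηl, sub_zero]
      rw [this]
      exact (real_inner_le_norm _ _).trans
        (mul_le_mul_of_nonneg_left (hbound g) (norm_nonneg _))
    have h2 : ‖s g‖ ≤ C * ‖s g - σ‖ := by
      rcases (norm_nonneg (s g)).eq_or_lt with h | h
      · rw [← h]; positivity
      · refine le_of_mul_le_mul_left ?_ h
        linarith
    calc ‖σ‖ = ‖s g - (s g - σ)‖ := by rw [sub_sub_cancel]
      _ ≤ ‖s g‖ + ‖s g - σ‖ := norm_sub_le _ _
      _ ≤ (1 + C) * ‖s g - σ‖ := by linarith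

theorem existsUnique_add_smul_mem {M : Submodule ℝ H} (hM : IsCompl M (Submodule.span ℝ {ξ}))
    (hξ : ξ ≠ 0) (x : H) : ∃! a : ℝ, x + a • ξ ∈ M := by
  have htop := codisjoint_iff.1 hM.codisjoint
  obtain ⟨m, hm, _, hz, hsum⟩ := Submodule.mem_sup.1 (htop ▸ Submodule.mem_top (x := x))
  obtain ⟨t, rfl⟩ := Submodule.mem_span_singleton.1 hz
  refine ⟨-t, ?_, fun b hb => ?_⟩
  · have : x + -t • ξ = m := by rw [← hsum, neg_smul, add_neg_cancel_right]
    show x + -t • ξ ∈ M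
    rwa [this]
  · have hmem : (b + t) • ξ ∈ M := by
      have h := M.sub_mem hb hm
      have e : x + b • ξ - m = (b + t) • ξ := by rw [← hsum, add_smul]; abel
      rwa [e] at h
    by_contra hne
    have hbt : b + t ≠ 0 := fun h => hne (by linarith)
    exact (Submodule.disjoint_span_singleton' hξ).1 hM.disjoint
      ((M.smul_mem_iff hbt).1 hmem)

/-- A space spanned by `W₀` and one more vector `e` is the closed span of `W₀` and of any vector of
its closure that is orthogonal to `W₀` but not to `e`. -/
theorem topologicalClosure_sup_span_le [CompleteSpace H] {W₀ N : Submodule ℝ H} {e x : H}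
    (hx : x ∈ (W₀ ⊔ Submodule.span ℝ {e}).topologicalClosure) (hx0 : ∀ w ∈ W₀, inner ℝ w x = 0)
    (hxe : inner ℝ e x ≠ 0) (hN : IsClosed (N : Set H)) (hW₀ : W₀ ≤ N) (hxN : x ∈ N) :
    (W₀ ⊔ Submodule.span ℝ {e}).topologicalClosure ≤ N := by
  set W := (W₀ ⊔ Submodule.span ℝ {e}).topologicalClosure with hW
  have hWcl : IsClosed (W : Set H) := Submodule.isClosed_topologicalClosure _
  have hcomplete : CompleteSpace (N ⊓ W : Submodule ℝ H) := (hN.inter hWcl).completeSpace_coe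
  have hW₀W : W₀ ≤ W := le_sup_left.trans (Submodule.le_topologicalClosure _)
  have heW : e ∈ W := Submodule.le_topologicalClosure _
    (Submodule.mem_sup_right (Submodule.mem_span_singleton_self e))
  -- Inside `W` a vector is determined by its pairings with `W₀` and with `e`.
  have hzero {y : H} (hy : y ∈ W) (h0 : ∀ w ∈ W₀, inner ℝ w y = 0) (he : inner ℝ e y = 0) :
      y = 0 := by
    have hcl : IsClosed {z : H | inner ℝ z y = 0} := isClosed_eq (by fun_prop) continuous_const
    have h : W ≤ LinearMap.ker ((innerₗ H).flip y) := by
      refine Submodule.topologicalClosure_minimal _ (sup_le (fun w hw => ?_) ?_) hcl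
      · exact h0 w hw
      · rw [Submodule.span_singleton_le_iff_mem]; exact he
    exact inner_self_eq_zero.1 (h hy)
  have hbot : (N ⊓ W)ᗮ ⊓ W = ⊥ := by
    rw [eq_bot_iff]
    rintro y ⟨hy1, hy2⟩
    have hy0 (w : H) (hw : w ∈ W₀) : inner ℝ w y = 0 :=
      (Submodule.mem_orthogonal _ _).1 hy1 w ⟨hW₀ hw, hW₀W hw⟩
    have hyx : inner ℝ x y = 0 := (Submodule.mem_orthogonal _ _).1 hy1 x ⟨hxN, hx⟩
    -- Both `y` and `x` are orthogonal to `W₀`, and this combination is also orthogonal to `e`. So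
    -- `y` and `x` are proportional, while `y ⟂ x`.
    have hz : inner ℝ e x • y - inner ℝ e y • x = 0 := by
      refine hzero (W.sub_mem (W.smul_mem _ hy2) (W.smul_mem _ hx)) (fun w hw => ?_) ?_
      · simp [inner_sub_right, inner_smul_right, hy0 w hw, hx0 w hw]
      · simp [inner_sub_right, inner_smul_right]; ring
    have hd : inner ℝ e y = 0 := by
      have h := congrArg (inner ℝ x) hz
      rw [inner_sub_right, inner_smul_right, inner_smul_right, hyx, inner_zero_right, mul_zero,
        zero_sub, neg_eq_zero] at h
      refine (mul_eq_zero.1 h).resolve_right fun h' => hxe ?_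
      rw [inner_self_eq_zero.1 h', inner_zero_right]
    exact hzero hy2 hy0 hd
  have h := Submodule.sup_orthogonal_inf_of_hasOrthogonalProjection
    (K₁ := N ⊓ W) (K₂ := W) inf_le_right
  rw [hbot, sup_bot_eq] at h
  rw [← h]
  exact inf_le_left

end Hilbert

/-! ### The completion of a semi-inner product -/

section Completion

variable {E : Type*} [AddCommGroup E] [Module ℝ E] {B : E → E → ℝ} (hB : IsSemiInner B)

theorem inner_toCompletion (x y : E) :
    inner ℝ (toCompletion hB x) (toCompletion hB y) = B x y :=
  UniformSpace.Completion.inner_coe (𝕜 := ℝ) (E := PreHilbert hB) x y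

theorem norm_sq_toCompletion (x : E) : ‖toCompletion hB x‖ ^ 2 = B x x := by
  rw [← real_inner_self_eq_norm_sq, inner_toCompletion]

theorem denseRange_toCompletion : DenseRange (toCompletion hB) :=
  UniformSpace.Completion.denseRange_coe (α := PreHilbert hB)

/-- A form pulled back from a Hilbert space is a semi-inner product. -/
theorem isSemiInner_of_inner {H : Type*} [NormedAddCommGroup H] [InnerProductSpace ℝ H]
    (κ : E →ₗ[ℝ] H) {c : ℝ} (hc : 0 ≤ c) (h : ∀ x y, B x y = c * inner ℝ (κ x) (κ y)) :
    IsSemiInner B where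
  symm x y := by rw [h, h, real_inner_comm]
  add_left x y z := by rw [h, h, h, map_add, inner_add_left, mul_add]
  smul_left a x y := by rw [h, h, map_smul, real_inner_smul_left]; ring
  nonneg x := by rw [h]; exact mul_nonneg hc real_inner_self_nonneg

end Completion

/-! ### Approximation by compactly supported functions -/

section Cutoff

variable {V : ℝ → ℝ} {δm δp β : ℝ} {f : Config → ℝ}

theorem dp_comp_smul (c : ℝ) (χ : Config → ℝ) (i : ℤ) (ω : Config) :
    dp i (fun ω => χ (c • ω)) ω = c * dp i χ (c • ω) := by
  have h (x : ℝ) : c • Function.update ω i (x, (ω i).2) =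
      Function.update (c • ω) i (c * x, ((c • ω) i).2) := by
    ext k : 1
    rcases eq_or_ne k i with rfl | hk <;> simp [*]
  simp only [dp, h]
  exact deriv_comp_mul_left c
    (fun y : ℝ => χ (Function.update (c • ω) i (y, ((c • ω) i).2))) (ω i).1

theorem dr_comp_smul (c : ℝ) (χ : Config → ℝ) (i : ℤ) (ω : Config) :
    dr i (fun ω => χ (c • ω)) ω = c * dr i χ (c • ω) := by
  have h (x : ℝ) : c • Function.update ω i ((ω i).1, x) =
      Function.update (c • ω) i (((c • ω) i).1, c * x) := by
    ext k : 1
    rcases eq_or_ne k i with rfl | hk <;> simp [*]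
  simp only [dr, h]
  exact deriv_comp_mul_left c
    (fun y : ℝ => χ (Function.update (c • ω) i (((c • ω) i).1, y))) (ω i).2

/-- Dilating the cutoff gains a factor `c` in its derivatives, which beats the unbounded
coefficients of the vector field: pointwise the bound tends to zero with `c`, and `|p_i| +
|V'(r_j)|` has moments of all orders. -/
theorem abs_Y_comp_smul_le {χ : Config → ℝ} (hχ : CompactLocal χ) (i j : ℤ) :
    ∃ K, 0 ≤ K ∧ ∀ c : ℝ, 0 ≤ c → ∀ ω : Config,
      |Y V i j (fun ω => χ (c • ω)) ω| ≤ c * (K * (|(ω i).1| + |deriv V (ω j).2|)) := by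
  obtain ⟨K₁, h₁⟩ := (hχ.dp i).exists_bound
  obtain ⟨K₂, h₂⟩ := (hχ.dr j).exists_bound
  have h₁0 := (abs_nonneg _).trans (h₁ 0)
  have h₂0 := (abs_nonneg _).trans (h₂ 0)
  refine ⟨K₁ + K₂, by positivity, fun c hc ω => ?_⟩
  rw [Y, dp_comp_smul, dr_comp_smul]
  have e₁ : |(ω i).1 * (c * dr j χ (c • ω))| ≤ c * ((K₁ + K₂) * |(ω i).1|) := by
    rw [abs_mul, abs_mul, abs_of_nonneg hc]
    have := h₂ (c • ω)
    calc |(ω i).1| * (c * |dr j χ (c • ω)|) ≤ |(ω i).1| * (c * (K₁ + K₂)) := by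
          gcongr; linarith
      _ = _ := by ring
  have e₂ : |deriv V (ω j).2 * (c * dp i χ (c • ω))| ≤ c * ((K₁ + K₂) * |deriv V (ω j).2|) := by
    rw [abs_mul, abs_mul, abs_of_nonneg hc]
    have := h₁ (c • ω)
    calc |deriv V (ω j).2| * (c * |dp i χ (c • ω)|) ≤ |deriv V (ω j).2| * (c * (K₁ + K₂)) := by
          gcongr; linarith
      _ = _ := by ring
  refine (abs_sub _ _).trans ((add_le_add e₁ e₂).trans (le_of_eq ?_))
  ring

/-- A cutoff in the coordinates of `Λ`. -/
theorem exists_cutoff (Λ : Finset ℤ) : ∃ χ : (Λ → ℝ × ℝ) → ℝ, ContDiff ℝ (⊤ : ℕ∞) χ ∧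
    HasCompactSupport χ ∧ (∀ y, 0 ≤ χ y) ∧ (∀ y, χ y ≤ 1) ∧ χ 0 = 1 := by
  let b : ContDiffBump (0 : Λ → ℝ × ℝ) := ⟨1, 2, one_pos, one_lt_two⟩
  exact ⟨b, b.contDiff, b.hasCompactSupport, fun y => b.nonneg, fun y => b.le_one,
    b.one_of_mem_closedBall (by simp [b])⟩

/-- The functions of `𝒞` approximate every centred tame function along the vector fields. -/
theorem exists_approximation (hV : IsAdmissible V δm δp) (hβ : 0 < β) (hf : f ∈ Tame V β 1)
    (hf0 : ∫ ω, f ω ∂(gibbs V β) = 0) :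
    ∃ (g : ℕ → Config → ℝ) (M : Finset ℤ), (∀ n, g n ∈ spaceC V β) ∧
      (∀ n, Window V (f - g n) M) ∧
      ∀ i j, Tendsto (fun n => ∫ ω, Y V i j (f - g n) ω ^ 2 ∂(gibbs V β)) atTop (𝓝 0) := by
  have hprob := isProbabilityMeasure_gibbs hV hβ
  set ν := gibbs V β with hν
  obtain ⟨Λ, φ, hφ, hfφ⟩ := Tame.smoothLocal hf
  obtain ⟨θ, hθ, hθc, hθ0, hθ1, hθz⟩ := exists_cutoff Λ
  let χ : Config → ℝ := fun ω => θ fun i => ω i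
  have hχ : CompactLocal χ := ⟨Λ, θ, hθ, hθc, fun _ => rfl⟩
  let c : ℕ → ℝ := fun n => 1 / ((n : ℝ) + 1)
  have hc0 (n : ℕ) : 0 < c n := Nat.one_div_pos_of_nat
  have hc1 (n : ℕ) : c n ≤ 1 := by
    rw [div_le_one (by positivity)]; linarith [(Nat.cast_nonneg n : (0 : ℝ) ≤ n)]
  have hct : Tendsto c atTop (𝓝 0) := tendsto_one_div_add_atTop_nhds_zero_nat
  let χn : ℕ → Config → ℝ := fun n ω => χ (c n • ω)
  have hθn (n : ℕ) : ContDiff ℝ (⊤ : ℕ∞) fun y => θ (c n • y) := hθ.comp (contDiff_id.const_smul _)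
  have hθnc (n : ℕ) : HasCompactSupport fun y => θ (c n • y) := hθc.comp_smul (hc0 n).ne'
  have hχn (n : ℕ) : CompactLocal (χn n) := ⟨Λ, _, hθn n, hθnc n, fun _ => rfl⟩
  have hχn0 (n : ℕ) (ω : Config) : 0 ≤ χn n ω := hθ0 _
  have hχn1 (n : ℕ) (ω : Config) : χn n ω ≤ 1 := hθ1 _
  have hχnt (ω : Config) : Tendsto (fun n => χn n ω) atTop (𝓝 1) := by
    have h1 : Tendsto (fun n => c n • ω) atTop (𝓝 0) := by
      simpa using hct.smul_const ω
    have h2 := (hχ.smoothLocal.continuous.tendsto 0).comp h1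
    have h3 : χ 0 = 1 := hθz
    rw [h3] at h2
    exact h2
  have hfs := Tame.smoothLocal hf
  have hf2 := Tame.memLp_two hf
  have hfi : Integrable f ν := hf2.integrable (by norm_num)
  have hχi (n : ℕ) : Integrable (χn n) ν :=
    (Tame.memLp_two ((hχn n).tame hV hβ 0)).integrable (by norm_num)
  have hfχi (n : ℕ) : Integrable (f * χn n) ν :=
    hf2.integrable_mul (Tame.memLp_two ((hχn n).tame hV hβ 0))
  have hm : Tendsto (fun n => ∫ ω, (f * χn n) ω ∂ν) atTop (𝓝 0) := by
    rw [← hf0]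
    refine tendsto_integral_of_dominated_convergence (fun ω => ‖f ω‖)
      (fun n => (hfχi n).aestronglyMeasurable) hfi.norm (fun n => .of_forall fun ω => ?_)
      (.of_forall fun ω => ?_)
    · rw [Pi.mul_apply, norm_mul, Real.norm_of_nonneg (hχn0 n ω)]
      exact mul_le_of_le_one_right (norm_nonneg _) (hχn1 n ω)
    · simpa using (hχnt ω).const_mul (f ω)
  have he : Tendsto (fun n => ∫ ω, χn n ω ∂ν) atTop (𝓝 1) := by
    have h1 : ∫ _, (1 : ℝ) ∂ν = 1 := by simp
    rw [← h1]
    refine tendsto_integral_of_dominated_convergence (fun _ => 1)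
      (fun n => (hχi n).aestronglyMeasurable) (integrable_const 1)
      (fun n => .of_forall fun ω => ?_) (.of_forall hχnt)
    rw [Real.norm_of_nonneg (hχn0 n ω)]
    exact hχn1 n ω
  -- Cutting off destroys the zero average. One fixed cutoff with nonzero mean repairs it, and the
  -- multiple `a n` that is required tends to zero.
  obtain ⟨N, hN⟩ := (he.eventually_ne one_ne_zero).exists
  let a : ℕ → ℝ := fun n => (∫ ω, (f * χn n) ω ∂ν) / ∫ ω, χn N ω ∂ν
  have hat : Tendsto a atTop (𝓝 0) := by
    have h := hm.div_const (∫ ω, χn N ω ∂ν)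
    rwa [zero_div] at h
  obtain ⟨A, hA⟩ := hat.abs.bddAbove_range
  have hA (n : ℕ) : |a n| ≤ A := hA ⟨n, rfl⟩
  let g : ℕ → Config → ℝ := fun n => f * χn n - a n • χn N
  have hdep {u : Config → ℝ} {η : (Λ → ℝ × ℝ) → ℝ} (hu : ∀ ω, u ω = η fun i => ω i) :
      DependsOnlyOn Λ u := fun ω ω' h => by
    rw [hu, hu]
    exact congrArg η (funext fun i => h i i.2)
  refine ⟨g, Λ ∪ Λ.map (addRightEmbedding (-1)), fun n => ⟨⟨Λ,
    fun y => φ y * θ (c n • y) - a n * θ (c N • y), ?_, ?_, fun ω => ?_⟩, ?_⟩, fun n => ?_,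
    fun i j => ?_⟩
  · exact (hφ.mul (hθn n)).sub (contDiff_const.mul (hθn N))
  · exact (hθnc n).mul_left.sub (hθnc N).mul_left
  · simp only [g, Pi.sub_apply, Pi.mul_apply, Pi.smul_apply, smul_eq_mul, hfφ]
    rfl
  · have h1 : ∫ ω, g n ω ∂ν = ∫ ω, (f * χn n) ω ∂ν - a n * ∫ ω, χn N ω ∂ν := by
      rw [← integral_const_mul]
      exact integral_sub (hfχi n) ((hχi N).const_mul (a n))
    rw [h1, div_mul_cancel₀ _ hN, sub_self]
  -- All approximants depend on the coordinates in `Λ` only, so a single window serves for every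
  -- `n`.
  · refine DependsOnlyOn.window (hdep
      (η := fun y => φ y - (φ y * θ (c n • y) - a n * θ (c N • y))) fun ω => ?_)
    simp only [g, Pi.sub_apply, Pi.mul_apply, Pi.smul_apply, smul_eq_mul, hfφ]
    rfl
  · obtain ⟨K, hK0, hK⟩ := abs_Y_comp_smul_le (V := V) hχ i j
    have hYn (n : ℕ) (ω : Config) : Y V i j (f - g n) ω =
        (1 - χn n ω) * Y V i j f ω - f ω * Y V i j (χn n) ω + a n * Y V i j (χn N) ω := by
      have h1 := (hχn n).smoothLocal
      have h2 := (hχn N).smoothLocal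
      simp only [g]
      rw [Y_sub hfs ((hfs.mul h1).sub (h2.smul _)), Y_sub (hfs.mul h1) (h2.smul _),
        Y_mul hfs h1, Y_smul h2]
      simp only [Pi.sub_apply, Pi.add_apply, Pi.mul_apply, Pi.smul_apply, smul_eq_mul]
      ring
    let w : Config → ℝ := fun ω => K * (|(ω i).1| + |deriv V (ω j).2|)
    have hYχ (n : ℕ) (ω : Config) : |f ω * Y V i j (χn n) ω| ≤ c n * (|f ω| * w ω) := by
      rw [abs_mul]
      calc _ ≤ |f ω| * (c n * w ω) :=
            mul_le_mul_of_nonneg_left (hK (c n) (hc0 n).le ω) (abs_nonneg _)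
        _ = _ := by ring
    have hw0 (ω : Config) : 0 ≤ w ω := by positivity
    -- A square integrable majorant of the three terms of `hYn`, uniform in `n`; it uses `c n ≤ 1`
    -- and the bound `A` on `|a n|`.
    let b : Config → ℝ := fun ω => |Y V i j f ω| + |f ω| * w ω + A * |Y V i j (χn N) ω|
    have hb : MemLp b 2 ν := by
      have e : (fun ω => |f ω| * w ω) =
          fun ω => K * |f ω * (ω i).1| + K * |f ω * deriv V (ω j).2| := by
        ext ω; simp only [w, abs_mul]; ring
      have h1 := Tame.memLp_two (Tame.Y hV hβ hf (Nat.zero_le 1) i j)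
      have h2 := Tame.memLp_two (Tame.mul (Tame.of_succ hf) (Tame.momentum hV hβ i))
      have h3 := Tame.memLp_two (Tame.mul (Tame.of_succ hf) (Tame.of_succ (Tame.force hV hβ j)))
      have h4 := Tame.memLp_two
        (Tame.Y hV hβ ((hχn N).tame hV hβ 1) (Nat.zero_le 1) i j)
      have h5 : MemLp (fun ω => |f ω| * w ω) 2 ν := by
        rw [e]; exact (h2.abs.const_mul K).add (h3.abs.const_mul K)
      exact (h1.abs.add h5).add (h4.abs.const_mul A)
    have hle (n : ℕ) (ω : Config) : |Y V i j (f - g n) ω| ≤ b ω := by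
      rw [hYn]
      refine (abs_add_le _ _).trans (add_le_add ((abs_sub _ _).trans (add_le_add ?_ ?_)) ?_)
      · rw [abs_mul]
        refine mul_le_of_le_one_left (abs_nonneg _) ?_
        rw [abs_le]
        constructor <;> linarith [hχn0 n ω, hχn1 n ω]
      · refine (hYχ n ω).trans (mul_le_of_le_one_left ?_ (hc1 n))
        exact mul_nonneg (abs_nonneg _) (hw0 ω)
      · rw [abs_mul]
        exact mul_le_mul_of_nonneg_right (hA n) (abs_nonneg _)
    have hpt (ω : Config) : Tendsto (fun n => Y V i j (f - g n) ω) atTop (𝓝 0) := by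
      simp only [hYn]
      have h1 : Tendsto (fun n => (1 - χn n ω) * Y V i j f ω) atTop (𝓝 0) := by
        simpa using ((hχnt ω).const_sub 1).mul_const (Y V i j f ω)
      have h2 : Tendsto (fun n => f ω * Y V i j (χn n) ω) atTop (𝓝 0) :=
        squeeze_zero_norm (fun n => hYχ n ω) (by simpa using hct.mul_const (|f ω| * w ω))
      have h3 : Tendsto (fun n => a n * Y V i j (χn N) ω) atTop (𝓝 0) := by
        simpa using hat.mul_const (Y V i j (χn N) ω)
      simpa using (h1.sub h2).add h3
    have h := tendsto_integral_of_dominated_convergence (μ := ν)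
      (F := fun n ω => Y V i j (f - g n) ω ^ 2) (f := fun _ => (0 : ℝ)) (fun ω => b ω ^ 2)
      (fun n => ?_) hb.integrable_sq (fun n => .of_forall fun ω => ?_)
      (.of_forall fun ω => by simpa using (hpt ω).pow 2)
    · simpa using h
    · have hgs : SmoothLocal (g n) :=
        (hfs.mul (hχn n).smoothLocal).sub ((hχn N).smoothLocal.smul _)
      exact (((hfs.sub hgs).Y hV i j).aestronglyMeasurable ν).pow 2
    · rw [norm_pow]
      exact pow_le_pow_left₀ (norm_nonneg _) (hle n ω) 2

end Cutoff

/-! ### Representation of the pairings in a Hilbert space -/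

/-- The class in `L²(ν_β)` of a square integrable function. -/
def l2 (V : ℝ → ℝ) (β : ℝ) (f : Config → ℝ) : Lp ℝ 2 (gibbs V β) :=
  open scoped Classical in if h : MemLp f 2 (gibbs V β) then h.toLp f else 0

/-- The Hilbert space `L²(ν_β) ⊕ L²(ν_β)`. -/
abbrev PairL2 (V : ℝ → ℝ) (β : ℝ) : Type :=
  WithLp 2 (Lp ℝ 2 (gibbs V β) × Lp ℝ 2 (gibbs V β))

section L2

variable {V : ℝ → ℝ} {β : ℝ} {f g : Config → ℝ}

theorem l2_add (hf : MemLp f 2 (gibbs V β)) (hg : MemLp g 2 (gibbs V β)) :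
    l2 V β (f + g) = l2 V β f + l2 V β g := by
  rw [l2, l2, l2, dif_pos hf, dif_pos hg, dif_pos (hf.add hg)]; rfl

theorem l2_smul (hf : MemLp f 2 (gibbs V β)) (c : ℝ) : l2 V β (c • f) = c • l2 V β f := by
  rw [l2, l2, dif_pos hf, dif_pos (hf.const_smul c)]; rfl

theorem l2_zero : l2 V β 0 = 0 := by
  rw [l2, dif_pos MemLp.zero]; rfl

theorem l2_sum {ι : Type*} (s : Finset ι) {f : ι → Config → ℝ}
    (hf : ∀ k, MemLp (f k) 2 (gibbs V β)) : l2 V β (∑ k ∈ s, f k) = ∑ k ∈ s, l2 V β (f k) := by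
  classical
  induction s using Finset.induction_on with
  | empty => simp [l2_zero]
  | insert a s ha ih =>
    rw [Finset.sum_insert ha, Finset.sum_insert ha,
      l2_add (hf a) (memLp_finsetSum' s fun k _ => hf k), ih]

theorem inner_l2 (hf : MemLp f 2 (gibbs V β)) (hg : MemLp g 2 (gibbs V β)) :
    inner ℝ (l2 V β f) (l2 V β g) = ∫ ω, f ω * g ω ∂(gibbs V β) := by
  rw [l2, l2, dif_pos hf, dif_pos hg, L2.inner_def]
  refine integral_congr_ae ?_
  filter_upwards [hf.coeFn_toLp, hg.coeFn_toLp] with x h1 h2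
  rw [h1, h2]; simp [mul_comm]

theorem norm_l2 (hf : MemLp f 2 (gibbs V β)) :
    ‖l2 V β f‖ = √(∫ ω, f ω ^ 2 ∂(gibbs V β)) := by
  rw [norm_eq_sqrt_real_inner, inner_l2 hf hf]; simp_rw [sq]

theorem norm_l2_sq (hf : MemLp f 2 (gibbs V β)) :
    ‖l2 V β f‖ ^ 2 = ∫ ω, f ω ^ 2 ∂(gibbs V β) := by
  rw [← real_inner_self_eq_norm_sq, inner_l2 hf hf]; simp_rw [sq]

/-- The pair with components `u` and `v`. -/
def pairL2 (u v : Lp ℝ 2 (gibbs V β)) : PairL2 V β := WithLp.toLp 2 (u, v)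

theorem inner_pairL2 (u v u' v' : Lp ℝ 2 (gibbs V β)) :
    inner ℝ (pairL2 u v) (pairL2 u' v') = inner ℝ u u' + inner ℝ v v' :=
  WithLp.prod_inner_apply _ _

theorem norm_sq_pairL2 (u v : Lp ℝ 2 (gibbs V β)) :
    ‖pairL2 u v‖ ^ 2 = ‖u‖ ^ 2 + ‖v‖ ^ 2 := by
  rw [← real_inner_self_eq_norm_sq, inner_pairL2, real_inner_self_eq_norm_sq,
    real_inner_self_eq_norm_sq]

theorem pairL2_add (u v u' v' : Lp ℝ 2 (gibbs V β)) :
    pairL2 (u + u') (v + v') = pairL2 u v + pairL2 u' v' := rfl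

theorem pairL2_smul (c : ℝ) (u v : Lp ℝ 2 (gibbs V β)) :
    pairL2 (c • u) (c • v) = c • pairL2 u v := rfl

theorem pairL2_sum {ι : Type*} (s : Finset ι) (u v : ι → Lp ℝ 2 (gibbs V β)) :
    pairL2 (∑ k ∈ s, u k) (∑ k ∈ s, v k) = ∑ k ∈ s, pairL2 (u k) (v k) := by
  classical
  induction s using Finset.induction_on with
  | empty => rfl
  | insert a s ha ih => simp only [Finset.sum_insert ha, pairL2_add, ih]

theorem norm_fst_le_pairL2 (u v : Lp ℝ 2 (gibbs V β)) : ‖u‖ ≤ ‖pairL2 u v‖ :=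
  (sq_le_sq₀ (norm_nonneg _) (norm_nonneg _)).1 (by rw [norm_sq_pairL2]; exact le_add_of_nonneg_right (sq_nonneg _))

theorem norm_snd_le_pairL2 (u v : Lp ℝ 2 (gibbs V β)) : ‖v‖ ≤ ‖pairL2 u v‖ :=
  (sq_le_sq₀ (norm_nonneg _) (norm_nonneg _)).1 (by rw [norm_sq_pairL2]; exact le_add_of_nonneg_left (sq_nonneg _))

end L2

/-- The vector `(X_0 Γ_g, a p_0 V'(r_1) + Y_{0,1} Γ_g)`. -/
def wvec (V : ℝ → ℝ) (β : ℝ) (g : Config → ℝ) (a : ℝ) : PairL2 V β :=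
  pairL2 (l2 V β (ZGamma V 0 g)) (l2 V β (a • current V + ZGamma V 1 g))

/-- `K` represents the linear functional defined by the pairings with `h`. -/
structure Represents (V : ℝ → ℝ) (β : ℝ) (h : Config → ℝ) (K : PairL2 V β) : Prop where
  memLp : MemLp h 2 (gibbs V β)
  finite_star : ∀ g ∈ Tame V β 1,
    (Function.support fun i : ℤ => ∫ ω, g ω * shift i h ω ∂(gibbs V β)).Finite
  finite_starStar : (Function.support fun i : ℤ =>
    (i : ℝ) * ∫ ω, h ω * energy V i ω ∂(gibbs V β)).Finite
  pairing : ∀ g ∈ Tame V β 1, ∀ a : ℝ,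
    pairStar V β g h + a * pairStarStar V β h = inner ℝ (wvec V β g a) K

section Represents

variable {V : ℝ → ℝ} {δm δp β γ : ℝ} {f g h h' F : Config → ℝ} {K K' : PairL2 V β}
  {M : Finset ℤ} {s : ℤ}

theorem Represents.zero : Represents V β 0 0 := by
  have e (i : ℤ) : shift i 0 = 0 := rfl
  exact ⟨.zero, fun g _ => by simp [e], by simp, fun g _ a => by simp [pairStar, pairStarStar, e]⟩

theorem Represents.add (hV : IsAdmissible V δm δp) (hβ : 0 < β) (H : Represents V β h K)
    (H' : Represents V β h' K') : Represents V β (h + h') (K + K') := by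
  have e1 (g) (hg : g ∈ Tame V β 1) (i : ℤ) : ∫ ω, g ω * shift i (h + h') ω ∂(gibbs V β) =
      ∫ ω, g ω * shift i h ω ∂(gibbs V β) + ∫ ω, g ω * shift i h' ω ∂(gibbs V β) := by
    rw [← integral_add (integrable_mul_of_memLp_two (Tame.memLp_two hg)
      (memLp_shift hV hβ i H.memLp)) (integrable_mul_of_memLp_two (Tame.memLp_two hg)
      (memLp_shift hV hβ i H'.memLp))]
    refine integral_congr_ae (.of_forall fun ω => ?_)
    simp [shift, mul_add]
  have e2 (i : ℤ) : (i : ℝ) * ∫ ω, (h + h') ω * energy V i ω ∂(gibbs V β) =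
      i * ∫ ω, h ω * energy V i ω ∂(gibbs V β) + i * ∫ ω, h' ω * energy V i ω ∂(gibbs V β) := by
    have hE := Tame.memLp_two (Tame.energy hV hβ i)
    rw [← mul_add, ← integral_add (integrable_mul_of_memLp_two H.memLp hE)
      (integrable_mul_of_memLp_two H'.memLp hE)]
    simp [add_mul]
  refine ⟨H.memLp.add H'.memLp, fun g hg => ?_, ?_, fun g hg a => ?_⟩
  · simp only [e1 g hg]
    exact ((H.finite_star g hg).union (H'.finite_star g hg)).subset
      (Function.support_add _ _)
  · simp only [e2]
    exact (H.finite_starStar.union H'.finite_starStar).subset (Function.support_add _ _)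
  · have h1 : pairStar V β g (h + h') = pairStar V β g h + pairStar V β g h' := by
      simp only [pairStar, e1 g hg]
      exact finsum_add_distrib (H.finite_star g hg) (H'.finite_star g hg)
    have h2 : pairStarStar V β (h + h') = pairStarStar V β h + pairStarStar V β h' := by
      simp only [pairStarStar, e2]
      exact finsum_add_distrib H.finite_starStar H'.finite_starStar
    rw [h1, h2, inner_add_right, ← H.pairing g hg, ← H'.pairing g hg]
    ring

theorem Represents.smul (c : ℝ) (H : Represents V β h K) : Represents V β (c • h) (c • K) := by
  have e1 (g : Config → ℝ) (i : ℤ) : ∫ ω, g ω * shift i (c • h) ω ∂(gibbs V β) =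
      c * ∫ ω, g ω * shift i h ω ∂(gibbs V β) := by
    rw [← integral_const_mul]
    refine integral_congr_ae (.of_forall fun ω => ?_)
    simp [shift]; ring
  have e2 (i : ℤ) : (i : ℝ) * ∫ ω, (c • h) ω * energy V i ω ∂(gibbs V β) =
      c * (i * ∫ ω, h ω * energy V i ω ∂(gibbs V β)) := by
    rw [mul_left_comm]
    refine congrArg ((i : ℝ) * ·) ?_
    rw [← integral_const_mul]
    refine integral_congr_ae (.of_forall fun ω => ?_)
    simp; ring
  refine ⟨H.memLp.const_smul c, fun g hg => ?_, ?_, fun g hg a => ?_⟩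
  · simp only [e1]
    exact (H.finite_star g hg).subset (Function.support_const_smul_subset c _)
  · simp only [e2]
    exact H.finite_starStar.subset (Function.support_const_smul_subset c _)
  · simp only [pairStar, pairStarStar, e1, e2]
    rw [← mul_finsum, ← mul_finsum, inner_smul_right,
      ← H.pairing g hg, pairStar, pairStarStar]
    ring

theorem Represents.sum (hV : IsAdmissible V δm δp) (hβ : 0 < β) {ι : Type*} (s : Finset ι)
    {h : ι → Config → ℝ} {K : ι → PairL2 V β} (H : ∀ k, Represents V β (h k) (K k)) :
    Represents V β (∑ k ∈ s, h k) (∑ k ∈ s, K k) := by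
  classical
  induction s using Finset.induction_on with
  | empty => exact .zero
  | insert a s ha ih =>
    rw [Finset.sum_insert ha, Finset.sum_insert ha]
    exact (H a).add hV hβ ih

theorem memLp_wvec_snd (hV : IsAdmissible V δm δp) (hβ : 0 < β) (hg : g ∈ Tame V β 1) (a : ℝ) :
    MemLp (a • current V + ZGamma V 1 g) 2 (gibbs V β) :=
  ((memLp_current hV hβ).const_smul a).add (memLp_ZGamma hV hβ hg (.inr rfl))

theorem represents_X (hV : IsAdmissible V δm δp) (hβ : 0 < β) (hF : F ∈ spaceCTilde V β)
    (i : ℤ) : Represents V β (Y V i (i + 0) F) (pairL2 (-l2 V β (shift (-i) F)) 0) := by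
  have hY : MemLp (Y V i (i + 0) F) 2 (gibbs V β) := by rw [add_zero]; exact (hF.2.2 i).1
  refine ⟨hY, fun g hg => support_pairStar_finite hV hβ hg hF.1 hF.2.1 i (.inl rfl) hY,
    support_pairStarStar_finite hV hβ hF.1 hF.2.1 i 0 hY, fun g hg a => ?_⟩
  rw [pairStar_Y hV hβ hg hF.1 hF.2.1 i (.inl rfl) hY, pairStarStar_X hV hβ hF.1 hF.2.1 i hY,
    wvec, inner_pairL2, inner_neg_right, inner_zero_right,
    inner_l2 (memLp_ZGamma hV hβ hg (.inl rfl)) (memLp_shift hV hβ _ hF.2.1)]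
  ring

/-- The two pairings give `-∫ Y_{0,1}Γ_g · τ_{-i}F` and `-∫ p_0 V'(r_1) · τ_{-i}F`. Weighted by `1`
and `a`, they combine into the second component of the test vector. -/
theorem represents_Y (hV : IsAdmissible V δm δp) (hβ : 0 < β) (hF : F ∈ spaceCTilde V β)
    (i : ℤ) : Represents V β (Y V i (i + 1) F) (pairL2 0 (-l2 V β (shift (-i) F))) := by
  have hY : MemLp (Y V i (i + 1) F) 2 (gibbs V β) := (hF.2.2 i).2
  refine ⟨hY, fun g hg => support_pairStar_finite hV hβ hg hF.1 hF.2.1 i (.inr rfl) hY,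
    support_pairStarStar_finite hV hβ hF.1 hF.2.1 i 1 hY, fun g hg a => ?_⟩
  have hs := memLp_shift hV hβ (-i) hF.2.1
  have hc := memLp_current hV hβ
  have hZ := memLp_ZGamma hV hβ hg (.inr rfl)
  rw [pairStar_Y hV hβ hg hF.1 hF.2.1 i (.inr rfl) hY, pairStarStar_Y hV hβ hF.1 hF.2.1 i hY,
    wvec, inner_pairL2, inner_neg_right, inner_zero_right, l2_add (hc.const_smul a) hZ,
    l2_smul hc, inner_add_left, real_inner_smul_left, inner_l2 hc hs, inner_l2 hZ hs]
  ring

theorem exists_represents (hV : IsAdmissible V δm δp) (hβ : 0 < β) (hh : h ∈ spaceC0 V β) :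
    ∃ K, Represents V β h K := by
  induction hh using Submodule.span_induction with
  | mem x hx =>
    obtain ⟨i, F, hF, rfl | rfl⟩ := hx
    · have := represents_X hV hβ hF i
      rw [add_zero] at this
      exact ⟨_, this⟩
    · exact ⟨_, represents_Y hV hβ hF i⟩
  | zero => exact ⟨0, .zero⟩
  | add x y _ _ hx hy =>
    obtain ⟨K, hK⟩ := hx
    obtain ⟨K', hK'⟩ := hy
    exact ⟨_, hK.add hV hβ hK'⟩
  | smul c x _ hx =>
    obtain ⟨K, hK⟩ := hx
    exact ⟨_, hK.smul c⟩

/-! ### The generator -/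

theorem opA_eq_sum (hM : Window V g M) :
    opA V g = ∑ k ∈ M, (Y V k (k + 0) g - Y V k (k + 1) g) := by
  ext ω
  rw [opA, Finset.sum_apply]
  simp only [add_zero]
  refine finsum_eq_sum_of_support_subset _ fun k hk => ?_
  by_contra hkM
  have h0 := (hM k hkM).1
  rw [add_zero] at h0
  exact hk (by simp [X, h0, (hM k hkM).2])

theorem opS_eq_sum (hM : Window V g M) :
    opS V γ g = (γ / 2) • ∑ k ∈ M, (Y V k (k + 0) (Y V k (k + 0) g) +
      Y V k (k + 1) (Y V k (k + 1) g)) := by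
  ext ω
  rw [opS, Pi.smul_apply, Finset.sum_apply, smul_eq_mul]
  simp only [add_zero]
  congr 1
  refine finsum_eq_sum_of_support_subset _ fun k hk => ?_
  by_contra hkM
  have h0 := (hM k hkM).1
  rw [add_zero] at h0
  exact hk (by simp [X, h0, (hM k hkM).2, Y_zero])

theorem X_mem_spaceC0 (hF : F ∈ spaceCTilde V β) (i : ℤ) : Y V i (i + 0) F ∈ spaceC0 V β :=
  Submodule.subset_span ⟨i, F, hF, .inl (by rw [add_zero]; rfl)⟩

theorem Y_mem_spaceC0 (hF : F ∈ spaceCTilde V β) (i : ℤ) : Y V i (i + 1) F ∈ spaceC0 V β :=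
  Submodule.subset_span ⟨i, F, hF, .inr rfl⟩

theorem opA_mem (hV : IsAdmissible V δm δp) (hβ : 0 < β) (hg : g ∈ Tame V β 1) :
    opA V g ∈ spaceC0 V β := by
  obtain ⟨M, hM⟩ := (Tame.smoothLocal hg).exists_window (V := V)
  have hg' := Tame.mem_spaceCTilde hV hβ hg
  rw [opA_eq_sum hM]
  exact Submodule.sum_mem _ fun k _ =>
    Submodule.sub_mem _ (X_mem_spaceC0 hg' k) (Y_mem_spaceC0 hg' k)

theorem opS_mem (hV : IsAdmissible V δm δp) (hβ : 0 < β) (hg : g ∈ Tame V β 2) (γ : ℝ) :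
    opS V γ g ∈ spaceC0 V β := by
  obtain ⟨M, hM⟩ := (Tame.smoothLocal hg).exists_window (V := V)
  have hg' (i j : ℤ) := Tame.mem_spaceCTilde hV hβ (Tame.Y hV hβ hg le_rfl i j)
  rw [opS_eq_sum hM]
  exact Submodule.smul_mem _ _ (Submodule.sum_mem _ fun k _ =>
    Submodule.add_mem _ (X_mem_spaceC0 (hg' _ _) k) (Y_mem_spaceC0 (hg' _ _) k))

theorem opL_mem (hV : IsAdmissible V δm δp) (hβ : 0 < β) (hg : g ∈ Tame V β 2) (γ : ℝ) :
    opL V γ g ∈ spaceC0 V β :=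
  Submodule.add_mem _ (opS_mem hV hβ hg γ) (opA_mem hV hβ (Tame.of_succ hg))

/-- Each `X_k g - Y_{k,k+1} g` contributes `(-τ_{-k} g, τ_{-k} g)`, and these add up to the
truncation of `Γ_g`. -/
theorem represents_opA (hV : IsAdmissible V δm δp) (hβ : 0 < β) (hg : g ∈ Tame V β 1)
    (hM : Window V g M) : Represents V β (opA V g)
      (pairL2 (-l2 V β (truncGamma M g)) (l2 V β (truncGamma M g))) := by
  have hg' := Tame.mem_spaceCTilde hV hβ hg
  rw [opA_eq_sum hM]
  have h (k : ℤ) : Represents V β (Y V k (k + 0) g - Y V k (k + 1) g)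
      (pairL2 (-l2 V β (shift (-k) g)) (l2 V β (shift (-k) g))) := by
    have := (represents_X hV hβ hg' k).add hV hβ ((represents_Y hV hβ hg' k).smul (-1))
    rw [neg_one_smul, ← sub_eq_add_neg, ← pairL2_smul, ← pairL2_add] at this
    simpa using this
  have h2 := Represents.sum hV hβ M h
  rwa [← pairL2_sum, Finset.sum_neg_distrib,
    ← l2_sum M fun k => memLp_shift hV hβ (-k) (Tame.memLp_two hg)] at h2

/-- In `X_k (X_k g)` the inner derivative plays the role of `F`, and the sum of its translates is
`X_0 Γ_g`; likewise for `Y`. So the representative is itself a multiple of a test vector. -/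
theorem represents_opS (hV : IsAdmissible V δm δp) (hβ : 0 < β) (hg : g ∈ Tame V β 2) :
    Represents V β (opS V γ g) (-(γ / 2) • wvec V β g 0) := by
  obtain ⟨M, hM⟩ := (Tame.smoothLocal hg).exists_window (V := V)
  have hY (i j : ℤ) := Tame.Y hV hβ hg le_rfl i j
  have hg' (i j : ℤ) := Tame.mem_spaceCTilde hV hβ (hY i j)
  rw [opS_eq_sum hM]
  have h (k : ℤ) := (represents_X hV hβ (hg' k (k + 0)) k).add hV hβ
    (represents_Y hV hβ (hg' k (k + 1)) k)
  have h2 := (Represents.sum hV hβ M h).smul (γ / 2)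
  simp only [← pairL2_add, add_zero, zero_add] at h2
  have hs (s : ℤ) (k : ℤ) := memLp_shift hV hβ (-k) (Tame.memLp_two (hY k (k + s)))
  have e : wvec V β g 0 = pairL2 (∑ k ∈ M, l2 V β (shift (-k) (Y V k (k + 0) g)))
      (∑ k ∈ M, l2 V β (shift (-k) (Y V k (k + 1) g))) := by
    rw [wvec, zero_smul, zero_add, ZGamma_eq_sum hM (.inl rfl), ZGamma_eq_sum hM (.inr rfl),
      l2_sum M (hs 0), l2_sum M (hs 1)]
  rw [e, neg_smul, ← smul_neg, ← neg_one_smul ℝ (pairL2 _ _), ← pairL2_smul]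
  simp only [add_zero, neg_one_smul, ← Finset.sum_neg_distrib]
  rw [pairL2_sum]
  exact h2

theorem represents_opL (hV : IsAdmissible V δm δp) (hβ : 0 < β) (hg : g ∈ Tame V β 2)
    (hM : Window V g M) : Represents V β (opL V γ g) (-(γ / 2) • wvec V β g 0 +
      pairL2 (-l2 V β (truncGamma M g)) (l2 V β (truncGamma M g))) :=
  (represents_opS hV hβ hg).add hV hβ (represents_opA hV hβ (Tame.of_succ hg) hM)

/-- The sector condition: the antisymmetric part is bounded by the symmetric part. -/
theorem abs_inner_wvec_opA_le (hV : IsAdmissible V δm δp) (hβ : 0 < β) (hf : f ∈ Tame V β 1)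
    (hg : g ∈ Tame V β 1) (hM : Window V g M) (a : ℝ) :
    |inner ℝ (wvec V β f a) (pairL2 (-l2 V β (truncGamma M g)) (l2 V β (truncGamma M g)))| ≤
      4 / √δm * (‖wvec V β f a‖ * ‖wvec V β g 0‖) := by
  obtain ⟨M', hM'⟩ := (Tame.smoothLocal hf).exists_window (V := V)
  have hZ (s : ℤ) (hs : s = 0 ∨ s = 1) := memLp_ZGamma hV hβ hg hs
  have hfZ := memLp_ZGamma hV hβ hf (.inl rfl)
  have hfW := memLp_wvec_snd hV hβ hf a
  have hΓ : MemLp (truncGamma M g) 2 (gibbs V β) := memLp_truncGamma hV hβ (Tame.memLp_two hg)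
  have hΓ' : MemLp (truncGamma M' f) 2 (gibbs V β) := memLp_truncGamma hV hβ (Tame.memLp_two hf)
  have hΓs : SmoothLocal (truncGamma M g) := smoothLocal_truncGamma (Tame.smoothLocal hg)
  have hΓs' : SmoothLocal (truncGamma M' f) := smoothLocal_truncGamma (Tame.smoothLocal hf)
  have hE := Tame.energy hV hβ 1
  have eΓ (s : ℤ) (hs : s = 0 ∨ s = 1) : Y V 0 (0 + s) (truncGamma M g) = ZGamma V s g := by
    rw [zero_add, Y_truncGamma (Tame.smoothLocal hg) hM hs]
  have eΓ' (s : ℤ) (hs : s = 0 ∨ s = 1) : Y V 0 (0 + s) (truncGamma M' f) = ZGamma V s f := by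
    rw [zero_add, Y_truncGamma (Tame.smoothLocal hf) hM' hs]
  -- The current is `Y_{0,1} ℰ_1`. The second component of the test vector is therefore an exact
  -- `Y_{0,1}` derivative for every `a`, as the sector estimate requires.
  have eE : Y V 0 (0 + 1) (a • energy V 1 + truncGamma M' f) = a • current V + ZGamma V 1 f := by
    rw [Y_add ((Tame.smoothLocal hE).smul a) hΓs', eΓ' 1 (.inr rfl), Y_smul (Tame.smoothLocal hE)]
    congr 2
    ext ω
    rw [Y_energy hV]
    simp [current]
  have h1 := abs_integral_Y_mul_le hV hβ hΓs' hΓs 0 0 hΓ' (by rw [eΓ' 0 (.inl rfl)]; exact hfZ) hΓ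
    (by rw [eΓ 0 (.inl rfl)]; exact hZ 0 (.inl rfl))
  have h2 := abs_integral_Y_mul_le hV hβ (((Tame.smoothLocal hE).smul a).add hΓs') hΓs 0 1
    (((Tame.memLp_two hE).const_smul a).add hΓ') (by rw [eE]; exact hfW) hΓ
    (by rw [eΓ 1 (.inr rfl)]; exact hZ 1 (.inr rfl))
  rw [eΓ 0 (.inl rfl), eΓ' 0 (.inl rfl), ← norm_l2 hfZ, ← norm_l2 (hZ 0 (.inl rfl)),
    ← inner_l2 hfZ hΓ] at h1
  rw [eΓ 1 (.inr rfl), eE, ← norm_l2 hfW, ← norm_l2 (hZ 1 (.inr rfl)), ← inner_l2 hfW hΓ] at h2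
  have hg0 : wvec V β g 0 = pairL2 (l2 V β (ZGamma V 0 g)) (l2 V β (ZGamma V 1 g)) := by
    rw [wvec, zero_smul, zero_add]
  -- Each component is bounded by the full pair, so the two constants `2 / √δm` add up to `4 / √δm`.
  have n1 := mul_le_mul (norm_fst_le_pairL2 (l2 V β (ZGamma V 0 f))
    (l2 V β (a • current V + ZGamma V 1 f))) (norm_fst_le_pairL2 (l2 V β (ZGamma V 0 g))
    (l2 V β (ZGamma V 1 g))) (norm_nonneg _) (norm_nonneg _)
  have n2 := mul_le_mul (norm_snd_le_pairL2 (l2 V β (ZGamma V 0 f))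
    (l2 V β (a • current V + ZGamma V 1 f))) (norm_snd_le_pairL2 (l2 V β (ZGamma V 0 g))
    (l2 V β (ZGamma V 1 g))) (norm_nonneg _) (norm_nonneg _)
  have hδ : 0 ≤ 2 / √δm := by positivity
  rw [hg0, wvec, inner_pairL2, inner_neg_right]
  refine (abs_add_le _ _).trans ?_
  rw [abs_neg]
  refine (add_le_add (h1.trans (mul_le_mul_of_nonneg_left n1 hδ))
    (h2.trans (mul_le_mul_of_nonneg_left n2 hδ))).trans (le_of_eq ?_)
  ring

/-- Antisymmetry of `Y_{0,s}`: the integral of `Y_{0,s} Γ · Γ` equals its own negative for the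
truncated sum `Γ`. -/
theorem inner_wvec_opA_self (hV : IsAdmissible V δm δp) (hβ : 0 < β)
    (hg : g ∈ Tame V β 1) (hM : Window V g M) :
    inner ℝ (wvec V β g 0) (pairL2 (-l2 V β (truncGamma M g)) (l2 V β (truncGamma M g))) = 0 := by
  have hΓ : MemLp (truncGamma M g) 2 (gibbs V β) := memLp_truncGamma hV hβ (Tame.memLp_two hg)
  have hΓs : SmoothLocal (truncGamma M g) := smoothLocal_truncGamma (Tame.smoothLocal hg)
  have key (s : ℤ) (hs : s = 0 ∨ s = 1) :
      inner ℝ (l2 V β (ZGamma V s g)) (l2 V β (truncGamma M g)) = 0 := by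
    have hZ := memLp_ZGamma hV hβ hg hs
    have e : Y V 0 (0 + s) (truncGamma M g) = ZGamma V s g := by
      rw [zero_add, Y_truncGamma (Tame.smoothLocal hg) hM hs]
    have h := integral_Y_mul hV hβ hΓs hΓs 0 s hΓ (by rw [e]; exact hZ) hΓ (by rw [e]; exact hZ)
    rw [e, ← inner_l2 hZ hΓ, ← inner_l2 hΓ hZ, real_inner_comm (l2 V β (ZGamma V s g))] at h
    linarith
  rw [wvec, zero_smul, zero_add, inner_pairL2, inner_neg_right, key 0 (.inl rfl),
    key 1 (.inr rfl)]
  ring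

/-! ### The gradient `p_1² - p_0²` -/

/-- `X_1 (p_1 r_1) = p_1² - V'(r_1) r_1` and `Y_{0,1} (p_0 r_1) = p_0² - V'(r_1) r_1` share their
position term. -/
theorem gradP_eq (V : ℝ → ℝ) : gradP =
    Y V 1 (1 + 0) (fun ω => (ω 1).1 * (ω 1).2) - Y V 0 (0 + 1) fun ω => (ω 0).1 * (ω 1).2 := by
  have hY (i j : ℤ) (ω : Config) : Y V i j (fun ω => (ω i).1 * (ω j).2) ω =
      (ω i).1 ^ 2 - deriv V (ω j).2 * (ω j).2 := by
    have h1 : dp i (fun ω => (ω i).1 * (ω j).2) ω = (ω j).2 := by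
      rcases eq_or_ne j i with rfl | h <;> simp [dp, *]
    have h2 : dr j (fun ω => (ω i).1 * (ω j).2) ω = (ω i).1 := by
      rcases eq_or_ne i j with rfl | h <;> simp [dr, *]
    rw [Y, h1, h2]; ring
  ext ω
  simp only [add_zero, zero_add, Pi.sub_apply, hY, gradP]
  ring

theorem tame_momentum_mul_position (hV : IsAdmissible V δm δp) (hβ : 0 < β) (i j : ℤ) :
    (fun ω => (ω i).1 * (ω j).2 : Config → ℝ) ∈ Tame V β 1 :=
  Tame.mul (Tame.momentum hV hβ i) (Tame.position hV hβ j)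

theorem gradP_mem (hV : IsAdmissible V δm δp) (hβ : 0 < β) : gradP ∈ spaceC0 V β := by
  rw [gradP_eq V]
  exact Submodule.sub_mem _
    (X_mem_spaceC0 (Tame.mem_spaceCTilde hV hβ (tame_momentum_mul_position hV hβ 1 1)) 1)
    (Y_mem_spaceC0 (Tame.mem_spaceCTilde hV hβ (tame_momentum_mul_position hV hβ 0 1)) 0)

end Represents

/-! ### The space of test vectors -/

section TestSpace

variable {V : ℝ → ℝ} {δm δp β γ : ℝ} {f g h : Config → ℝ} {K K' : PairL2 V β} {M : Finset ℤ}
  {s : ℤ}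

theorem exists_common_window (hf : SmoothLocal f) (hg : SmoothLocal g) :
    ∃ M, Window V f M ∧ Window V g M ∧ Window V (f + g) M := by
  obtain ⟨M, hM⟩ := hf.exists_window (V := V)
  obtain ⟨M', hM'⟩ := hg.exists_window (V := V)
  have h1 := hM.mono (M.subset_union_left (s₂ := M'))
  have h2 := hM'.mono (M.subset_union_right (s₂ := M'))
  refine ⟨M ∪ M', h1, h2, fun k hk => ?_⟩
  rw [Y_add hf hg, Y_add hf hg, (h1 k hk).1, (h1 k hk).2, (h2 k hk).1, (h2 k hk).2]
  simp

theorem Window.smul (hf : SmoothLocal f) (hM : Window V f M) (c : ℝ) : Window V (c • f) M := by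
  intro k hk
  rw [Y_smul hf, Y_smul hf, (hM k hk).1, (hM k hk).2]
  simp

theorem ZGamma_add (hf : SmoothLocal f) (hg : SmoothLocal g) (hs : s = 0 ∨ s = 1) :
    ZGamma V s (f + g) = ZGamma V s f + ZGamma V s g := by
  obtain ⟨M, h1, h2, h3⟩ := exists_common_window (V := V) hf hg
  rw [ZGamma_eq_sum h1 hs, ZGamma_eq_sum h2 hs, ZGamma_eq_sum h3 hs, ← Finset.sum_add_distrib]
  refine Finset.sum_congr rfl fun k _ => ?_
  rw [Y_add hf hg]
  rfl

theorem ZGamma_smul (hf : SmoothLocal f) (hs : s = 0 ∨ s = 1) (c : ℝ) :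
    ZGamma V s (c • f) = c • ZGamma V s f := by
  obtain ⟨M, hM⟩ := hf.exists_window (V := V)
  rw [ZGamma_eq_sum hM hs, ZGamma_eq_sum (hM.smul hf c) hs, Finset.smul_sum]
  refine Finset.sum_congr rfl fun k _ => ?_
  rw [Y_smul hf]
  rfl

theorem wvec_add (hV : IsAdmissible V δm δp) (hβ : 0 < β) (hf : f ∈ Tame V β 1)
    (hg : g ∈ Tame V β 1) (a b : ℝ) :
    wvec V β (f + g) (a + b) = wvec V β f a + wvec V β g b := by
  have hf' := Tame.smoothLocal hf
  have hg' := Tame.smoothLocal hg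
  have e : (a + b) • current V + (ZGamma V 1 f + ZGamma V 1 g) =
      (a • current V + ZGamma V 1 f) + (b • current V + ZGamma V 1 g) := by
    rw [add_smul]; abel
  rw [wvec, ZGamma_add hf' hg' (.inl rfl), ZGamma_add hf' hg' (.inr rfl), e,
    l2_add (memLp_ZGamma hV hβ hf (.inl rfl)) (memLp_ZGamma hV hβ hg (.inl rfl)),
    l2_add (memLp_wvec_snd hV hβ hf a) (memLp_wvec_snd hV hβ hg b)]
  rfl

theorem wvec_smul (hV : IsAdmissible V δm δp) (hβ : 0 < β) (hf : f ∈ Tame V β 1) (c a : ℝ) :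
    wvec V β (c • f) (c * a) = c • wvec V β f a := by
  have hf' := Tame.smoothLocal hf
  rw [wvec, ZGamma_smul hf' (.inl rfl), ZGamma_smul hf' (.inr rfl), mul_smul, ← smul_add,
    l2_smul (memLp_ZGamma hV hβ hf (.inl rfl)), l2_smul (memLp_wvec_snd hV hβ hf a)]
  rfl

/-- By shift invariance the translates cost nothing, so finitely many `L²` norms of derivatives of
`f` control the test vector. For a window independent of `n` this converts the output of
`exists_approximation` into convergence of test vectors. -/
theorem norm_wvec_zero_le (hV : IsAdmissible V δm δp) (hβ : 0 < β) (hf : f ∈ Tame V β 1)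
    (hM : Window V f M) : ‖wvec V β f 0‖ ≤
      ∑ k ∈ M, √(∫ ω, Y V k (k + 0) f ω ^ 2 ∂(gibbs V β)) +
      ∑ k ∈ M, √(∫ ω, Y V k (k + 1) f ω ^ 2 ∂(gibbs V β)) := by
  have hY (s k : ℤ) := Tame.memLp_two (Tame.Y hV hβ hf (Nat.zero_le 1) k (k + s))
  have key (s : ℤ) (hs : s = 0 ∨ s = 1) : ‖l2 V β (ZGamma V s f)‖ ≤
      ∑ k ∈ M, √(∫ ω, Y V k (k + s) f ω ^ 2 ∂(gibbs V β)) := by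
    rw [ZGamma_eq_sum hM hs, l2_sum M fun k => memLp_shift hV hβ (-k) (hY s k)]
    refine (norm_sum_le _ _).trans (Finset.sum_le_sum fun k _ => ?_)
    rw [norm_l2 (memLp_shift hV hβ (-k) (hY s k))]
    exact (congrArg Real.sqrt (integral_shift hV hβ (-k)
      ((hY s k).aestronglyMeasurable.pow 2))).le
  rw [wvec, zero_smul, zero_add]
  refine le_trans ?_ (add_le_add (key 0 (.inl rfl)) (key 1 (.inr rfl)))
  refine abs_le_of_sq_le_sq' ?_ (by positivity) |>.2
  rw [norm_sq_pairL2]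
  nlinarith [norm_nonneg (l2 V β (ZGamma V 0 f)), norm_nonneg (l2 V β (ZGamma V 1 f))]

/-- The centred functions in `Tame V β 2`. -/
def centred (hV : IsAdmissible V δm δp) (hβ : 0 < β) : Submodule ℝ (Config → ℝ) where
  carrier := {f | f ∈ Tame V β 2 ∧ ∫ ω, f ω ∂(gibbs V β) = 0}
  add_mem' {f g} hf hg := by
    have := isProbabilityMeasure_gibbs hV hβ
    refine ⟨Tame.add hf.1 hg.1, ?_⟩
    have h := integral_add ((Tame.memLp_two hf.1).integrable one_le_two)
      ((Tame.memLp_two hg.1).integrable one_le_two)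
    rw [hf.2, hg.2, add_zero] at h
    exact h
  zero_mem' := ⟨Tame.const hV hβ 0, by simp⟩
  smul_mem' c f hf := ⟨Tame.smul hf.1 c, by
    have h := integral_const_mul (μ := gibbs V β) c f
    rw [hf.2, mul_zero] at h
    exact h⟩

theorem spaceC_subset_centred (hV : IsAdmissible V δm δp) (hβ : 0 < β) (hg : g ∈ spaceC V β) :
    g ∈ centred hV hβ :=
  ⟨CompactLocal.tame hV hβ hg.1 2, hg.2⟩

theorem tame_of_mem_centred {hV : IsAdmissible V δm δp} {hβ : 0 < β} (hf : f ∈ centred hV hβ) :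
    f ∈ Tame V β 1 :=
  Tame.of_succ hf.1

/-- The linear map `(g, a) ↦ (X_0 Γ_g, a p_0 V'(r_1) + Y_{0,1} Γ_g)`. -/
def wmap (hV : IsAdmissible V δm δp) (hβ : 0 < β) : centred hV hβ × ℝ →ₗ[ℝ] PairL2 V β where
  toFun x := wvec V β x.1 x.2
  map_add' x y := wvec_add hV hβ (tame_of_mem_centred x.1.2) (tame_of_mem_centred y.1.2) _ _
  map_smul' c x := wvec_smul hV hβ (tame_of_mem_centred x.1.2) c _

/-- The closed space of test vectors. -/
def testSpace (hV : IsAdmissible V δm δp) (hβ : 0 < β) : Submodule ℝ (PairL2 V β) :=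
  (LinearMap.range (wmap hV hβ)).topologicalClosure

instance (hV : IsAdmissible V δm δp) (hβ : 0 < β) : CompleteSpace (testSpace hV hβ) :=
  (Submodule.isClosed_topologicalClosure _).completeSpace_coe

theorem wvec_mem_testSpace (hV : IsAdmissible V δm δp) (hβ : 0 < β) (hf : f ∈ centred hV hβ)
    (a : ℝ) : wvec V β f a ∈ testSpace hV hβ :=
  Submodule.le_topologicalClosure _ ⟨(⟨f, hf⟩, a), rfl⟩

theorem exists_seq_spaceC (hV : IsAdmissible V δm δp) (hβ : 0 < β) (hf : f ∈ centred hV hβ) :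
    ∃ g : ℕ → Config → ℝ, (∀ n, g n ∈ spaceC V β) ∧
      Tendsto (fun n => wvec V β (f - g n) 0) atTop (𝓝 0) := by
  obtain ⟨g, M, hg, hM, hlim⟩ := exists_approximation hV hβ (tame_of_mem_centred hf) hf.2
  refine ⟨g, hg, squeeze_zero_norm (fun n => norm_wvec_zero_le hV hβ (Tame.sub
    (tame_of_mem_centred hf) (tame_of_mem_centred (spaceC_subset_centred hV hβ (hg n))))
    (hM n)) ?_⟩
  have h (s : ℤ) : Tendsto (fun n => ∑ k ∈ M, √(∫ ω, Y V k (k + s) (f - g n) ω ^ 2 ∂(gibbs V β)))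
      atTop (𝓝 0) := by
    rw [← Finset.sum_const_zero (s := M) (ι := ℤ) (M := ℝ)]
    refine tendsto_finsetSum M fun k _ => ?_
    rw [← Real.sqrt_zero]
    exact (hlim k (k + s)).sqrt
  rw [← add_zero (0 : ℝ)]
  exact (h 0).add (h 1)

/-- The supremum runs over `𝒞`, whose test vectors are not known to form a subspace. They are
nevertheless dense in the linear test space built from `centred`. -/
theorem testSpace_subset_closure (hV : IsAdmissible V δm δp) (hβ : 0 < β) :
    (testSpace hV hβ : Set (PairL2 V β)) ⊆
      closure {w | ∃ g ∈ spaceC V β, ∃ a : ℝ, w = wvec V β g a} := by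
  refine closure_minimal ?_ isClosed_closure
  rintro _ ⟨⟨f, a⟩, rfl⟩
  obtain ⟨g, hg, hlim⟩ := exists_seq_spaceC hV hβ f.2
  refine mem_closure_of_tendsto (x := wvec V β f a) (b := atTop) ?_
    (.of_forall fun n => ⟨g n, hg n, a, rfl⟩)
  have e (n : ℕ) : wvec V β (g n) a = wvec V β f a - wvec V β (f - g n) 0 := by
    have hgn := tame_of_mem_centred (spaceC_subset_centred hV hβ (hg n))
    have h := wvec_add hV hβ hgn (Tame.sub (tame_of_mem_centred f.2) hgn) a 0
    rw [add_sub_cancel, add_zero] at h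
    rw [h, add_sub_cancel_right]
  simp only [e]
  simpa using tendsto_const_nhds.sub hlim

/-! ### The Riesz representative -/

/-- Two representatives agree on all test vectors, so their difference is orthogonal to the test
space. This makes `riesz` linear in spite of the choice of a representative. -/
theorem starProjection_eq_of_represents {hV : IsAdmissible V δm δp} {hβ : 0 < β}
    (hK : Represents V β h K) (hK' : Represents V β h K') :
    (testSpace hV hβ).starProjection K = (testSpace hV hβ).starProjection K' := by
  rw [← sub_eq_zero, ← map_sub, Submodule.starProjection_apply_eq_zero_iff, testSpace,
    Submodule.orthogonal_closure, Submodule.mem_orthogonal]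
  rintro _ ⟨x, rfl⟩
  have hx := tame_of_mem_centred x.1.2
  have h1 := hK.pairing _ hx x.2
  rw [hK'.pairing _ hx x.2] at h1
  rw [inner_sub_right, sub_eq_zero]
  exact h1.symm

/-- The element of the space of test vectors that represents the pairings with `h`. -/
def riesz (hV : IsAdmissible V δm δp) (hβ : 0 < β) : spaceC0 V β →ₗ[ℝ] PairL2 V β where
  toFun h := (testSpace hV hβ).starProjection (exists_represents hV hβ h.2).choose
  map_add' h h' := by
    rw [← map_add]
    exact starProjection_eq_of_represents (exists_represents hV hβ (h + h').2).choose_spec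
      ((exists_represents hV hβ h.2).choose_spec.add hV hβ
        (exists_represents hV hβ h'.2).choose_spec)
  map_smul' c h := by
    rw [← map_smul]
    exact starProjection_eq_of_represents (exists_represents hV hβ (c • h).2).choose_spec
      ((exists_represents hV hβ h.2).choose_spec.smul c)

variable (hV : IsAdmissible V δm δp) (hβ : 0 < β)

theorem riesz_eq {h : spaceC0 V β} (hK : Represents V β h K) :
    riesz hV hβ h = (testSpace hV hβ).starProjection K :=
  starProjection_eq_of_represents (exists_represents hV hβ h.2).choose_spec hK

theorem riesz_mem (h : spaceC0 V β) : riesz hV hβ h ∈ testSpace hV hβ :=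
  Submodule.starProjection_apply_mem _ _

theorem inner_starProjection {w : PairL2 V β} (hw : w ∈ testSpace hV hβ) (K : PairL2 V β) :
    inner ℝ w ((testSpace hV hβ).starProjection K) = inner ℝ w K := by
  have h := Submodule.starProjection_inner_eq_zero (K := testSpace hV hβ) K w hw
  rw [inner_sub_left, sub_eq_zero] at h
  rw [real_inner_comm, ← h, real_inner_comm]

theorem inner_wvec_riesz (hg : g ∈ centred hV hβ) (a : ℝ) (h : spaceC0 V β) :
    inner ℝ (wvec V β g a) (riesz hV hβ h) =
      pairStar V β g h + a * pairStarStar V β h := by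
  obtain ⟨K, hK⟩ := exists_represents hV hβ h.2
  rw [riesz_eq hV hβ hK, inner_starProjection hV hβ (wvec_mem_testSpace hV hβ hg a),
    hK.pairing g (tame_of_mem_centred hg)]

theorem variationalSet_eq (h : spaceC0 V β) : variationalSet V β γ h =
    {x : ℝ | ∃ w ∈ {w | ∃ g ∈ spaceC V β, ∃ a : ℝ, w = wvec V β g a},
      x = 2 * inner ℝ w (riesz hV hβ h) - γ / 2 * ‖w‖ ^ 2} := by
  have e (g : Config → ℝ) (hg : g ∈ spaceC V β) (a : ℝ) :
      2 * inner ℝ (wvec V β g a) (riesz hV hβ h) - γ / 2 * ‖wvec V β g a‖ ^ 2 =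
      2 * pairStar V β g h + 2 * a * pairStarStar V β h
      - γ / 2 * ∫ ω, (a * ((ω 0).1 * deriv V (ω 1).2) + YGamma V g ω) ^ 2 ∂(gibbs V β)
      - γ / 2 * ∫ ω, (XGamma V g ω) ^ 2 ∂(gibbs V β) := by
    have hg' := spaceC_subset_centred hV hβ hg
    have ht := tame_of_mem_centred hg'
    rw [inner_wvec_riesz hV hβ hg' a h, wvec, norm_sq_pairL2,
      norm_l2_sq (memLp_ZGamma hV hβ ht (.inl rfl)), norm_l2_sq (memLp_wvec_snd hV hβ ht a),
      ← XGamma_eq, ← YGamma_eq]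
    simp only [Pi.add_apply, Pi.smul_apply, smul_eq_mul, current]
    ring
  ext x
  constructor
  · rintro ⟨g, hg, a, rfl⟩
    exact ⟨_, ⟨g, hg, a, rfl⟩, (e g hg a).symm⟩
  · rintro ⟨_, ⟨g, hg, a, rfl⟩, rfl⟩
    exact ⟨g, hg, a, e g hg a⟩

theorem isLUB_variationalSet (hγ : 0 < γ) (h : spaceC0 V β) :
    IsLUB (variationalSet V β γ h) (2 / γ * ‖riesz hV hβ h‖ ^ 2) := by
  rw [variationalSet_eq hV hβ]
  exact isLUB_quadratic hγ (testSpace_subset_closure hV hβ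
    (Submodule.smul_mem _ _ (riesz_mem hV hβ h)))

theorem normSq_eq (hγ : 0 < γ) (h : spaceC0 V β) :
    normSq V β γ h = 2 / γ * ‖riesz hV hβ h‖ ^ 2 :=
  -- The pair `g = 0`, `a = 0` shows that the set is nonempty.
  (isLUB_variationalSet hV hβ hγ h).csSup_eq ⟨_, 0, ⟨CompactLocal.zero, by simp⟩, 0, rfl⟩

theorem form_eq (hγ : 0 < γ) (g h : spaceC0 V β) :
    form V β γ g h = 2 / γ * inner ℝ (riesz hV hβ g) (riesz hV hβ h) := by
  rw [form, normSq_eq hV hβ hγ, normSq_eq hV hβ hγ, map_add, map_sub, norm_add_sq_real,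
    norm_sub_sq_real]
  ring

end TestSpace

theorem isSemiInner_form {V : ℝ → ℝ} {δm δp β γ : ℝ} (hV : IsAdmissible V δm δp) (hβ : 0 < β)
    (hγ : 0 < γ) : IsSemiInner (form V β γ) :=
  isSemiInner_of_inner (riesz hV hβ) (by positivity) (form_eq hV hβ hγ)

/-! ### The pairings of `p_1² - p_0²` -/

section GradP

variable {V : ℝ → ℝ} {δm δp β γ : ℝ} {f g : Config → ℝ} {M : Finset ℤ}

theorem integral_mul_momentum_sq (hV : IsAdmissible V δm δp) (hβ : 0 < β)
    {Λ : Finset ℤ} (hf : AEStronglyMeasurable f (gibbs V β)) (hΛ : DependsOnlyOn Λ f) {i : ℤ}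
    (hi : i ∉ Λ) (hf0 : ∫ ω, f ω ∂(gibbs V β) = 0) :
    ∫ ω, f ω * (ω i).1 ^ 2 ∂(gibbs V β) = 0 := by
  have := isProbabilityMeasure_gibbs hV hβ
  have := isProbabilityMeasure_siteMeasure hV hβ
  have hm : Measurable fun ω : Config => (ω i).1 ^ 2 := by fun_prop
  refine (integral_comp_of_measurePreserving (measurePreserving_update hV hβ i)
    (hf.mul hm.aestronglyMeasurable)).symm.trans ?_
  have e (z : Config × (ℝ × ℝ)) : (f * fun ω : Config => (ω i).1 ^ 2)
      (Function.update z.1 i z.2) = f z.1 * z.2.1 ^ 2 := by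
    have h : f (Function.update z.1 i z.2) = f z.1 :=
      hΛ _ _ fun k hk => Function.update_of_ne (ne_of_mem_of_not_mem hk hi) _ _
    rw [Pi.mul_apply, Function.update_self, h]
  refine (integral_congr_ae (.of_forall e)).trans ?_
  rw [integral_prod_mul f fun x : ℝ × ℝ => x.1 ^ 2, hf0, zero_mul]

/-- With `a i = ∫ f p_i²` the pairing is the telescoping sum of `a (i + 1) - a i`. It vanishes
because `a` has finite support: for `i` outside the coordinates of `f`, independence and the zero
average of `f` give `a i = 0`. -/
theorem pairStar_gradP (hV : IsAdmissible V δm δp) (hβ : 0 < β) (hf : f ∈ centred hV hβ) :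
    pairStar V β f gradP = 0 := by
  obtain ⟨Λ, hΛ⟩ := (Tame.smoothLocal hf.1).exists_dependsOnlyOn
  have hf2 := Tame.memLp_two hf.1
  have hp (i : ℤ) : MemLp (fun ω : Config => (ω i).1 ^ 2) 2 (gibbs V β) := by
    have := Tame.memLp_two (Tame.mul (Tame.momentum hV hβ i (n := 0)) (Tame.momentum hV hβ i))
    refine this.ae_eq (.of_forall fun ω => ?_)
    simp [sq]
  let a : ℤ → ℝ := fun i => ∫ ω, f ω * (ω i).1 ^ 2 ∂(gibbs V β)
  have ha : a.support.Finite := by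
    refine Λ.finite_toSet.subset fun i hi => ?_
    by_contra h
    exact hi (integral_mul_momentum_sq hV hβ hf2.aestronglyMeasurable hΛ h hf.2)
  have e (i : ℤ) : ∫ ω, f ω * shift i gradP ω ∂(gibbs V β) = a (i + 1) - a i := by
    simp only [a]
    rw [← integral_sub (integrable_mul_of_memLp_two hf2 (hp _))
      (integrable_mul_of_memLp_two hf2 (hp _))]
    refine integral_congr_ae (.of_forall fun ω => ?_)
    simp only [shift, gradP, zero_add, add_comm (1 : ℤ)]
    ring
  have ha' : (Function.support fun i : ℤ => a (i + 1)).Finite :=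
    ha.preimage (add_left_injective (1 : ℤ)).injOn
  rw [pairStar]
  simp only [e]
  rw [finsum_sub_distrib ha' ha, sub_eq_zero]
  exact finsum_comp_equiv (Equiv.addRight (1 : ℤ))

theorem mul_deriv_pos (hV : IsAdmissible V δm δp) {r : ℝ} (hr : r ≠ 0) : 0 < deriv V r * r := by
  have hmono : StrictMono (deriv V) :=
    strictMono_of_deriv_pos fun x => hV.pos.trans_le (hV.lower x)
  rcases hr.lt_or_gt with h | h
  · have := hmono h
    rw [hV.deriv_zero] at this
    exact mul_pos_of_neg_of_neg this h
  · have := hmono h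
    rw [hV.deriv_zero] at this
    exact mul_pos this h

theorem ae_momentum_position_ne_zero (hV : IsAdmissible V δm δp) (hβ : 0 < β) (i j : ℤ) :
    ∀ᵐ ω ∂(gibbs V β), (ω i).1 ≠ 0 ∧ (ω j).2 ≠ 0 := by
  have hac : siteMeasure V β ≪ volume := withDensity_absolutelyContinuous _ _
  have h0 : ∀ᵐ x : ℝ, x ≠ 0 := by simp [ae_iff]
  have h1 : ∀ᵐ x ∂(siteMeasure V β), x.1 ≠ 0 :=
    hac.ae_le ((Measure.quasiMeasurePreserving_fst (μ := volume) (ν := volume)).ae h0)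
  have h2 : ∀ᵐ x ∂(siteMeasure V β), x.2 ≠ 0 :=
    hac.ae_le ((Measure.quasiMeasurePreserving_snd (μ := volume) (ν := volume)).ae h0)
  exact ((measurePreserving_eval hV hβ i).quasiMeasurePreserving.ae h1).and
    ((measurePreserving_eval hV hβ j).quasiMeasurePreserving.ae h2)

/-- The value is the integral of `p_0² V'(r_1) r_1`, which is almost surely positive since `V'` is
increasing and vanishes at `0`. -/
theorem pairStarStar_gradP_ne_zero (hV : IsAdmissible V δm δp) (hβ : 0 < β) :
    pairStarStar V β gradP ≠ 0 := by
  have := isProbabilityMeasure_gibbs hV hβ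
  have ht (i j : ℤ) := tame_momentum_mul_position hV hβ i j
  have hc := memLp_current hV hβ
  have hF := Tame.memLp_two (ht 0 1)
  have e : pairStarStar V β gradP =
      ∫ ω, current V ω * ((ω 0).1 * (ω 1).2) ∂(gibbs V β) := by
    have H := (represents_X hV hβ (Tame.mem_spaceCTilde hV hβ (ht 1 1)) 1).add hV hβ
      ((represents_Y hV hβ (Tame.mem_spaceCTilde hV hβ (ht 0 1)) 0).smul (-1))
    rw [neg_one_smul, ← sub_eq_add_neg, ← gradP_eq] at H
    have h0 : (0 : Config → ℝ) ∈ Tame V β 1 := Tame.const hV hβ 0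
    have hZ (s : ℤ) (hs : s = 0 ∨ s = 1) : ZGamma V s 0 = 0 := by
      rw [ZGamma_eq_sum (M := ∅) (fun k _ => by simp [Y_zero]) hs, Finset.sum_empty]
    -- At `g = 0`, subtracting the case `a = 0` from the case `a = 1` isolates `≪·≫_**`.
    have h1 := H.pairing 0 h0 1
    have h2 := H.pairing 0 h0 0
    have es : shift (-0) (fun ω : Config => (ω 0).1 * (ω 1).2) =
        fun ω => (ω 0).1 * (ω 1).2 := by ext ω; simp [shift]
    rw [wvec, hZ 0 (.inl rfl), hZ 1 (.inr rfl), l2_zero, inner_add_right, inner_smul_right,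
      inner_pairL2, inner_pairL2, es] at h1 h2
    simp only [zero_smul, one_smul, add_zero, l2_zero, inner_zero_left, inner_zero_right,
      inner_neg_right, inner_l2 hc hF, zero_mul, one_mul] at h1 h2
    rw [h2] at h1
    linarith
  rw [e]
  intro h
  have hnn : 0 ≤ fun ω : Config => current V ω * ((ω 0).1 * (ω 1).2) := fun ω => by
    have : 0 ≤ deriv V (ω 1).2 * (ω 1).2 := by
      rcases eq_or_ne (ω 1).2 0 with h | h
      · simp [h]
      · exact (mul_deriv_pos hV h).le
    have h2 := mul_nonneg (sq_nonneg (ω 0).1) this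
    simp only [current, Pi.zero_apply]
    linarith
  rw [integral_eq_zero_iff_of_nonneg hnn (integrable_mul_of_memLp_two hc hF)] at h
  obtain ⟨ω, h1, h2, h3⟩ := (h.and (ae_momentum_position_ne_zero hV hβ 0 1)).exists
  have h4 := mul_pos (pow_pos (abs_pos.2 h2) 2) (mul_deriv_pos hV h3)
  rw [sq_abs] at h4
  simp only [current, Pi.zero_apply] at h1
  linarith

end GradP

/-! ### The generator on centred functions -/

section Generator

variable {V : ℝ → ℝ} {δm δp β γ : ℝ} {f g : Config → ℝ} {M : Finset ℤ}

theorem opA_add (hf : SmoothLocal f) (hg : SmoothLocal g) :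
    opA V (f + g) = opA V f + opA V g := by
  obtain ⟨M, h1, h2, h3⟩ := exists_common_window (V := V) hf hg
  rw [opA_eq_sum h1, opA_eq_sum h2, opA_eq_sum h3, ← Finset.sum_add_distrib]
  refine Finset.sum_congr rfl fun k _ => ?_
  rw [Y_add hf hg, Y_add hf hg]
  abel

theorem opA_smul (hf : SmoothLocal f) (c : ℝ) : opA V (c • f) = c • opA V f := by
  obtain ⟨M, hM⟩ := hf.exists_window (V := V)
  rw [opA_eq_sum hM, opA_eq_sum (hM.smul hf c), Finset.smul_sum]
  refine Finset.sum_congr rfl fun k _ => ?_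
  rw [Y_smul hf, Y_smul hf, smul_sub]

theorem opS_add (hV : IsAdmissible V δm δp) (hf : SmoothLocal f) (hg : SmoothLocal g) :
    opS V γ (f + g) = opS V γ f + opS V γ g := by
  obtain ⟨M, h1, h2, h3⟩ := exists_common_window (V := V) hf hg
  rw [opS_eq_sum h1, opS_eq_sum h2, opS_eq_sum h3, ← smul_add, ← Finset.sum_add_distrib]
  congr 1
  refine Finset.sum_congr rfl fun k _ => ?_
  rw [Y_add hf hg, Y_add hf hg, Y_add (hf.Y hV _ _) (hg.Y hV _ _),
    Y_add (hf.Y hV _ _) (hg.Y hV _ _)]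
  abel

theorem opS_smul (hV : IsAdmissible V δm δp) (hf : SmoothLocal f) (c : ℝ) :
    opS V γ (c • f) = c • opS V γ f := by
  obtain ⟨M, hM⟩ := hf.exists_window (V := V)
  rw [opS_eq_sum hM, opS_eq_sum (hM.smul hf c), smul_comm c, Finset.smul_sum (r := c)]
  congr 1
  refine Finset.sum_congr rfl fun k _ => ?_
  rw [Y_smul hf, Y_smul hf, Y_smul (hf.Y hV _ _), Y_smul (hf.Y hV _ _), smul_add]

/-- The symmetric part of the generator as a linear map into `𝒞₀`. -/
def symmPart (hV : IsAdmissible V δm δp) (hβ : 0 < β) (γ : ℝ) :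
    centred hV hβ →ₗ[ℝ] spaceC0 V β where
  toFun f := ⟨opS V γ f, opS_mem hV hβ f.2.1 γ⟩
  map_add' f g := Subtype.ext
    (opS_add hV (Tame.smoothLocal f.2.1) (Tame.smoothLocal g.2.1))
  map_smul' c f := Subtype.ext (opS_smul hV (Tame.smoothLocal f.2.1) c)

/-- The generator as a linear map into `𝒞₀`. -/
def generator (hV : IsAdmissible V δm δp) (hβ : 0 < β) (γ : ℝ) :
    centred hV hβ →ₗ[ℝ] spaceC0 V β where
  toFun f := ⟨opL V γ f, opL_mem hV hβ f.2.1 γ⟩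
  map_add' f g := Subtype.ext <| by
    have hf := Tame.smoothLocal f.2.1
    have hg := Tame.smoothLocal g.2.1
    show opS V γ (f + g) + opA V (f + g) = (opS V γ f + opA V f) + (opS V γ g + opA V g)
    rw [opS_add hV hf hg, opA_add hf hg]
    abel
  map_smul' c f := Subtype.ext <| by
    have hf := Tame.smoothLocal f.2.1
    show opS V γ (c • (f : Config → ℝ)) + opA V (c • (f : Config → ℝ)) =
      c • (opS V γ f + opA V f)
    rw [opS_smul hV hf, opA_smul hf, smul_add]

variable (hV : IsAdmissible V δm δp) (hβ : 0 < β)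

/-- The representative of the symmetric part already lies in the test space, so the projection does
nothing. -/
theorem riesz_symmPart (f : centred hV hβ) :
    riesz hV hβ (symmPart hV hβ γ f) = -(γ / 2) • wvec V β f 0 := by
  have h : Represents V β (symmPart hV hβ γ f : Config → ℝ) _ := represents_opS hV hβ f.2.1
  rw [riesz_eq hV hβ h, Submodule.starProjection_eq_self_iff]
  exact Submodule.smul_mem _ _ (wvec_mem_testSpace hV hβ f.2 0)

theorem inner_wvec_generator_self (f : centred hV hβ) :
    inner ℝ (wvec V β f 0) (riesz hV hβ (generator hV hβ γ f)) =
      -(γ / 2) * ‖wvec V β f 0‖ ^ 2 := by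
  obtain ⟨M, hM⟩ := (Tame.smoothLocal f.2.1).exists_window (V := V)
  have h : Represents V β (generator hV hβ γ f : Config → ℝ) _ :=
    represents_opL hV hβ f.2.1 hM
  rw [riesz_eq hV hβ h, inner_starProjection hV hβ (wvec_mem_testSpace hV hβ f.2 0),
    inner_add_right, inner_wvec_opA_self hV hβ (tame_of_mem_centred f.2) hM, inner_smul_right,
    real_inner_self_eq_norm_sq, add_zero]

/-- By density of the test vectors the bound may be tested on `κ` itself. No sign is assumed for
`C`, and one divides by `‖κ‖`; hence the separate alternative `κ = 0`. -/
theorem norm_le_of_abs_inner_wvec_le {κ : PairL2 V β} (hκ : κ ∈ testSpace hV hβ) {C : ℝ}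
    (h : ∀ f ∈ centred hV hβ, ∀ a : ℝ, |inner ℝ (wvec V β f a) κ| ≤ C * ‖wvec V β f a‖) :
    ‖κ‖ ≤ C ∨ κ = 0 := by
  refine or_iff_not_imp_right.2 fun h0 => ?_
  have hcl : IsClosed {w : PairL2 V β | inner ℝ w κ ≤ C * ‖w‖} :=
    isClosed_le (by fun_prop) (by fun_prop)
  have h1 : inner ℝ κ κ ≤ C * ‖κ‖ := by
    refine closure_minimal ?_ hcl hκ
    rintro _ ⟨x, rfl⟩
    exact (le_abs_self _).trans (h x.1 x.1.2 x.2)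
  rw [real_inner_self_eq_norm_mul_norm] at h1
  exact le_of_mul_le_mul_right h1 (norm_pos_iff.2 h0)

theorem norm_riesz_generator_le (hγ : 0 < γ) (g : centred hV hβ) :
    ‖riesz hV hβ (generator hV hβ γ g)‖ ≤ (γ / 2 + 4 / √δm) * ‖wvec V β g 0‖ := by
  obtain ⟨M, hM⟩ := (Tame.smoothLocal g.2.1).exists_window (V := V)
  have h : Represents V β (generator hV hβ γ g : Config → ℝ) _ :=
    represents_opL hV hβ g.2.1 hM
  have hC : 0 ≤ (γ / 2 + 4 / √δm) * ‖wvec V β g 0‖ := by positivity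
  refine (norm_le_of_abs_inner_wvec_le hV hβ (riesz_mem hV hβ _) fun f hf a => ?_).elim id
    fun h => by rw [h, norm_zero]; exact hC
  rw [riesz_eq hV hβ h, inner_starProjection hV hβ (wvec_mem_testSpace hV hβ hf a),
    inner_add_right, inner_smul_right]
  refine (abs_add_le _ _).trans ?_
  have h1 := abs_inner_wvec_opA_le hV hβ (tame_of_mem_centred hf) (tame_of_mem_centred g.2) hM a
  have h2 := mul_le_mul_of_nonneg_left
    (abs_real_inner_le_norm (wvec V β f a) (wvec V β g 0)) (half_pos hγ).le
  rw [abs_mul, abs_neg, abs_of_pos (half_pos hγ)]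
  linarith

end Generator

/-! ### Decomposition of `ℋ₋₁` -/

section Decomposition

variable {V : ℝ → ℝ} {δm δp β γ : ℝ} {f : Config → ℝ}

theorem inner_toCompletion_eq (hV : IsAdmissible V δm δp) (hβ : 0 < β) (hγ : 0 < γ)
    (hB : IsSemiInner (form V β γ)) (g h : spaceC0 V β) :
    inner ℝ (toCompletion hB g) (toCompletion hB h) =
      2 / γ * inner ℝ (riesz hV hβ g) (riesz hV hβ h) := by
  rw [inner_toCompletion, form_eq hV hβ hγ]

theorem norm_toCompletion_eq (hV : IsAdmissible V δm δp) (hβ : 0 < β) (hγ : 0 < γ)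
    (hB : IsSemiInner (form V β γ)) (h : spaceC0 V β) :
    ‖toCompletion hB h‖ = √(2 / γ) * ‖riesz hV hβ h‖ := by
  rw [norm_eq_sqrt_real_inner, inner_toCompletion_eq hV hβ hγ, real_inner_self_eq_norm_sq,
    Real.sqrt_mul (by positivity), Real.sqrt_sq (norm_nonneg _)]

/-- Up to the factor `√(2 / γ)` the semi-norm of `ℋ₋₁` is that of the Riesz vectors, so closure
statements can be checked in `L² ⊕ L²`. -/
theorem toCompletion_mem_closure (hV : IsAdmissible V δm δp) (hβ : 0 < β) (hγ : 0 < γ)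
    (hB : IsSemiInner (form V β γ)) {S : Set (spaceC0 V β)} {h : spaceC0 V β}
    (hh : riesz hV hβ h ∈ closure (riesz hV hβ '' S)) :
    toCompletion hB h ∈ closure (toCompletion hB '' S) := by
  have h0 : 0 < √(2 / γ) := Real.sqrt_pos.2 (by positivity)
  rw [Metric.mem_closure_iff] at hh ⊢
  intro ε hε
  obtain ⟨_, ⟨t, ht, rfl⟩, hlt⟩ := hh (ε / √(2 / γ)) (by positivity)
  refine ⟨_, ⟨t, ht, rfl⟩, ?_⟩
  rw [dist_eq_norm, ← map_sub] at hlt ⊢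
  rw [norm_toCompletion_eq hV hβ hγ, mul_comm]
  exact (lt_div_iff₀ h0).1 hlt

/-- The symmetric part provides every `w(f, 0)`, and only the direction `w(0, 1)` is missing. The
vector of `p_1² - p_0²` supplies it, being orthogonal to all `w(f, 0)` but not to `w(0, 1)`. -/
theorem testSpace_le (hV : IsAdmissible V δm δp) (hβ : 0 < β) (hγ : 0 < γ)
    (hξ : gradP ∈ spaceC0 V β) {N : Submodule ℝ (PairL2 V β)}
    (hN : IsClosed (N : Set (PairL2 V β)))
    (hs : ∀ f, riesz hV hβ (symmPart hV hβ γ f) ∈ N) (hx : riesz hV hβ ⟨gradP, hξ⟩ ∈ N) :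
    testSpace hV hβ ≤ N := by
  have e0 : wvec V β 0 1 = wmap hV hβ (0, 1) := rfl
  set W₀ : Submodule ℝ (PairL2 V β) :=
    LinearMap.range (wmap hV hβ ∘ₗ LinearMap.inl ℝ (centred hV hβ) ℝ) with hW₀
  have hle : testSpace hV hβ ≤ (W₀ ⊔ Submodule.span ℝ {wvec V β 0 1}).topologicalClosure := by
    refine Submodule.topologicalClosure_mono ?_
    rintro _ ⟨⟨f, a⟩, rfl⟩
    have e : ((f, a) : centred hV hβ × ℝ) = LinearMap.inl ℝ (centred hV hβ) ℝ f + a • (0, 1) := by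
      simp
    rw [e, map_add, map_smul]
    exact Submodule.add_mem_sup ⟨f, rfl⟩ (Submodule.smul_mem _ _
      (Submodule.mem_span_singleton_self _))
  refine hle.trans (topologicalClosure_sup_span_le (hle (riesz_mem hV hβ _)) ?_ ?_ hN ?_ hx)
  · rintro _ ⟨f, rfl⟩
    refine (inner_wvec_riesz hV hβ f.2 0 ⟨gradP, hξ⟩).trans ?_
    rw [zero_mul, add_zero, pairStar_gradP hV hβ f.2]
  · rw [inner_wvec_riesz hV hβ (Submodule.zero_mem _) 1 ⟨gradP, hξ⟩,
      pairStar_gradP hV hβ (Submodule.zero_mem _), one_mul, zero_add]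
    exact pairStarStar_gradP_ne_zero hV hβ
  · rintro _ ⟨f, rfl⟩
    have h := N.smul_mem (-(γ / 2))⁻¹ (hs f)
    rw [riesz_symmPart, inv_smul_smul₀ (neg_ne_zero.2 (half_pos hγ).ne')] at h
    exact h

theorem topologicalClosure_symmPart_sup (hV : IsAdmissible V δm δp) (hβ : 0 < β) (hγ : 0 < γ)
    (hB : IsSemiInner (form V β γ)) (hξ : gradP ∈ spaceC0 V β) :
    (LinearMap.range (toCompletion hB ∘ₗ symmPart hV hβ γ) ⊔
      Submodule.span ℝ {toCompletion hB ⟨gradP, hξ⟩}).topologicalClosure = ⊤ := by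
  set T : Submodule ℝ (spaceC0 V β) :=
    LinearMap.range (symmPart hV hβ γ) ⊔ Submodule.span ℝ {⟨gradP, hξ⟩} with hT
  have e : LinearMap.range (toCompletion hB ∘ₗ symmPart hV hβ γ) ⊔
      Submodule.span ℝ {toCompletion hB ⟨gradP, hξ⟩} = T.map (toCompletion hB) := by
    rw [hT, Submodule.map_sup, LinearMap.range_comp, Submodule.map_span, Set.image_singleton]
  have hle : testSpace hV hβ ≤ (T.map (riesz hV hβ)).topologicalClosure := by
    refine testSpace_le hV hβ hγ hξ (Submodule.isClosed_topologicalClosure _) (fun f => ?_) ?_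
    · exact Submodule.le_topologicalClosure _
        ⟨_, Submodule.mem_sup_left (LinearMap.mem_range_self _ f), rfl⟩
    · exact Submodule.le_topologicalClosure _
        ⟨_, Submodule.mem_sup_right (Submodule.mem_span_singleton_self _), rfl⟩
  rw [e, eq_top_iff]
  intro x _
  refine closure_minimal ?_ (Submodule.isClosed_topologicalClosure _)
    (denseRange_toCompletion hB x)
  rintro _ ⟨h, rfl⟩
  exact toCompletion_mem_closure hV hβ hγ hB (S := T) (hle (riesz_mem hV hβ h))

theorem toCompletion_gradP_ne_zero (hV : IsAdmissible V δm δp) (hβ : 0 < β) (hγ : 0 < γ)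
    (hB : IsSemiInner (form V β γ)) (hξ : gradP ∈ spaceC0 V β) :
    toCompletion hB ⟨gradP, hξ⟩ ≠ 0 := by
  intro h0
  have h := norm_toCompletion_eq hV hβ hγ hB ⟨gradP, hξ⟩
  rw [h0, norm_zero, zero_eq_mul] at h
  have h1 := norm_eq_zero.1 (h.resolve_left (Real.sqrt_pos.2 (by positivity)).ne')
  have h2 := inner_wvec_riesz hV hβ (Submodule.zero_mem _) 1 ⟨gradP, hξ⟩
  rw [h1, inner_zero_right, pairStar_gradP hV hβ (Submodule.zero_mem _), one_mul, zero_add] at h2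
  exact pairStarStar_gradP_ne_zero hV hβ h2.symm

theorem isCompl_closure_range_generator (hV : IsAdmissible V δm δp) (hβ : 0 < β) (hγ : 0 < γ)
    (hB : IsSemiInner (form V β γ)) (hξ : gradP ∈ spaceC0 V β) :
    IsCompl (LinearMap.range (toCompletion hB ∘ₗ generator hV hβ γ)).topologicalClosure
      (Submodule.span ℝ {toCompletion hB ⟨gradP, hξ⟩}) := by
  have hγ2 := half_pos hγ
  have hn (f : centred hV hβ) :
      ‖toCompletion hB (symmPart hV hβ γ f)‖ = √(2 / γ) * (γ / 2 * ‖wvec V β f 0‖) := by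
    rw [norm_toCompletion_eq hV hβ hγ, riesz_symmPart, norm_smul, norm_neg,
      Real.norm_of_nonneg hγ2.le]
  -- The factor `2 / γ` in the constant converts `‖wvec V β f 0‖` back into the norm of the
  -- symmetric part.
  refine isCompl_closure_range (s := toCompletion hB ∘ₗ symmPart hV hβ γ)
    (C := (γ / 2 + 4 / √δm) * (2 / γ)) (toCompletion_gradP_ne_zero hV hβ hγ hB hξ) (fun f => ?_)
    (topologicalClosure_symmPart_sup hV hβ hγ hB hξ) (fun f => ?_) (by positivity) fun f => ?_
  · rw [LinearMap.comp_apply, inner_toCompletion_eq hV hβ hγ, riesz_symmPart,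
      real_inner_smul_left, inner_wvec_riesz hV hβ f.2, pairStar_gradP hV hβ f.2]
    ring
  · rw [LinearMap.comp_apply, LinearMap.comp_apply, hn, inner_toCompletion_eq hV hβ hγ,
      riesz_symmPart, real_inner_smul_left, inner_wvec_generator_self, mul_pow,
      Real.sq_sqrt (by positivity)]
    ring
  · rw [LinearMap.comp_apply, LinearMap.comp_apply, hn, norm_toCompletion_eq hV hβ hγ]
    refine (mul_le_mul_of_nonneg_left (norm_riesz_generator_le hV hβ hγ f)
      (Real.sqrt_nonneg _)).trans (le_of_eq ?_)
    field_simp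

/-- `L` is bounded relative to the test vector norm, so approximating `f` by elements of `𝒞` in that
norm also approximates `L f`. Hence the closure of `L𝒞` is that of the range of a linear map, and in
particular a subspace. -/
theorem closure_imageLC (hV : IsAdmissible V δm δp) (hβ : 0 < β) (hγ : 0 < γ)
    (hB : IsSemiInner (form V β γ)) :
    closure (imageLC V β γ hB) =
    ((LinearMap.range (toCompletion hB ∘ₗ generator hV hβ γ)).topologicalClosure :
      Set (HMinusOne V β γ hB)) := by
  refine subset_antisymm (closure_mono ?_) (closure_minimal ?_ isClosed_closure)
  · rintro _ ⟨g, hg, h, hh, rfl⟩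
    exact ⟨⟨g, spaceC_subset_centred hV hβ hg⟩, congrArg (toCompletion hB) (Subtype.ext hh.symm)⟩
  · rintro _ ⟨f, rfl⟩
    obtain ⟨g, hg, hlim⟩ := exists_seq_spaceC hV hβ f.2
    set S : Set (spaceC0 V β) := {h | ∃ g ∈ spaceC V β, (h : Config → ℝ) = opL V γ g} with hS
    have hsub : toCompletion hB '' S ⊆ imageLC V β γ hB := by
      rintro _ ⟨h, ⟨g, hg, hh⟩, rfl⟩
      exact ⟨g, hg, h, hh, rfl⟩
    refine closure_mono hsub (toCompletion_mem_closure hV hβ hγ hB ?_)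
    let g' (n : ℕ) : centred hV hβ := ⟨g n, spaceC_subset_centred hV hβ (hg n)⟩
    have hlim' : Tendsto (fun n => riesz hV hβ (generator hV hβ γ (f - g' n))) atTop (𝓝 0) := by
      refine squeeze_zero_norm (fun n => norm_riesz_generator_le hV hβ hγ _) ?_
      have := hlim.norm.const_mul (γ / 2 + 4 / √δm)
      rwa [norm_zero, mul_zero] at this
    refine mem_closure_of_tendsto (b := atTop) (f := fun n => riesz hV hβ (generator hV hβ γ (g' n)))
      ?_ (.of_forall fun n => ⟨_, ⟨g n, hg n, rfl⟩, rfl⟩)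
    simp only [map_sub] at hlim'
    have := tendsto_const_nhds (x := riesz hV hβ (generator hV hβ γ f)) |>.sub hlim'
    simpa using this

end Decomposition
end EnergyChain

end

/-! ### The decomposition theorem -/

open EnergyChain in
theorem mainTheorem8 (V : ℝ → ℝ) (δm δp : ℝ) (hV : IsAdmissible V δm δp)
    (β γ : ℝ) (hβ : 0 < β) (hγ : 0 < γ) :
    -- `L𝒞` and `p_1² - p_0²` lie in `𝒞₀`, and the semi-norm is finite on `𝒞₀`
    (∀ g ∈ spaceC V β, opL V γ g ∈ spaceC0 V β) ∧
    (∀ h ∈ spaceC0 V β, BddAbove (variationalSet V β γ h)) ∧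
    ∃ (hξ : gradP ∈ spaceC0 V β) (hB : IsSemiInner (form V β γ)),
      -- the form induces the semi-norm given by the variational formula
      (∀ h : spaceC0 V β, ‖toCompletion hB h‖ ^ 2 = normSq V β γ h) ∧
      -- direct sum decomposition of `ℋ₋₁`
      (∃ M : Submodule ℝ (HMinusOne V β γ hB),
        (M : Set (HMinusOne V β γ hB)) = closure (imageLC V β γ hB) ∧
        IsCompl M (Submodule.span ℝ {toCompletion hB ⟨gradP, hξ⟩})) ∧
      -- every element of `𝒞₀`
      ∀ g : spaceC0 V β, ∃! a : ℝ,
        toCompletion hB (g + a • (⟨gradP, hξ⟩ : spaceC0 V β)) ∈ closure (imageLC V β γ hB) := by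
  have hξ : gradP ∈ spaceC0 V β := gradP_mem hV hβ
  have hB := isSemiInner_form hV hβ hγ
  have hcompl := isCompl_closure_range_generator hV hβ hγ hB hξ
  refine ⟨fun g hg => opL_mem hV hβ (spaceC_subset_centred hV hβ hg).1 γ,
    fun h hh => (isLUB_variationalSet hV hβ hγ ⟨h, hh⟩).bddAbove, hξ, hB, fun h => ?_,
    ⟨_, (closure_imageLC hV hβ hγ hB).symm, hcompl⟩, fun g => ?_⟩
  · rw [norm_sq_toCompletion, form_eq hV hβ hγ, normSq_eq hV hβ hγ, real_inner_self_eq_norm_sq]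
  · simp only [map_add, map_smul]
    rw [closure_imageLC hV hβ hγ hB]
    exact existsUnique_add_smul_mem hcompl (toCompletion_gradP_ne_zero hV hβ hγ hB hξ)
      (toCompletion hB g)
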